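/- Let $G$ be a finite group; spaces are compactly generated. **$\Gamma_G$-spaces.** Let $\Gamma_G$ be the category of finite pointed $G$-sets (objects: a set $\{*,1,\dots,n\}$ with a $G$-action fixing $*$) and all pointed maps, with $G$ acting on $\Gamma_G(S,T)$ by conjugation. Write $\mathbf n=\{*,1,\dots,n\}$ with trivial action. A $\Gamma_G$-space is a $G$-functor $X$ from $\Gamma_G$ to $G$-spaces and all continuous maps, with $X(\mathbf 0)$ a point; the image of this point is the base point of each $X(S)$. For $s\in S\setminus\{*\}$ let $p_s:S\to\mathbf 1$ be the pointed map sending $s$ to $1$ and all other elements to $*$. $X$ is *special* if for every $S$ the $G$-map $X(S)\to \mathrm{Map}_*(S,X(\mathbf 1))$, $x\mapsto (s\mapsto X(p_s)(x))$, induces weak homotopy equivalences on $H$-fixed points for all subgroups $H\le G$. $X$ is *very special* if moreover, for every $H\le G$, the multiplication $$\pi_0(X(\mathbf 1)^H)^2\xleftarrow{\ (p_1,p_2)\ \cong\ }\pi_0(X(\mathbf 2)^H)\xrightarrow{\ \mu\ }\pi_0(X(\mathbf 1)^H)$$ makes $\pi_0(X(\mathbf 1)^H)$ a group, where $\mu(1)=\mu(2)=1$.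 **$\Gamma_G$-$\mathcal O(G)$-spaces.** Let $\mathcal O(G)$ be the orbit category. For a $G$-space $W$ put $\Phi W(G/H)=\mathrm{Map}_G(G/H,W)\cong W^H$. A $\Gamma_G$-$\mathcal O(G)$-space $F$ is an $\mathcal O(G)$-enriched functor from $\Gamma_G$ to based $\mathcal O(G)^{op}$-diagrams of spaces, with $F(\mathbf 0)$ a point; that is, it has maps $\Phi(\Gamma_G(S,T))(G/H)\times F(S)(G/H)\to F(T)(G/H)$, natural in $G/H$, unital and associative. Every $\Gamma_G$-space $X$ gives such an object $\Phi X$. **Units.** Let $U\pi_0F(S)(G/H)\subseteq \pi_0(F(S)(G/H))$ be the set of all $(\mathrm{id}\wedge p_1)_*(d)$ with $d\in\pi_0(F(S\wedge\mathbf 2)(G/H))$ such that $(\mathrm{id}\wedge\mu)_*(d)$ is the component of the base point. Let $UF(S)(G/H)$ be the homotopy pullback of $F(S)(G/H)\to\pi_0(F(S)(G/H))\leftarrow U\pi_0F(S)(G/H)$ (with discrete sets of components), i.e. the space of those points of $F(S)(G/H)$ whose path component lies in $U\pi_0F(S)(G/H)$. Then $UF$ is a $\Gamma_G$-$\mathcal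 O(G)$-space. For a $\Gamma_G$-space $X$ put $UX=U(\Phi X)$. **The coalescence functor $\mathbf C$.** It is the left derived functor of the left adjoint of $\Phi$, given by the following bar construction. Let $\mathcal D$ have objects $(S,G/H)$ and morphisms $$\mathcal D((S,G/H),(T,G/K))=\mathcal O(G)(G/K,G/H)\times\Phi(\Gamma_G(S,T))(G/K),$$ composed by $(\beta,f')\circ(\alpha,f)=(\alpha\beta,\,f'\circ\beta^*f)$, so that a $\Gamma_G$-$\mathcal O(G)$-space $F$ is a covariant functor on $\mathcal D$; let $M_T(S,G/H)=G/H\times\Gamma_G(S,T)$, a $G$-set contravariant in $(S,G/H)\in\mathcal D$ by $(\alpha,f)^*(c,h)=(\alpha(c),h\circ f(c))$. Then $(\mathbf CF)(T)$ is the based two-sided bar construction $B(F,\mathcal D,M_T)$: the geometric realization of the simplicial space whose $n$-simplices are triples of a chain $A_0\to\dots\to A_n$ in $\mathcal D$, a point $x\in F(A_0)$ and an element $(c,h)\in M_T(A_n)$, where all points of simplices for which $x$ is the base point, or $h$ is the constant map to $*$, or one of the maps $A_i\to A_{i+1}$ has as its component in $\Phi(\Gamma_G(-,-))$ the constant map to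 $*$, are identified with one base point. It is a $\Gamma_G$-space through the variable $M_T$. **Statement.** If $X$ is a special $\Gamma_G$-space, then $\mathbf CUX$ is a very special $\Gamma_G$-space. -/

import Mathlib

open CategoryTheory Topology

universe u

namespace EquivGamma

noncomputable section

/-! ### Compactly generated topologies -/

/-- A continuous map from a compact Hausdorff space stays continuous for the k-ified topology. -/
theorem continuous_to_kification {X : Type u} (t : TopologicalSpace X) (S : CompHaus.{u})
    (g : S → X) (hg : Continuous g) :
    @Continuous S X _ (@TopologicalSpace.compactlyGenerated.{u} X t) g := by
  let f : (Σ i : (S' : CompHaus.{u}) × C(S', X), i.fst) → X := fun p => p.1.2 p.2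
  have h1 : @Continuous _ X _ (@TopologicalSpace.compactlyGenerated.{u} X t) f :=
    continuous_coinduced_rng
  have h2 : Continuous (Sigma.mk (β := fun i : (S' : CompHaus.{u}) × C(S', X) => i.fst)
      ⟨S, ⟨g, hg⟩⟩) := continuous_sigmaMk
  exact @Continuous.comp _ _ _ _ _ (@TopologicalSpace.compactlyGenerated.{u} X t)
    (Sigma.mk (β := fun i : (S' : CompHaus.{u}) × C(S', X) => i.fst) ⟨S, ⟨g, hg⟩⟩) f h1 h2

/-- The compactly generated refinement ("k-ification") of a topology is compactly generated. -/
theorem cg_kification (X : Type u) (t : TopologicalSpace X) :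
    @CompactlyGeneratedSpace X (@TopologicalSpace.compactlyGenerated.{u} X t) := by
  refine @UCompactlyGeneratedSpace.mk.{u} X (@TopologicalSpace.compactlyGenerated.{u} X t) ?_
  refine continuous_id_iff_le.1 ?_
  refine @continuous_from_compactlyGenerated.{u} X X t
    (@TopologicalSpace.compactlyGenerated.{u} X (@TopologicalSpace.compactlyGenerated.{u} X t))
    id fun S g => ?_
  exact continuous_to_kification _ S g (continuous_to_kification t S g g.continuous)

/-- K-ification is functorial. -/
theorem continuous_kification {X Y : Type u} (tX : TopologicalSpace X) (tY : TopologicalSpace Y)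
    (f : X → Y) (hf : Continuous f) :
    @Continuous X Y (@TopologicalSpace.compactlyGenerated.{u} X tX)
      (@TopologicalSpace.compactlyGenerated.{u} Y tY) f :=
  @continuous_from_compactlyGenerated.{u} X Y tX
    (@TopologicalSpace.compactlyGenerated.{u} Y tY) f fun S g =>
    continuous_to_kification tY S _ (hf.comp g.continuous)

/-- The product of a compactly generated space and a compact Hausdorff space is compactly
generated. -/
theorem cg_prod_compact (X : Type u) (K : Type) [TopologicalSpace X] [TopologicalSpace K]
    [CompactlyGeneratedSpace X] [CompactSpace K] [T2Space K] :
    CompactlyGeneratedSpace (X × K) := by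
  refine compactlyGeneratedSpace_of_continuous_maps fun {Z} _ f hf => ?_
  have hslice : ∀ x, Continuous fun k => f (x, k) := fun x => by
    have := hf (ULift.{u} K) (fun k => (x, k.down)) (by fun_prop)
    exact this.comp continuous_uliftUp
  let F : X → C(K, Z) := fun x => ⟨fun k => f (x, k), hslice x⟩
  have hF : Continuous F := by
    refine continuous_from_compactlyGeneratedSpace F fun S _ _ _ g hg => ?_
    refine ContinuousMap.continuous_of_continuous_uncurry _ ?_
    exact hf (S × K) (fun p => (g p.1, p.2)) (by fun_prop)
  exact ContinuousMap.continuous_uncurry_of_continuous ⟨F, hF⟩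

/-! ### Weak homotopy equivalences -/

section Weak

variable {X Y : Type u} [TopologicalSpace X] [TopologicalSpace Y]

/-- The map induced on path components. -/
def pi0Map (f : C(X, Y)) : ZerothHomotopy X → ZerothHomotopy Y :=
  ZerothHomotopy.lift (fun x => ZerothHomotopy.mk (f x)) fun _ _ p =>
    ZerothHomotopy.sound (p.map f.continuous)

/-- The map induced on homotopy groups. -/
def piMap (n : ℕ) (f : C(X, Y)) (x : X) :
    HomotopyGroup.Pi n X x → HomotopyGroup.Pi n Y (f x) :=
  Quotient.map (fun p => ⟨f.comp p.1, fun y hy => congrArg f (p.2 y hy)⟩)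
    fun _ _ h => h.map fun H => H.compContinuousMap f

/-- Weak homotopy equivalences. -/
def IsWeakEquiv (f : C(X, Y)) : Prop :=
  Function.Bijective (pi0Map f) ∧ ∀ n x, Function.Bijective (piMap (n + 1) f x)

end Weak

section Fixed

variable {G : Type u} [Group G] {X Y : Type u} [TopologicalSpace X] [TopologicalSpace Y]
  [MulAction G X] [MulAction G Y]

/-- The map `X^H → Y^H` of fixed point spaces induced by a `G`-map `X → Y`. -/
def fixedMap (f : C(X, Y)) (hf : ∀ (g : G) x, f (g • x) = g • f x) (H : Subgroup G) :
    C(MulAction.fixedPoints H X, MulAction.fixedPoints H Y) where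
  toFun x := ⟨f x.1, fun h => by
    have := x.2 h
    rw [Subgroup.smul_def] at this ⊢
    rw [← hf, this]⟩
  continuous_toFun := by fun_prop

/-- `G`-weak equivalences: `G`-maps inducing weak equivalences on all fixed point spaces. -/
def IsGWeakEquiv (f : C(X, Y)) (hf : ∀ (g : G) x, f (g • x) = g • f x) : Prop :=
  ∀ H : Subgroup G, IsWeakEquiv (fixedMap f hf H)

end Fixed

/-! ### The category `Γ_G` -/

/-- A finite pointed `G`-set with underlying set `{*, 0, …, n-1}`. -/
structure GammaObj (G : Type u) [Group G] where
  n : ℕ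
  ρ : G →* Equiv.Perm (Fin n)

variable {G : Type u} [Group G]

namespace GammaObj

/-- The underlying set; `none` is the marked point. -/
def carrier (S : GammaObj G) : Type := Option (Fin S.n)

/-- The marked point. -/
def pt (S : GammaObj G) : S.carrier := (none : Option (Fin S.n))

/-- The elements different from the marked point. -/
def el (S : GammaObj G) (i : Fin S.n) : S.carrier := (some i : Option (Fin S.n))

instance (S : GammaObj G) : DecidableEq S.carrier := inferInstanceAs (DecidableEq (Option _))

instance (S : GammaObj G) : MulAction G S.carrier where
  smul g s := Option.map (S.ρ g) s
  one_smul s := by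
    change Option.map (S.ρ 1) s = s
    cases s <;> simp
  mul_smul g h s := by
    change Option.map (S.ρ (g * h)) s = Option.map (S.ρ g) (Option.map (S.ρ h) s)
    cases s <;> simp

@[simp] theorem smul_pt (S : GammaObj G) (g : G) : g • S.pt = S.pt := rfl

/-- The set `{*, 0, …, m-1}` with trivial action. -/
def num (G : Type u) [Group G] (m : ℕ) : GammaObj G := ⟨m, 1⟩

/-- The smash product of `S` with the set `{*, 0, …, m-1}` with trivial action; its elements other
than the marked point are the pairs of such elements of the factors. -/
def smash (S : GammaObj G) (m : ℕ) : GammaObj G where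
  n := S.n * m
  ρ :=
    { toFun := fun g =>
        (finProdFinEquiv.symm.trans ((S.ρ g).prodCongr (Equiv.refl _))).trans finProdFinEquiv
      map_one' := by
        refine Equiv.ext fun i => ?_
        obtain ⟨p, rfl⟩ := finProdFinEquiv.surjective i
        simp [-finProdFinEquiv_apply_val, -finProdFinEquiv_symm_apply]
      map_mul' := fun g h => by
        refine Equiv.ext fun i => ?_
        obtain ⟨p, rfl⟩ := finProdFinEquiv.surjective i
        simp [-finProdFinEquiv_apply_val, -finProdFinEquiv_symm_apply, Prod.map] }

end GammaObj

/-- Morphisms of `Γ_G`: all maps of pointed sets, not only the equivariant ones. -/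
@[ext] structure GammaHom (S T : GammaObj G) where
  toFun : S.carrier → T.carrier
  map_pt : toFun S.pt = T.pt

namespace GammaHom

variable {S T U : GammaObj G}

/-- Identity. -/
def id (S : GammaObj G) : GammaHom S S := ⟨fun s => s, rfl⟩

/-- The composite `f' ∘ f`. -/
def comp (f' : GammaHom T U) (f : GammaHom S T) : GammaHom S U :=
  ⟨fun s => f'.toFun (f.toFun s), by rw [f.map_pt, f'.map_pt]⟩

/-- The constant map to the marked point. -/
def zero (S T : GammaObj G) : GammaHom S T := ⟨fun _ => T.pt, rfl⟩

/-- `G` acts on the morphisms of `Γ_G` by conjugation. -/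
instance : MulAction G (GammaHom S T) where
  smul g f := ⟨fun s => g • f.toFun (g⁻¹ • s), by simp [f.map_pt]⟩
  one_smul f := by
    ext s
    change (1 : G) • f.toFun ((1 : G)⁻¹ • s) = _
    simp
  mul_smul g h f := by
    ext s
    change (g * h) • f.toFun ((g * h)⁻¹ • s) = g • (h • f.toFun (h⁻¹ • g⁻¹ • s))
    simp [mul_smul]

theorem smul_toFun (g : G) (f : GammaHom S T) (s : S.carrier) :
    (g • f).toFun s = g • f.toFun (g⁻¹ • s) := rfl

theorem smul_comp (g : G) (f' : GammaHom T U) (f : GammaHom S T) :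
    g • f'.comp f = (g • f').comp (g • f) := by
  ext s
  simp [smul_toFun, comp]

theorem smul_id (g : G) : g • GammaHom.id S = GammaHom.id S := by
  ext s
  simp [smul_toFun, GammaHom.id]

theorem smul_zero (g : G) : g • GammaHom.zero S T = GammaHom.zero S T := by
  ext s
  simp [smul_toFun, zero]

theorem comp_zero (f' : GammaHom T U) : f'.comp (zero S T) = zero S U := by
  ext s
  exact f'.map_pt

/-- The projection `p_s : S → 1`, sending `s` to the element `1` and all other elements to the
marked point. -/
def proj (S : GammaObj G) (i : Fin S.n) : GammaHom S (GammaObj.num G 1) where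
  toFun t := if t = S.el i then (GammaObj.num G 1).el (0 : Fin 1) else (GammaObj.num G 1).pt
  map_pt := by
    rw [if_neg]
    exact fun h : (none : Option (Fin S.n)) = some i => by simp at h

theorem smul_proj (S : GammaObj G) (g : G) (i : Fin S.n) :
    g • proj S i = proj S (S.ρ g i) := by
  ext t
  have key : g⁻¹ • t = S.el i ↔ t = S.el (S.ρ g i) := by
    rw [inv_smul_eq_iff]
    rfl
  have triv : ∀ t : (GammaObj.num G 1).carrier, g • t = t := fun t => by
    change Option.map _ t = t
    cases t <;> rfl
  rw [smul_toFun, triv]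
  simp only [proj, key]

/-- The map `μ : 2 → 1` sending both elements other than the marked point to the element `1`. -/
def mu (G : Type u) [Group G] : GammaHom (GammaObj.num G 2) (GammaObj.num G 1) :=
  ⟨fun t => Option.map (fun _ : Fin 2 => (0 : Fin 1)) t, rfl⟩

theorem smul_mu (g : G) : g • mu G = mu G := by
  ext t
  cases t <;> rfl

/-- `id ∧ μ : S ∧ 2 → S ∧ 1 = S`. -/
def smashMu (S : GammaObj G) : GammaHom (S.smash 2) S :=
  ⟨fun t => Option.map (fun k : Fin (S.n * 2) => (finProdFinEquiv.symm k).1) t, rfl⟩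

/-- `id ∧ p₁ : S ∧ 2 → S ∧ 1 = S`. -/
def smashFst (S : GammaObj G) : GammaHom (S.smash 2) S :=
  ⟨fun t => Option.bind t fun k : Fin (S.n * 2) =>
    if (finProdFinEquiv.symm k).2 = 0 then some (finProdFinEquiv.symm k).1 else none, rfl⟩

/-- `f ∧ id : S ∧ 2 → T ∧ 2`. -/
def smashMap (f : GammaHom S T) : GammaHom (S.smash 2) (T.smash 2) :=
  ⟨fun t => Option.bind t fun k : Fin (S.n * 2) =>
    Option.map (fun j : Fin T.n => finProdFinEquiv (j, (finProdFinEquiv.symm k).2))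
      (f.toFun (S.el (finProdFinEquiv.symm k).1)), rfl⟩

/-- Elements of `S ∧ 2` other than the marked point. -/
theorem smash_cases {P : (S.smash 2).carrier → Prop} (h0 : P (S.smash 2).pt)
    (h1 : ∀ i j, P ((S.smash 2).el (finProdFinEquiv (i, j)))) (t) : P t := by
  rcases t with _ | k
  · exact h0
  · have := h1 (finProdFinEquiv.symm k).1 (finProdFinEquiv.symm k).2
    rwa [Prod.mk.eta, show finProdFinEquiv (finProdFinEquiv.symm k) = k from
      finProdFinEquiv.apply_symm_apply k] at this

theorem smashMu_el (i : Fin S.n) (j : Fin 2) :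
    (smashMu S).toFun ((S.smash 2).el (finProdFinEquiv (i, j))) = S.el i := by
  change some (finProdFinEquiv.symm (finProdFinEquiv (i, j))).1 = some i
  rw [Equiv.symm_apply_apply]

theorem smashFst_el (i : Fin S.n) (j : Fin 2) :
    (smashFst S).toFun ((S.smash 2).el (finProdFinEquiv (i, j))) =
      if j = 0 then S.el i else S.pt := by
  change (if _ then _ else _) = _
  rw [Equiv.symm_apply_apply]
  rfl

/-- The element `(s, j)` of `S ∧ 2`. -/
def pair (s : S.carrier) (j : Fin 2) : (S.smash 2).carrier :=
  Option.map (fun i : Fin S.n => finProdFinEquiv (i, j)) s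

theorem smul_pair (g : G) (s : S.carrier) (j : Fin 2) : g • pair s j = pair (g • s) j := by
  rcases s with _ | i
  · rfl
  · change some _ = some _
    congr 1
    change finProdFinEquiv (Prod.map (S.ρ g) (fun x => x)
      (finProdFinEquiv.symm (finProdFinEquiv (i, j)))) = _
    rw [Equiv.symm_apply_apply]
    rfl

theorem pair_el (i : Fin S.n) (j : Fin 2) :
    (S.smash 2).el (finProdFinEquiv (i, j)) = pair (S.el i) j := rfl

theorem smashMap_pair (f : GammaHom S T) (s : S.carrier) (j : Fin 2) :
    (smashMap f).toFun (pair s j) = pair (f.toFun s) j := by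
  rcases s with _ | i
  · have : f.toFun none = T.pt := f.map_pt
    rw [this]
    rfl
  · change Option.map _ _ = Option.map _ _
    rw [Equiv.symm_apply_apply]
    rfl

theorem smashMu_pair (s : S.carrier) (j : Fin 2) : (smashMu S).toFun (pair s j) = s := by
  rcases s with _ | i
  · rfl
  · exact smashMu_el i j

theorem smashFst_pair (s : S.carrier) (j : Fin 2) :
    (smashFst S).toFun (pair s j) = if j = 0 then s else S.pt := by
  rcases s with _ | i
  · change S.pt = if j = 0 then S.pt else S.pt
    rw [ite_self]
  · exact smashFst_el i j

theorem pair_cases {P : (S.smash 2).carrier → Prop} (h : ∀ s j, P (pair s j)) (t) : P t :=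
  smash_cases (h S.pt 0) (fun i j => h (S.el i) j) t

theorem smul_smashMu (g : G) : g • smashMu S = smashMu S := by
  ext t
  induction t using pair_cases with
  | h s j => rw [smul_toFun, smul_pair, smashMu_pair, smashMu_pair, smul_inv_smul]

theorem smul_smashFst (g : G) : g • smashFst S = smashFst S := by
  ext t
  induction t using pair_cases with
  | h s j =>
    rw [smul_toFun, smul_pair, smashFst_pair, smashFst_pair]
    split_ifs
    · rw [smul_inv_smul]
    · rfl

theorem smul_smashMap (g : G) (f : GammaHom S T) : g • smashMap f = smashMap (g • f) := by
  ext t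
  induction t using pair_cases with
  | h s j => rw [smul_toFun, smul_pair, smashMap_pair, smul_pair, smashMap_pair, smul_toFun]

theorem smashMu_smashMap (f : GammaHom S T) :
    (smashMu T).comp (smashMap f) = f.comp (smashMu S) := by
  ext t
  induction t using pair_cases with
  | h s j => simp only [comp, smashMap_pair, smashMu_pair]

theorem smashFst_smashMap (f : GammaHom S T) :
    (smashFst T).comp (smashMap f) = f.comp (smashFst S) := by
  ext t
  induction t using pair_cases with
  | h s j =>
    simp only [comp, smashMap_pair, smashFst_pair]
    split_ifs
    · rfl
    · exact f.map_pt.symm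

end GammaHom

/-! ### `Γ_G`-spaces -/

/-- A `Γ_G`-space: a `G`-functor from `Γ_G` to (compactly generated) `G`-spaces whose value at `0`
is a point. The images of that point are the base points of the other values; all maps preserve
them. -/
structure GammaGSpace (G : Type u) [Group G] where
  obj : GammaObj G → Type u
  [top : ∀ S, TopologicalSpace (obj S)]
  [cg : ∀ S, CompactlyGeneratedSpace (obj S)]
  [act : ∀ S, MulAction G (obj S)]
  continuous_act : ∀ S (g : G), Continuous fun x : obj S => g • x
  map : ∀ {S T}, GammaHom S T → C(obj S, obj T)
  map_id : ∀ S x, map (GammaHom.id S) x = x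
  map_comp : ∀ {S T U} (f' : GammaHom T U) (f : GammaHom S T) x,
    map (f'.comp f) x = map f' (map f x)
  map_smul : ∀ {S T} (g : G) (f : GammaHom S T) x, map (g • f) x = g • map f (g⁻¹ • x)
  zero : Unique (obj (GammaObj.num G 0))

namespace GammaGSpace

attribute [instance] top cg act

variable (X : GammaGSpace G)

/-- The base point. -/
def base (S : GammaObj G) : X.obj S := X.map (GammaHom.zero _ S) X.zero.default

theorem map_equivariant {S T : GammaObj G} (f : GammaHom S T) (hf : ∀ g : G, g • f = f)
    (g : G) (x : X.obj S) : X.map f (g • x) = g • X.map f x := by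
  conv_lhs => rw [← hf g, X.map_smul, inv_smul_smul]

theorem smul_base (S : GammaObj G) (g : G) : g • X.base S = X.base S := by
  rw [base, ← X.map_equivariant _ GammaHom.smul_zero]
  congr 1
  exact X.zero.uniq _

/-- The space of all based maps `S → X(1)`, with `G` acting by conjugation. -/
def Maps (S : GammaObj G) : Type u :=
  {φ : S.carrier → X.obj (GammaObj.num G 1) // φ S.pt = X.base _}

instance (S : GammaObj G) : TopologicalSpace (X.Maps S) :=
  inferInstanceAs (TopologicalSpace (Subtype _))

instance (S : GammaObj G) : MulAction G (X.Maps S) where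
  smul g φ := ⟨fun s => g • φ.1 (g⁻¹ • s), by
    change g • φ.1 S.pt = _
    rw [show φ.1 S.pt = X.base _ from φ.2, X.smul_base]⟩
  one_smul φ := by
    refine Subtype.ext (funext fun s => ?_)
    change (1 : G) • φ.1 ((1 : G)⁻¹ • s) = _
    simp
  mul_smul g h φ := by
    refine Subtype.ext (funext fun s => ?_)
    change (g * h) • φ.1 ((g * h)⁻¹ • s) = g • (h • φ.1 (h⁻¹ • g⁻¹ • s))
    simp [mul_smul]

/-- The adjoint `X(S) → Map(S, X(1))`, `x ↦ (s ↦ X(p_s)(x))`, of the map induced by the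
projections. -/
def segal (S : GammaObj G) : C(X.obj S, X.Maps S) where
  toFun x := ⟨fun s => Option.elim s (X.base _) fun i => X.map (GammaHom.proj S i) x, rfl⟩
  continuous_toFun := by
    refine Continuous.subtype_mk (continuous_pi fun s => ?_) _
    rcases s with _ | i
    · exact continuous_const
    · exact (X.map (GammaHom.proj S i)).continuous

theorem segal_equivariant (S : GammaObj G) (g : G) (x : X.obj S) :
    X.segal S (g • x) = g • X.segal S x := by
  refine Subtype.ext (funext fun s => ?_)
  rcases s with _ | i
  · exact (X.smul_base _ g).symm
  · change X.map (GammaHom.proj S i) (g • x) = g • X.map (GammaHom.proj S (S.ρ g⁻¹ i)) x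
    rw [← GammaHom.smul_proj, X.map_smul, smul_inv_smul, inv_inv]

/-- Special `Γ_G`-spaces: `X(S) → Map(S, X(1))` is a `G`-weak equivalence for every `S`. -/
def IsSpecial : Prop := ∀ S, IsGWeakEquiv (X.segal S) (X.segal_equivariant S)

/-- The map `π₀(X(S)^H) → π₀(X(T)^H)` induced by an equivariant map `S → T`. -/
def pi0Fixed {S T : GammaObj G} (f : GammaHom S T) (hf : ∀ g : G, g • f = f) (H : Subgroup G) :
    ZerothHomotopy (MulAction.fixedPoints H (X.obj S)) →
      ZerothHomotopy (MulAction.fixedPoints H (X.obj T)) :=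
  pi0Map (fixedMap (X.map f) (X.map_equivariant f hf) H)

theorem smul_proj_num (m : ℕ) (i : Fin m) (g : G) :
    g • GammaHom.proj (GammaObj.num G m) i = GammaHom.proj (GammaObj.num G m) i :=
  GammaHom.smul_proj (GammaObj.num G m) g i

/-- Very special `Γ_G`-spaces: special ones such that for every subgroup `H` the multiplication
`π₀(X(1)^H) × π₀(X(1)^H) ← π₀(X(2)^H) → π₀(X(1)^H)`, given by `(p₁, p₂)` (a bijection) and `μ`, is
a group structure. -/
def IsVerySpecial : Prop :=
  X.IsSpecial ∧ ∀ H : Subgroup G,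
    ∃ _ : Group (ZerothHomotopy (MulAction.fixedPoints H (X.obj (GammaObj.num G 1)))),
      ∀ d : ZerothHomotopy (MulAction.fixedPoints H (X.obj (GammaObj.num G 2))),
        X.pi0Fixed (GammaHom.proj _ (0 : Fin 2)) (smul_proj_num 2 0) H d *
            X.pi0Fixed (GammaHom.proj _ (1 : Fin 2)) (smul_proj_num 2 1) H d =
          X.pi0Fixed (GammaHom.mu G) GammaHom.smul_mu H d

end GammaGSpace

/-! ### `Γ_G`-`𝒪(G)`-spaces -/

/-- `Φ` applied to the `G`-set `Γ_G(S, T)`, evaluated at `G/H`. -/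
abbrev PhiHom (H : Subgroup G) (S T : GammaObj G) : Type u := (G ⧸ H) →[G] GammaHom S T

namespace PhiHom

variable {H K : Subgroup G} {S T U : GammaObj G}

/-- The constant map at an equivariant map `S → T`. -/
def const (H : Subgroup G) (f : GammaHom S T) (hf : ∀ g : G, g • f = f) : PhiHom H S T :=
  ⟨fun _ => f, fun g _ => (hf g).symm⟩

/-- Composition. -/
def comp (f' : PhiHom H T U) (f : PhiHom H S T) : PhiHom H S U :=
  ⟨fun c => (f' c).comp (f c), fun g c => by
    rw [map_smul, map_smul]
    exact (GammaHom.smul_comp g _ _).symm⟩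

/-- Restriction along a map of orbits. -/
def pull (f : PhiHom H S T) (α : (G ⧸ K) →[G] (G ⧸ H)) : PhiHom K S T :=
  MulActionHom.comp f α

/-- `f ∧ id`. -/
def smash (f : PhiHom H S T) : PhiHom H (S.smash 2) (T.smash 2) :=
  ⟨fun c => (f c).smashMap, fun g c => by
    rw [map_smul]
    exact (GammaHom.smul_smashMap g _).symm⟩

end PhiHom

/-- A `Γ_G`-`𝒪(G)`-space: an `𝒪(G)`-enriched functor `F` from `Γ_G` to based `𝒪(G)`-spaces, with
`F(0)` a point. Here `res` is the contravariant functoriality of the `𝒪(G)`-space `F(S)`, whose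
value at `G/H` is `obj S H`, and the enriched functoriality is given in the adjoint form
`Φ(Γ_G(S, T)) × F(S) → F(T)`, a map of `𝒪(G)`-spaces. -/
structure GammaOSpace (G : Type u) [Group G] where
  obj : GammaObj G → Subgroup G → Type u
  [top : ∀ S H, TopologicalSpace (obj S H)]
  [cg : ∀ S H, CompactlyGeneratedSpace (obj S H)]
  res : ∀ {S : GammaObj G} {H K : Subgroup G}, ((G ⧸ K) →[G] (G ⧸ H)) → C(obj S H, obj S K)
  res_id : ∀ {S : GammaObj G} {H : Subgroup G} (x : obj S H), res (MulActionHom.id G) x = x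
  res_comp : ∀ {S : GammaObj G} {H K L : Subgroup G} (α : (G ⧸ K) →[G] (G ⧸ H)) (β : (G ⧸ L) →[G] (G ⧸ K)) (x : obj S H),
    res (α.comp β) x = res β (res α x)
  map : ∀ {S T : GammaObj G} {H : Subgroup G}, PhiHom H S T → C(obj S H, obj T H)
  map_id : ∀ {S : GammaObj G} {H : Subgroup G} (x : obj S H), map (PhiHom.const H (GammaHom.id S) GammaHom.smul_id) x = x
  map_comp : ∀ {S T U : GammaObj G} {H : Subgroup G} (f' : PhiHom H T U) (f : PhiHom H S T) (x : obj S H),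
    map (f'.comp f) x = map f' (map f x)
  res_map : ∀ {S T : GammaObj G} {H K : Subgroup G} (α : (G ⧸ K) →[G] (G ⧸ H)) (f : PhiHom H S T) (x : obj S H),
    res α (map f x) = map (f.pull α) (res α x)
  zero : ∀ H, Unique (obj (GammaObj.num G 0) H)

namespace GammaOSpace

attribute [instance] top cg

variable (F : GammaOSpace G)

/-- The base point. -/
def base (S : GammaObj G) (H : Subgroup G) : F.obj S H :=
  F.map (PhiHom.const H (GammaHom.zero _ S) GammaHom.smul_zero) (F.zero H).default

theorem map_base {S T : GammaObj G} {H : Subgroup G} (f : PhiHom H S T) :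
    F.map f (F.base S H) = F.base T H := by
  rw [base, ← F.map_comp]
  congr 2
  refine MulActionHom.ext fun c => ?_
  exact GammaHom.comp_zero _

theorem res_base {S : GammaObj G} {H K : Subgroup G} (α : (G ⧸ K) →[G] (G ⧸ H)) :
    F.res α (F.base S H) = F.base S K := by
  rw [base, F.res_map]
  have := (F.zero K).uniq (F.res α (F.zero H).default)
  rw [this]
  rfl

end GammaOSpace

/-! ### Fixed point systems -/

/-- `Φ(W)(G/H) = G𝒯(G/H, W) ≅ W^H` for a `G`-space `W`. -/
def Phi (G : Type u) [Group G] (W : Type u) [MulAction G W] (H : Subgroup G) : Type u :=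
  (G ⧸ H) →[G] W

namespace Phi

variable {W W' : Type u} [MulAction G W] [MulAction G W'] [TopologicalSpace W]
  [TopologicalSpace W'] {H K : Subgroup G}

/-- The values of an element. -/
def val (x : Phi G W H) : (G ⧸ H) → W := MulActionHom.toFun x

/-- The topology of pointwise convergence, i.e. that of `W^H ⊆ W`, before k-ification. -/
abbrev preTop (G : Type u) [Group G] (W : Type u) [MulAction G W] [TopologicalSpace W]
    (H : Subgroup G) : TopologicalSpace (Phi G W H) :=
  TopologicalSpace.induced Phi.val inferInstance

instance : TopologicalSpace (Phi G W H) :=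
  @TopologicalSpace.compactlyGenerated.{u} _ (preTop G W H)

instance : CompactlyGeneratedSpace (Phi G W H) := cg_kification _ (preTop G W H)

theorem continuous_of_pointwise (F : Phi G W H → Phi G W' K)
    (hF : ∀ c : G ⧸ K, ∃ (c' : G ⧸ H) (f : C(W, W')), ∀ x, (F x).val c = f (x.val c')) :
    Continuous F := by
  refine continuous_kification (preTop G W H) (preTop G W' K) F ?_
  let _ := preTop G W H
  refine continuous_induced_rng.2 (continuous_pi fun c => ?_)
  obtain ⟨c', f, h⟩ := hF c
  have : Continuous fun x : Phi G W H => f (x.val c') :=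
    f.continuous.comp ((continuous_apply c').comp continuous_induced_dom)
  exact this.congr fun x => (h x).symm

end Phi

/-- The `Γ_G`-`𝒪(G)`-space `Φ X` of a `Γ_G`-space `X`. -/
def phi (X : GammaGSpace G) : GammaOSpace G where
  obj S H := Phi G (X.obj S) H
  res {S H K} α :=
    { toFun := fun x => MulActionHom.comp x α
      continuous_toFun := Phi.continuous_of_pointwise _ fun c =>
        ⟨α c, ContinuousMap.id _, fun _ => rfl⟩ }
  res_id _ := MulActionHom.ext fun _ => rfl
  res_comp _ _ _ := MulActionHom.ext fun _ => rfl
  map {S T H} f :=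
    { toFun := fun x => MulActionHom.mk (fun c => X.map (f c) (x.val c)) fun g c => by
        have h1 : x.val (g • c) = g • x.val c := x.map_smul' g c
        have h2 : f (g • c) = g • f c := f.map_smul' g c
        rw [h1, h2, X.map_smul, inv_smul_smul]
        rfl
      continuous_toFun := Phi.continuous_of_pointwise _ fun c => ⟨c, X.map (f c), fun _ => rfl⟩ }
  map_id _ := MulActionHom.ext fun _ => X.map_id _ _
  map_comp _ _ _ := MulActionHom.ext fun _ => X.map_comp _ _ _
  res_map _ _ _ := MulActionHom.ext fun _ => rfl
  zero H :=
    { default := MulActionHom.mk (fun _ => X.zero.default) fun _ _ => (X.zero.uniq _).symm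
      uniq := fun _ => MulActionHom.ext fun _ => X.zero.uniq _ }

/-! ### Units -/

theorem pi0Map_comp {X Y Z : Type u} [TopologicalSpace X] [TopologicalSpace Y]
    [TopologicalSpace Z] (f : C(X, Y)) (f' : C(Y, Z)) (c : ZerothHomotopy X) :
    pi0Map f' (pi0Map f c) = pi0Map (f'.comp f) c := by
  induction c with
  | mk x => rfl

namespace GammaOSpace

variable (F : GammaOSpace G)

/-- The units `U(π₀ F)(S)(G/H) ⊆ π₀(F(S)(G/H))`: the image under `id ∧ p₁` of the pullback of
`π₀(F(S ∧ 2)(G/H)) → π₀(F(S ∧ 1)(G/H)) ← π₀(F(S ∧ 0)(G/H)) = *`, where the first map is `id ∧ μ`. -/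
def unitComponents (S : GammaObj G) (H : Subgroup G) : Set (ZerothHomotopy (F.obj S H)) :=
  {c | ∃ d : ZerothHomotopy (F.obj (S.smash 2) H),
    pi0Map (F.map (PhiHom.const H (GammaHom.smashMu S) GammaHom.smul_smashMu)) d =
        ZerothHomotopy.mk (F.base S H) ∧
      pi0Map (F.map (PhiHom.const H (GammaHom.smashFst S) GammaHom.smul_smashFst)) d = c}

theorem base_mem (S : GammaObj G) (H : Subgroup G) :
    ZerothHomotopy.mk (F.base S H) ∈ F.unitComponents S H :=
  ⟨ZerothHomotopy.mk (F.base _ H), congrArg ZerothHomotopy.mk (F.map_base _),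
    congrArg ZerothHomotopy.mk (F.map_base _)⟩

theorem map_mem {S T : GammaObj G} {H : Subgroup G} (f : PhiHom H S T)
    {c : ZerothHomotopy (F.obj S H)} (hc : c ∈ F.unitComponents S H) :
    pi0Map (F.map f) c ∈ F.unitComponents T H := by
  obtain ⟨d, h1, rfl⟩ := hc
  refine ⟨pi0Map (F.map f.smash) d, ?_, ?_⟩
  · rw [← F.map_base f]
    refine Eq.trans ?_ (congrArg (pi0Map (F.map f)) h1)
    rw [pi0Map_comp, pi0Map_comp]
    congr 1
    refine ContinuousMap.ext fun x => ?_
    change F.map _ (F.map _ x) = F.map _ (F.map _ x)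
    rw [← F.map_comp, ← F.map_comp]
    congr 2
    exact MulActionHom.ext fun c => GammaHom.smashMu_smashMap _
  · rw [pi0Map_comp, pi0Map_comp]
    congr 1
    refine ContinuousMap.ext fun x => ?_
    change F.map _ (F.map _ x) = F.map _ (F.map _ x)
    rw [← F.map_comp, ← F.map_comp]
    congr 2
    exact MulActionHom.ext fun c => GammaHom.smashFst_smashMap _

theorem res_mem {S : GammaObj G} {H K : Subgroup G} (α : (G ⧸ K) →[G] (G ⧸ H))
    {c : ZerothHomotopy (F.obj S H)} (hc : c ∈ F.unitComponents S H) :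
    pi0Map (F.res α) c ∈ F.unitComponents S K := by
  obtain ⟨d, h1, rfl⟩ := hc
  refine ⟨pi0Map (F.res α) d, ?_, ?_⟩
  · rw [← F.res_base α]
    refine Eq.trans ?_ (congrArg (pi0Map (F.res α)) h1)
    rw [pi0Map_comp, pi0Map_comp]
    congr 1
    exact ContinuousMap.ext fun x => (F.res_map α (PhiHom.const H _ GammaHom.smul_smashMu) x).symm
  · rw [pi0Map_comp, pi0Map_comp]
    congr 1
    exact ContinuousMap.ext fun x =>
      (F.res_map α (PhiHom.const H _ GammaHom.smul_smashFst) x).symm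

/-- The homotopy pullback of `F(S)(G/H) → π₀(F(S)(G/H)) ← U(π₀ F)(S)(G/H)`. As the sets of
components are discrete, their paths are constant, and the homotopy pullback consists of the points
`x` of `F(S)(G/H)` whose component is a unit: a union of path components of `F(S)(G/H)`. -/
def UnitsObj (S : GammaObj G) (H : Subgroup G) : Type u :=
  {x : F.obj S H // ZerothHomotopy.mk x ∈ F.unitComponents S H}

/-- The subspace topology, before k-ification. -/
abbrev unitsPreTop (S : GammaObj G) (H : Subgroup G) : TopologicalSpace (F.UnitsObj S H) :=
  TopologicalSpace.induced Subtype.val inferInstance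

instance (S : GammaObj G) (H : Subgroup G) : TopologicalSpace (F.UnitsObj S H) :=
  @TopologicalSpace.compactlyGenerated.{u} _ (F.unitsPreTop S H)

instance (S : GammaObj G) (H : Subgroup G) : CompactlyGeneratedSpace (F.UnitsObj S H) :=
  cg_kification _ (F.unitsPreTop S H)

/-- A map preserving unit components restricts to the homotopy pullbacks. -/
def unitsMap {S T : GammaObj G} {H K : Subgroup G} (f : C(F.obj S H, F.obj T K))
    (hf : ∀ c ∈ F.unitComponents S H, pi0Map f c ∈ F.unitComponents T K) :
    C(F.UnitsObj S H, F.UnitsObj T K) where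
  toFun x := ⟨f x.1, hf _ x.2⟩
  continuous_toFun := by
    refine continuous_kification (F.unitsPreTop S H) (F.unitsPreTop T K) _ ?_
    let _ := F.unitsPreTop S H
    exact continuous_induced_rng.2 (f.continuous.comp continuous_induced_dom)

/-- The units `U F` of a `Γ_G`-`𝒪(G)`-space. -/
def units : GammaOSpace G where
  obj := F.UnitsObj
  res α := F.unitsMap (F.res α) fun _ => F.res_mem α
  res_id x := Subtype.ext (F.res_id x.1)
  res_comp α β x := Subtype.ext (F.res_comp α β x.1)
  map f := F.unitsMap (F.map f) fun _ => F.map_mem f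
  map_id x := Subtype.ext (F.map_id x.1)
  map_comp f' f x := Subtype.ext (F.map_comp f' f x.1)
  res_map α f x := Subtype.ext (F.res_map α f x.1)
  zero H :=
    { default := ⟨F.base _ H, F.base_mem _ H⟩
      uniq := fun _ => Subtype.ext (((F.zero H).uniq _).trans ((F.zero H).uniq _).symm) }

end GammaOSpace

/-! ### The coalescence functor `C`

The functor `Φ` from `Γ_G`-spaces to `Γ_G`-`𝒪(G)`-spaces has the left adjoint `F ↦ F(-)(G/e)`. The
coalescence functor is its left derived functor, given by the two-sided bar construction
`B(F, 𝒟, M)` of based spaces. Here `𝒟` is the category of pairs `(S, G/H)` with morphisms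
`𝒟((S, G/H), (T, G/K)) = 𝒪(G)(G/K, G/H) × Φ(Γ_G(S, T))(G/K)`; a `Γ_G`-`𝒪(G)`-space is a functor on
it. For each `T`, the `G`-set `M(S, G/H)(T) = (G/H) × Γ_G(S, T)` is contravariant in `(S, G/H)`;
as a functor of `T` it is the left adjoint applied to the functor represented by `(S, G/H)`. All
morphisms with zero component in `Γ_G` are identified with the base point. -/

/-- Objects `(S, G/H)` of `𝒟`. -/
structure OrbObj (G : Type u) [Group G] where
  S : GammaObj G
  H : Subgroup G

/-- Morphisms of `𝒟`. -/
@[ext] structure OrbHom (A B : OrbObj G) where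
  orb : (G ⧸ B.H) →[G] (G ⧸ A.H)
  hom : PhiHom B.H A.S B.S

instance : Category (OrbObj G) where
  Hom := OrbHom
  id A := ⟨MulActionHom.id G, PhiHom.const A.H (GammaHom.id A.S) GammaHom.smul_id⟩
  comp φ ψ := ⟨φ.orb.comp ψ.orb, ψ.hom.comp (φ.hom.pull ψ.orb)⟩
  id_comp _ := rfl
  comp_id _ := rfl
  assoc _ _ _ := rfl

/-- The morphisms of `𝒟` that are identified with the base point. -/
def OrbHom.IsTrivial {A B : OrbObj G} (φ : OrbHom A B) : Prop :=
  ∀ c, φ.hom c = GammaHom.zero A.S B.S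

/-- The functoriality of a `Γ_G`-`𝒪(G)`-space on `𝒟`. -/
def GammaOSpace.actOn (F : GammaOSpace G) {A B : OrbObj G} (φ : A ⟶ B) :
    C(F.obj A.S A.H, F.obj B.S B.H) :=
  (F.map (OrbHom.hom φ)).comp (F.res (OrbHom.orb φ))

/-- `M(A)(T)`; it carries the diagonal action of `G`. -/
abbrev Corep (T : GammaObj G) (A : OrbObj G) : Type u := (G ⧸ A.H) × GammaHom A.S T

namespace Corep

variable {T T' : GammaObj G} {A B : OrbObj G}

/-- Contravariant functoriality in `A`. -/
def pull (φ : A ⟶ B) (p : Corep T B) : Corep T A :=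
  (OrbHom.orb φ p.1, p.2.comp (OrbHom.hom φ p.1))

/-- Functoriality in `T`. -/
def push (f : GammaHom T T') (p : Corep T A) : Corep T' A := (p.1, f.comp p.2)

theorem smul_pull (g : G) (φ : A ⟶ B) (p : Corep T B) : g • pull φ p = pull φ (g • p) := by
  refine Prod.ext (map_smul (OrbHom.orb φ) g p.1).symm ?_
  change g • p.2.comp (OrbHom.hom φ p.1) = (g • p.2).comp (OrbHom.hom φ (g • p.1))
  rw [GammaHom.smul_comp, map_smul]

end Corep

namespace GammaOSpace

variable (F : GammaOSpace G)

/-- The index set of `n`-simplices of the bar construction: a chain `A₀ → ⋯ → Aₙ` in `𝒟` and an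
element of `M(Aₙ)(T)`. -/
structure BarIndex (T : GammaObj G) where
  n : ℕ
  chain : ComposableArrows (OrbObj G) n
  last : Corep T (chain.obj (Fin.last n))

/-- The disjoint union over all indices of `F(A₀) × Δⁿ`. -/
abbrev BarPre (T : GammaObj G) : Type u :=
  Σ i : BarIndex T, F.obj (i.chain.obj 0).S (i.chain.obj 0).H × stdSimplex ℝ (Fin (i.n + 1))

/-- The points that represent the base point: one of the factors is a base point. -/
def IsCollapsed {T : GammaObj G} (a : F.BarPre T) : Prop :=
  a.2.1 = F.base _ _ ∨
    (∃ j : Fin a.1.n, OrbHom.IsTrivial (a.1.chain.map (homOfLE (Fin.castSucc_le_succ j)))) ∨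
      a.1.last.2 = GammaHom.zero _ T

/-- The relation defining the geometric realization: `(θ^* y, t) ∼ (y, θ_* t)` for all monotone maps
`θ` and simplices `y`, and all points that represent the base point are identified. -/
inductive BarRel (T : GammaObj G) : F.BarPre T → F.BarPre T → Prop
  | simplicial {m n : ℕ} (θ : Fin (m + 1) →o Fin (n + 1)) (A : ComposableArrows (OrbObj G) n)
      (p : Corep T (A.obj (Fin.last n))) (x : F.obj (A.obj 0).S (A.obj 0).H)
      (t : stdSimplex ℝ (Fin (m + 1))) :
      BarRel T
        ⟨⟨m, θ.monotone.functor ⋙ A,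
            Corep.pull (A.map (homOfLE (Fin.le_last (θ (Fin.last m))))) p⟩,
          F.actOn (A.map (homOfLE (Fin.zero_le (θ 0)))) x, t⟩
        ⟨⟨n, A, p⟩, x, stdSimplex.map θ t⟩
  | collapse (a b : F.BarPre T) : F.IsCollapsed a → F.IsCollapsed b → BarRel T a b

/-- The realization of the bar construction. -/
def Bar (T : GammaObj G) : Type u := Quot (F.BarRel T)

instance (T : GammaObj G) : TopologicalSpace (F.Bar T) :=
  inferInstanceAs (TopologicalSpace (Quot (F.BarRel T)))

instance (T : GammaObj G) : CompactlyGeneratedSpace (F.Bar T) := by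
  have : ∀ i : BarIndex T, CompactlyGeneratedSpace
      (F.obj (i.chain.obj 0).S (i.chain.obj 0).H × stdSimplex ℝ (Fin (i.n + 1))) :=
    fun i => cg_prod_compact _ _
  exact compactlyGeneratedSpace_of_coinduced (f := Quot.mk (F.BarRel T)) continuous_quot_mk rfl

/-- The map of bar constructions induced by a map in the variable `M`. -/
def barMap {T T' : GammaObj G} (κ : ∀ A : OrbObj G, Corep T A → Corep T' A)
    (hκ : ∀ {A B : OrbObj G} (φ : A ⟶ B) p, κ A (Corep.pull φ p) = Corep.pull φ (κ B p))
    (h0 : ∀ A p, p.2 = GammaHom.zero A.S T → (κ A p).2 = GammaHom.zero A.S T') :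
    C(F.Bar T, F.Bar T') where
  toFun := Quot.map (fun a => ⟨⟨a.1.n, a.1.chain, κ _ a.1.last⟩, a.2⟩) fun a b h => by
    cases h with
    | @simplicial m n θ A p x t =>
      have key : ∀ q : Corep T' (A.obj (θ (Fin.last m))),
          q = Corep.pull (A.map (homOfLE (Fin.le_last (θ (Fin.last m))))) (κ _ p) →
          F.BarRel T' ⟨⟨m, θ.monotone.functor ⋙ A, q⟩,
            F.actOn (A.map (homOfLE (Fin.zero_le (θ 0)))) x, t⟩
            ⟨⟨n, A, κ _ p⟩, x, stdSimplex.map θ t⟩ := by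
        rintro _ rfl
        exact BarRel.simplicial θ A (κ _ p) x t
      exact key _ (hκ _ _)
    | collapse a b ha hb =>
      exact BarRel.collapse _ _ (ha.imp_right (Or.imp_right (h0 _ _)))
        (hb.imp_right (Or.imp_right (h0 _ _)))
  continuous_toFun := by
    refine continuous_quot_lift _ (continuous_quot_mk.comp ?_)
    refine continuous_sigma fun i => ?_
    exact continuous_sigmaMk (ι := BarIndex T') (σ := fun i => F.obj (i.chain.obj 0).S
      (i.chain.obj 0).H × stdSimplex ℝ (Fin (i.n + 1))) (i := ⟨i.n, i.chain, κ _ i.last⟩)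

/-- The map of bar constructions induced by a morphism of `Γ_G`. -/
def barPush {T T' : GammaObj G} (f : GammaHom T T') : C(F.Bar T, F.Bar T') :=
  F.barMap (fun _ => Corep.push f) (fun _ _ => rfl) fun A p h => by
    change f.comp p.2 = _
    rw [h, GammaHom.comp_zero]

/-- The action of an element of `G` on the bar construction. -/
def barSmul (T : GammaObj G) (g : G) : C(F.Bar T, F.Bar T) :=
  F.barMap (fun _ p => g • p) (fun φ p => Corep.smul_pull g φ p) fun A p h => by
    change g • p.2 = _
    rw [h, GammaHom.smul_zero]

instance (T : GammaObj G) : MulAction G (F.Bar T) where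
  smul g z := F.barSmul T g z
  one_smul := by
    rintro ⟨⟨n, A, p⟩, y⟩
    change Quot.mk _ (⟨⟨n, A, (1 : G) • p⟩, y⟩ : F.BarPre T) = _
    rw [one_smul]
  mul_smul g h := by
    rintro ⟨⟨n, A, p⟩, y⟩
    change Quot.mk _ (⟨⟨n, A, (g * h) • p⟩, y⟩ : F.BarPre T) =
      Quot.mk _ (⟨⟨n, A, g • h • p⟩, y⟩ : F.BarPre T)
    rw [mul_smul]

/-- The `Γ_G`-space `C F`. -/
def coalescence : GammaGSpace G where
  obj := F.Bar
  continuous_act T g := (F.barSmul T g).continuous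
  map := F.barPush
  map_id := by
    rintro T ⟨⟨n, A, p⟩, y⟩
    rfl
  map_comp := by
    rintro S T U f' f ⟨⟨n, A, p⟩, y⟩
    rfl
  map_smul := by
    rintro S T g f ⟨⟨n, A, p⟩, y⟩
    change Quot.mk _ (⟨⟨n, A, Corep.push (g • f) p⟩, y⟩ : F.BarPre T) =
      Quot.mk _ (⟨⟨n, A, g • Corep.push f (g⁻¹ • p)⟩, y⟩ : F.BarPre T)
    have : Corep.push (g • f) p = g • Corep.push f (g⁻¹ • p) := by
      refine Prod.ext (smul_inv_smul g p.1).symm ?_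
      change (g • f).comp p.2 = g • f.comp (g⁻¹ • p.2)
      rw [GammaHom.smul_comp, smul_inv_smul]
    rw [this]
  zero :=
    { default := Quot.mk _ ⟨⟨0, ComposableArrows.mk₀ ⟨GammaObj.num G 0, ⊤⟩,
        ((1 : G), GammaHom.zero _ _)⟩, F.base _ _, stdSimplex.vertex 0⟩
      uniq := by
        rintro ⟨⟨⟨n, A, p⟩, y⟩⟩
        refine Quot.sound (BarRel.collapse _ _ (Or.inr (Or.inr ?_)) (Or.inl rfl))
        refine GammaHom.ext (funext fun s => ?_)
        exact Subsingleton.elim (α := Option (Fin 0)) _ _ }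

end GammaOSpace

end

end EquivGamma

/-!
The point is that the `K`-fixed points of the coalescence `C F` can be computed: a `K`-fixed simplex
of `B(F, 𝒟, M_T)` is a chain `A₀ → ⋯ → Aₙ` with a `K`-fixed element of `M_T(Aₙ)`, and such an
element is a morphism `Aₙ → (T, G/K)` of `𝒟`. So `(C F)(T)^K` is the bar construction of `F` with a
representable functor, and it contracts onto `F(T)(G/K)` by adding the terminal vertex `(T, G/K)` to
the chains. This works on the point-set level, without cofibrancy hypotheses: the augmentation
`(C F)(T)^K → F(T)(G/K)` has a section onto which its source deforms along the fibres
(`GammaOSpace.isFiberRetraction_aug`). The topological input is that the `K`-fixed points of the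
realization have the quotient topology from the `K`-fixed simplices
(`GammaOSpace.isQuotientMap_fixMk`). The augmentation is natural (`GammaOSpace.aug_barPush`).

Hence `C U X` is special as soon as the maps `U X(T)(G/K) → ∏ U X(1)(G/K_i)` are weak equivalences,
where `i` runs through representatives of the `K`-orbits of `T` and `K_i` is the stabilizer. These
maps are restrictions of the corresponding maps of `X` to unions of path components, and as `X` is
special it suffices that a point of `X(T)^K` is a unit if all its projections to `X(1)` are units
(`GammaGSpace.IsSpecial.isUnitPt`): inverses of the projections assemble to an inverse in
`X(T ∧ 2)^K`.

For the group structure, every special `Γ_G`-space gives an associative and unital multiplication on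
`π₀(X(1)^H)` (`GammaGSpace.IsSpecial.exists_group`), so only right inverses are needed. A component
of `(C U X)(1)^H` lies over a unit of `X(1)^H`, hence is the first projection of a point `d` of
`X(1 ∧ 2)^H` with trivial product. Both projections of `d` are units, so `d` is a unit itself and
lifts to `(C U X)(1 ∧ 2)^H` (`GammaGSpace.IsSpecial.exists_inverse`).
-/

namespace EquivGamma

section

open scoped unitInterval

/-! ### Weak homotopy equivalences -/

section WeakEquiv

variable {X Y Z W : Type u} [TopologicalSpace X] [TopologicalSpace Y] [TopologicalSpace Z]
  [TopologicalSpace W]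

theorem mk_eq_mk_iff_joined {x y : X} :
    ZerothHomotopy.mk x = ZerothHomotopy.mk y ↔ Joined x y :=
  ⟨fun h => Quotient.exact h, fun ⟨p⟩ => ZerothHomotopy.sound p⟩

theorem joined_map (f : C(X, Y)) {x x' : X} (h : Joined x x') : Joined (f x) (f x') :=
  h.elim fun p => ⟨p.map f.continuous⟩

/-- A map that is bijective on all homotopy groups in positive degrees, at all base points. -/
def IsPiBijective (f : C(X, Y)) : Prop :=
  ∀ n x, Function.Bijective (piMap (n + 1) f x)

theorem piMap_comp (n : ℕ) (g : C(Y, Z)) (f : C(X, Y)) (x : X) :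
    piMap n (g.comp f) x = piMap n g (f x) ∘ piMap n f x :=
  funext fun c => Quotient.inductionOn c fun _ => rfl

theorem pi0Map_comp' (g : C(Y, Z)) (f : C(X, Y)) : pi0Map (g.comp f) = pi0Map g ∘ pi0Map f :=
  funext fun c => (pi0Map_comp f g c).symm

theorem IsPiBijective.comp {g : C(Y, Z)} {f : C(X, Y)} (hg : IsPiBijective g)
    (hf : IsPiBijective f) : IsPiBijective (g.comp f) := fun n x => by
  rw [piMap_comp]
  exact (hg n _).comp (hf n x)

theorem IsPiBijective.of_comp {g : C(Y, Z)} {f : C(X, Y)} (hg : IsPiBijective g)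
    (hgf : IsPiBijective (g.comp f)) : IsPiBijective f := fun n x => by
  have h := hgf n x
  rw [piMap_comp] at h
  exact (Function.Bijective.of_comp_iff' (hg n (f x)) _).1 h

theorem IsWeakEquiv.comp {g : C(Y, Z)} {f : C(X, Y)} (hg : IsWeakEquiv g)
    (hf : IsWeakEquiv f) : IsWeakEquiv (g.comp f) := by
  refine ⟨?_, IsPiBijective.comp hg.2 hf.2⟩
  rw [pi0Map_comp']
  exact hg.1.comp hf.1

theorem IsWeakEquiv.of_comp {g : C(Y, Z)} {f : C(X, Y)} (hg : IsWeakEquiv g)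
    (hgf : IsWeakEquiv (g.comp f)) : IsWeakEquiv f := by
  refine ⟨?_, IsPiBijective.of_comp hg.2 hgf.2⟩
  have h := hgf.1
  rw [pi0Map_comp'] at h
  exact (Function.Bijective.of_comp_iff' hg.1 _).1 h

theorem IsWeakEquiv.joined_iff {f : C(X, Y)} (hf : IsWeakEquiv f) {x x' : X} :
    Joined (f x) (f x') ↔ Joined x x' := by
  rw [← mk_eq_mk_iff_joined, ← mk_eq_mk_iff_joined]
  exact hf.1.1.eq_iff (a := ZerothHomotopy.mk x) (b := ZerothHomotopy.mk x')

theorem IsWeakEquiv.exists_joined {f : C(X, Y)} (hf : IsWeakEquiv f) (y : Y) :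
    ∃ x, Joined (f x) y := by
  obtain ⟨c, hc⟩ := hf.1.2 (ZerothHomotopy.mk y)
  induction c with
  | mk x => exact ⟨x, mk_eq_mk_iff_joined.1 hc⟩

/-! ### Inclusions of path components -/

/-- Up to a change of topology that compact Hausdorff test spaces do not see, `f` is the inclusion
of a union of path components. -/
structure IsPathInclusion (f : C(X, Y)) : Prop where
  injective : Function.Injective f
  lift : ∀ {K : Type} [TopologicalSpace K] [CompactSpace K] [T2Space K] (g : K → X),
    Continuous (f ∘ g) → Continuous g
  mem_range : ∀ x y, Joined (f x) y → y ∈ Set.range f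

theorem IsPathInclusion.joined {f : C(X, Y)} (hf : IsPathInclusion f) {x x' : X}
    (h : Joined (f x) (f x')) : Joined x x' := by
  obtain ⟨p⟩ := h
  have hp : ∀ t, p t ∈ Set.range f := fun t =>
    hf.mem_range x _ ⟨(p.truncateOfLE t.2.1).cast (by simp) (by simp)⟩
  choose q hq using hp
  refine ⟨⟨⟨q, hf.lift q ?_⟩, ?_, ?_⟩⟩
  · rw [show f ∘ q = p from funext hq]
    exact p.continuous
  · exact hf.injective ((hq 0).trans p.source)
  · exact hf.injective ((hq 1).trans p.target)

theorem IsPathInclusion.comp {g : C(Y, Z)} {f : C(X, Y)} (hg : IsPathInclusion g)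
    (hf : IsPathInclusion f) : IsPathInclusion (g.comp f) where
  injective := hg.injective.comp hf.injective
  lift k hk := hf.lift _ (hg.lift _ hk)
  mem_range x z h := by
    obtain ⟨y, rfl⟩ := hg.mem_range _ z h
    obtain ⟨x', rfl⟩ := hf.mem_range x y (hg.joined h)
    exact ⟨x', rfl⟩

theorem IsPathInclusion.pi {ι : Type} {A B : ι → Type u} [∀ i, TopologicalSpace (A i)]
    [∀ i, TopologicalSpace (B i)] {f : ∀ i, C(A i, B i)} (hf : ∀ i, IsPathInclusion (f i)) :
    IsPathInclusion (ContinuousMap.mk (fun x : ∀ i, A i => fun i => f i (x i))) where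
  injective x y h := funext fun i => (hf i).injective (congrFun h i)
  lift g hg := continuous_pi fun i => (hf i).lift _ ((continuous_apply i).comp hg)
  mem_range x y h := by
    have := fun i => (hf i).mem_range (x i) (y i) (h.elim fun p => ⟨p.map (continuous_apply i)⟩)
    choose z hz using this
    exact ⟨z, funext hz⟩

theorem joined_zero_cube {N : Type} (y : I^N) : Joined 0 y :=
  ⟨⟨⟨fun t i => t * y i, by fun_prop⟩, by ext; simp, by ext; simp⟩⟩

/-- Maps from path connected compact Hausdorff spaces that hit the image somewhere lift. -/
theorem IsPathInclusion.exists_lift {f : C(X, Y)} (hf : IsPathInclusion f) {K : Type}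
    [TopologicalSpace K] [CompactSpace K] [T2Space K] (g : C(K, Y)) (k₀ : K) (x : X)
    (hx : f x = g k₀) (hK : ∀ k, Joined k₀ k) : ∃ g' : C(K, X), ∀ k, f (g' k) = g k := by
  have hp : ∀ k, g k ∈ Set.range f := fun k =>
    hf.mem_range x _ (hx ▸ (hK k).elim fun p => ⟨p.map g.continuous⟩)
  choose q hq using hp
  refine ⟨⟨q, hf.lift q ?_⟩, hq⟩
  rw [show f ∘ q = g from funext hq]
  exact g.continuous

theorem IsPathInclusion.isPiBijective {f : C(X, Y)} (hf : IsPathInclusion f) :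
    IsPiBijective f := by
  refine fun n x => ⟨fun a b => ?_, fun b => ?_⟩
  · refine Quotient.inductionOn₂ a b fun p q h => Quotient.sound ?_
    obtain ⟨H⟩ : GenLoop.Homotopic _ _ := Quotient.exact h
    obtain ⟨H', hH'⟩ := hf.exists_lift (K := I × (Fin (n + 1) → I)) H.toHomotopy.toContinuousMap
      (0, 0) (p.1 0) (H.map_zero_left 0).symm
      fun k => (joined_zero_cube (N := Fin 1) fun _ => k.1).elim fun r =>
        (joined_zero_cube k.2).elim fun s =>
        ⟨((r.map (continuous_apply 0)).prod s).cast rfl rfl⟩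
    refine ⟨⟨⟨H', ?_, ?_⟩, ?_⟩⟩
    · exact fun y => hf.injective ((hH' _).trans (H.map_zero_left y))
    · exact fun y => hf.injective ((hH' _).trans (H.map_one_left y))
    · exact fun t y hy => hf.injective ((hH' _).trans (H.prop' t y hy))
  · refine Quotient.inductionOn b fun p => ?_
    have h0 : (0 : Fin (n + 1) → I) ∈ Cube.boundary (Fin (n + 1)) := ⟨0, Or.inl rfl⟩
    obtain ⟨p', hp'⟩ := hf.exists_lift p.1 0 x (p.2 0 h0).symm joined_zero_cube
    refine ⟨Quotient.mk _ ⟨p', fun y hy => hf.injective ((hp' y).trans (p.2 y hy))⟩, ?_⟩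
    refine congrArg (Quotient.mk _) (Subtype.ext (ContinuousMap.ext hp'))

/-- A map `v` between unions of path components that is induced by a weak equivalence `f` is a weak
equivalence, if `f` hits no further components of the target. -/
theorem IsPathInclusion.isWeakEquiv_of_square {i : C(X, Y)} {j : C(Z, W)} {f : C(Y, W)}
    {v : C(X, Z)} (hi : IsPathInclusion i) (hj : IsPathInclusion j) (hf : IsWeakEquiv f)
    (hsq : j.comp v = f.comp i)
    (hrange : ∀ y z, Joined (f y) (j z) → y ∈ Set.range i) : IsWeakEquiv v := by
  refine ⟨⟨fun a b => ?_, fun b => ?_⟩, ?_⟩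
  · induction a with
    | mk a =>
    induction b with
    | mk b =>
    intro h
    have h1 : Joined (v a) (v b) := mk_eq_mk_iff_joined.1 h
    have h2 : Joined ((j.comp v) a) ((j.comp v) b) := joined_map j h1
    rw [hsq] at h2
    exact mk_eq_mk_iff_joined.2 (hi.joined (hf.joined_iff.1 h2))
  · induction b with
    | mk z =>
    obtain ⟨y, hy⟩ := hf.exists_joined (j z)
    obtain ⟨x, rfl⟩ := hrange y z hy
    refine ⟨ZerothHomotopy.mk x, mk_eq_mk_iff_joined.2 (hj.joined ?_)⟩
    have : Joined ((j.comp v) x) (j z) := by rwa [hsq]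
    exact this
  · exact IsPiBijective.of_comp hj.isPiBijective
      (hsq ▸ IsPiBijective.comp hf.2 hi.isPiBijective)

/-! ### Fibrewise deformation retractions -/

/-- The map `f` has a section onto which the source deforms along the fibres of `f`. -/
def IsFiberRetraction (f : C(X, Y)) : Prop :=
  ∃ (sec : C(Y, X)) (h : C(X × I, X)), (∀ y, f (sec y) = y) ∧ (∀ x, h (x, 0) = x) ∧
    (∀ x, h (x, 1) = sec (f x)) ∧ ∀ x s, f (h (x, s)) = f x

theorem IsFiberRetraction.pi {ι : Type} {A B : ι → Type u} [∀ i, TopologicalSpace (A i)]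
    [∀ i, TopologicalSpace (B i)] {f : ∀ i, C(A i, B i)} (hf : ∀ i, IsFiberRetraction (f i)) :
    IsFiberRetraction (ContinuousMap.mk (fun x : ∀ i, A i => fun i => f i (x i))) := by
  choose sec h h1 h2 h3 h4 using hf
  exact ⟨⟨fun y i => sec i (y i), by fun_prop⟩, ⟨fun p i => h i (p.1 i, p.2), by fun_prop⟩,
    fun y => funext fun i => h1 i _, fun x => funext fun i => h2 i _,
    fun x => funext fun i => h3 i _, fun x s => funext fun i => h4 i _ _⟩

theorem IsFiberRetraction.of_homeomorph (e : X ≃ₜ Y) : IsFiberRetraction (e : C(X, Y)) :=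
  ⟨e.symm, ⟨fun p => p.1, by fun_prop⟩, fun y => e.apply_symm_apply y, fun _ => rfl,
    fun x => (e.symm_apply_apply x).symm, fun _ _ => rfl⟩

end WeakEquiv

/-! ### Collars of cubes -/

section Collar

variable {N : Type}

/-- At `s = 0` the identity; at `s = 1` the map expanding the subcube of side `1/2` around the
centre to the whole cube. -/
noncomputable def expand (s : I) (y : I^N) : I^N :=
  fun i => Set.projIcc (0 : ℝ) 1 zero_le_one ((1 + s) * y i - s / 2)

theorem continuous_expand : Continuous fun p : I × (I^N) => expand p.1 p.2 :=
  continuous_pi fun i => continuous_projIcc.comp (by fun_prop)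

theorem expand_zero (y : I^N) : expand 0 y = y := by
  funext i
  simp [expand]

theorem expand_boundary (s : I) {y : I^N} (hy : y ∈ Cube.boundary N) :
    expand s y ∈ Cube.boundary N := by
  obtain ⟨i, h | h⟩ := hy
  · refine ⟨i, Or.inl (Set.projIcc_of_le_left _ ?_)⟩
    rw [h]
    have := s.2.1
    simp only [Set.Icc.coe_zero]
    linarith
  · refine ⟨i, Or.inr (Set.projIcc_of_right_le _ ?_)⟩
    rw [h]
    have := s.2.1
    simp only [Set.Icc.coe_one]
    linarith

/-- A collar coordinate: it vanishes on the boundary of the cube and is `1` on the subcube of side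
`1/2` around the centre. -/
noncomputable def collar [Fintype N] (y : I^N) : I :=
  ∏ i, Set.projIcc (0 : ℝ) 1 zero_le_one (4 * min (y i : ℝ) (1 - y i))

theorem continuous_collar [Fintype N] : Continuous (collar : (I^N) → I) :=
  continuous_finsetProd _ fun i _ => continuous_projIcc.comp (by fun_prop)

theorem collar_boundary [Fintype N] {y : I^N} (hy : y ∈ Cube.boundary N) : collar y = 0 := by
  obtain ⟨i, h⟩ := hy
  refine Finset.prod_eq_zero (Finset.mem_univ i) (Set.projIcc_of_le_left _ ?_)
  rcases h with h | h <;> simp [h]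

theorem expand_mem_boundary [Fintype N] {y : I^N} (hy : collar y ≠ 1) :
    expand 1 y ∈ Cube.boundary N := by
  obtain ⟨i, hi⟩ : ∃ i, min (y i : ℝ) (1 - y i) < 1 / 4 := by
    by_contra! h
    exact hy (Finset.prod_eq_one fun i _ => Set.projIcc_of_right_le _ (by linarith [h i]))
  rcases min_lt_iff.1 hi with h | h
  · refine ⟨i, Or.inl (Set.projIcc_of_le_left _ ?_)⟩
    simp only [Set.Icc.coe_one]
    linarith
  · refine ⟨i, Or.inr (Set.projIcc_of_right_le _ ?_)⟩
    simp only [Set.Icc.coe_one]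
    linarith

theorem isClosed_boundary [Finite N] : IsClosed (Cube.boundary N) := by
  have : Cube.boundary N = ⋃ i, {y : I^N | y i = 0 ∨ y i = 1} := by
    ext
    simp [Cube.boundary]
  rw [this]
  refine isClosed_iUnion_of_finite fun i => ?_
  exact (isClosed_eq (continuous_apply i) continuous_const).union
    (isClosed_eq (continuous_apply i) continuous_const)

end Collar

/-! ### Fibrewise deformation retractions and homotopy groups -/

section FiberRetraction

variable {X Y : Type u} [TopologicalSpace X] [TopologicalSpace Y] {N : Type}

open Classical in
/-- A loop family `γ` in the base is lifted by the section on the inner cube, and joined on the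
collar to the base point `x` along the path that the deformation `h` gives. -/
noncomputable def collarLift [Fintype N] (sec : C(Y, X)) (h : C(X × I, X)) (x : X) {P : Type}
    (γ : P × (I^N) → Y) (p : P × (I^N)) : X :=
  if collar p.2 = 1 then sec (γ (p.1, expand 1 p.2)) else h (x, collar p.2)

theorem continuous_collarLift [Fintype N] {f : C(X, Y)} {sec : C(Y, X)} {h : C(X × I, X)}
    (h1 : ∀ x, h (x, 1) = sec (f x)) {x : X} {P : Type} [TopologicalSpace P] {γ : P × (I^N) → Y}
    (hγ : Continuous γ) (hb : ∀ s, ∀ y ∈ Cube.boundary N, γ (s, y) = f x) :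
    Continuous (collarLift sec h x γ) := by
  have cA : IsClosed {p : P × (I^N) | collar p.2 = 1} :=
    isClosed_eq (continuous_collar.comp continuous_snd) continuous_const
  have cE : Continuous fun p : P × (I^N) => expand 1 p.2 :=
    continuous_expand.comp (continuous_const.prodMk continuous_snd)
  have cB : IsClosed {p : P × (I^N) | expand 1 p.2 ∈ Cube.boundary N} :=
    isClosed_boundary.preimage cE
  rw [← continuousOn_univ]
  have hU : (Set.univ : Set (P × (I^N))) =
      {p | collar p.2 = 1} ∪ {p | expand 1 p.2 ∈ Cube.boundary N} := by
    refine (Set.eq_univ_of_forall fun p => ?_).symm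
    by_cases hp : collar p.2 = 1
    · exact Or.inl hp
    · exact Or.inr (expand_mem_boundary hp)
  rw [hU]
  refine ContinuousOn.union_of_isClosed ?_ ?_ cA cB
  · have : Continuous fun p : P × (I^N) => sec (γ (p.1, expand 1 p.2)) :=
      sec.continuous.comp (hγ.comp (continuous_fst.prodMk cE))
    exact this.continuousOn.congr fun p hp => if_pos hp
  · have : Continuous fun p : P × (I^N) => h (x, collar p.2) :=
      h.continuous.comp (continuous_const.prodMk (continuous_collar.comp continuous_snd))
    refine this.continuousOn.congr fun p hp => ?_
    unfold collarLift
    split_ifs with hc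
    · change _ = h (x, collar p.2)
      rw [hb _ _ hp, hc, h1]
    · rfl

theorem collarLift_boundary [Fintype N] {sec : C(Y, X)} {h : C(X × I, X)} (h0 : ∀ x, h (x, 0) = x)
    (x : X) {P : Type} (γ : P × (I^N) → Y) (s : P) {y : I^N} (hy : y ∈ Cube.boundary N) :
    collarLift sec h x γ (s, y) = x := by
  unfold collarLift
  rw [if_neg, collar_boundary hy, h0]
  rw [collar_boundary hy]
  exact zero_ne_one

/-- Expanding the inner subcube does not change the class of a loop. -/
theorem homotopic_of_expand {x : X} (p q : GenLoop N X x) (hq : ∀ y, q y = p (expand 1 y)) :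
    GenLoop.Homotopic p q := by
  refine ⟨⟨⟨⟨fun r => p.1 (expand r.1 r.2), p.1.continuous.comp continuous_expand⟩, ?_, ?_⟩, ?_⟩⟩
  · intro y
    change p.1 (expand 0 y) = p.1 y
    rw [expand_zero]
  · exact fun y => (hq y).symm
  · intro s y hy
    exact (p.2 _ (expand_boundary s hy)).trans (p.2 y hy).symm

/-- A loop at `f x` lifts to a loop at `x`: the section gives a loop at `sec (f x)`, and the path
from `x` that the deformation gives is added on a collar. As the deformation moves points within the
fibres, this path lies over `f x`, so no change of base point is needed in the target. -/
theorem IsFiberRetraction.isPiBijective {f : C(X, Y)} (hf : IsFiberRetraction f) :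
    IsPiBijective f := by
  obtain ⟨sec, h, hs, h0, h1, hfib⟩ := hf
  refine fun n x => ?_
  let lift (γ : GenLoop (Fin (n + 1)) Y (f x)) : GenLoop (Fin (n + 1)) X x :=
    ⟨⟨fun y => collarLift sec h x (fun p : Unit × _ => γ.1 p.2) ((), y),
      (continuous_collarLift h1 (by fun_prop) fun _ y hy => γ.2 y hy).comp (by fun_prop)⟩,
      fun y hy => collarLift_boundary (sec := sec) h0 x (fun p : Unit × _ => γ.1 p.2) () hy⟩
  have lift_apply : ∀ γ y, (lift γ).1 y =
      collarLift sec h x (fun p : Unit × _ => γ.1 p.2) ((), y) :=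
    fun _ _ => rfl
  have lift_congr : ∀ γ γ', GenLoop.Homotopic γ γ' → GenLoop.Homotopic (lift γ) (lift γ') := by
    rintro γ γ' ⟨H⟩
    let Γ : C(I × (Fin (n + 1) → I), Y) := H.toHomotopy.toContinuousMap
    have hb : ∀ s, ∀ y ∈ Cube.boundary (Fin (n + 1)), Γ (s, y) = f x :=
      fun s y hy => (H.prop' s y hy).trans (γ.2 y hy)
    have Γ0 : ∀ y, Γ (0, y) = γ.1 y := H.map_zero_left
    have Γ1 : ∀ y, Γ (1, y) = γ'.1 y := H.map_one_left
    refine ⟨⟨⟨⟨collarLift sec h x Γ, continuous_collarLift h1 Γ.continuous hb⟩, ?_, ?_⟩, ?_⟩⟩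
    · intro y
      rw [lift_apply]
      change collarLift sec h x Γ (0, y) = _
      unfold collarLift
      rw [Γ0]
    · intro y
      rw [lift_apply]
      change collarLift sec h x Γ (1, y) = _
      unfold collarLift
      rw [Γ1]
    · intro s y hy
      exact (collarLift_boundary h0 x Γ s hy).trans ((lift γ).2 y hy).symm
  have lift_map : ∀ p : GenLoop (Fin (n + 1)) X x,
      GenLoop.Homotopic p (lift ⟨f.comp p.1, fun y hy => congrArg f (p.2 y hy)⟩) := by
    intro p
    have cE : Continuous (expand (N := Fin (n + 1)) 1) :=
      continuous_expand.comp (continuous_const.prodMk continuous_id)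
    let q : GenLoop (Fin (n + 1)) X x := ⟨⟨fun y => p.1 (expand 1 y), p.1.continuous.comp cE⟩,
      fun y hy => p.2 _ (expand_boundary 1 hy)⟩
    refine (homotopic_of_expand p q fun _ => rfl).trans ?_
    -- The deformation of `p ∘ expand 1`, stopped at the collar coordinate.
    have cont : Continuous fun r : I × (Fin (n + 1) → I) =>
        h (p.1 (expand 1 r.2), min r.1 (collar r.2)) := by
      have := continuous_collar (N := Fin (n + 1))
      fun_prop
    refine ⟨⟨⟨⟨_, cont⟩, ?_, ?_⟩, ?_⟩⟩
    · intro y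
      change h (p.1 (expand 1 y), min 0 (collar y)) = p.1 (expand 1 y)
      rw [show min 0 (collar y) = 0 from min_eq_left (collar y).2.1, h0]
    · intro y
      rw [lift_apply]
      change h (p.1 (expand 1 y), min 1 (collar y)) = _
      rw [show min 1 (collar y) = collar y from min_eq_right (collar y).2.2]
      unfold collarLift
      split_ifs with hc
      · rw [show collar y = 1 from hc, h1]
        rfl
      · rw [show p.1 (expand 1 y) = x from p.2 _ (expand_mem_boundary hc)]
    · intro s y hy
      change h (p.1 (expand 1 y), min s (collar y)) = p.1 (expand 1 y)
      rw [collar_boundary hy, show min s 0 = 0 from min_eq_right s.2.1, h0]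
  have map_lift : ∀ γ : GenLoop (Fin (n + 1)) Y (f x), GenLoop.Homotopic γ
      ⟨f.comp (lift γ).1, fun y hy => congrArg f ((lift γ).2 y hy)⟩ := by
    intro γ
    refine homotopic_of_expand _ _ fun y => ?_
    change f ((lift γ).1 y) = γ.1 (expand 1 y)
    rw [lift_apply]
    unfold collarLift
    split_ifs with hc
    · exact hs _
    · rw [hfib]
      exact (γ.2 _ (expand_mem_boundary hc)).symm
  refine ⟨fun a b => ?_, fun b => ?_⟩
  · refine Quotient.inductionOn₂ a b fun p q hpq => Quotient.sound ?_
    exact (lift_map p).trans ((lift_congr _ _ (Quotient.exact hpq)).trans (lift_map q).symm)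
  · refine Quotient.inductionOn b fun γ => ⟨Quotient.mk _ (lift γ), Quotient.sound ?_⟩
    exact (map_lift γ).symm

theorem IsFiberRetraction.isWeakEquiv {f : C(X, Y)} (hf : IsFiberRetraction f) :
    IsWeakEquiv f := by
  refine ⟨?_, hf.isPiBijective⟩
  obtain ⟨sec, h, hs, h0, h1, -⟩ := hf
  refine ⟨fun a b => ?_, fun b => ?_⟩
  · induction a with
    | mk a =>
    induction b with
    | mk b =>
    intro hab
    have key : ∀ x, Joined x (sec (f x)) := fun x =>
      ⟨⟨⟨fun s => h (x, s), by fun_prop⟩, h0 x, h1 x⟩⟩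
    have h2 : Joined (f a) (f b) := mk_eq_mk_iff_joined.1 hab
    exact mk_eq_mk_iff_joined.2 ((key a).trans ((joined_map sec h2).trans (key b).symm))
  · induction b with
    | mk b => exact ⟨ZerothHomotopy.mk (sec b), congrArg ZerothHomotopy.mk (hs b)⟩

end FiberRetraction

end

noncomputable section

/-! ### Points of simplices -/

section Simplex

variable {m n : ℕ}

theorem stdSimplex_map_apply (f : Fin (m + 1) → Fin (n + 1)) (t : stdSimplex ℝ (Fin (m + 1)))
    (i : Fin (n + 1)) : stdSimplex.map f t i = ∑ j with f j = i, t j := by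
  rw [stdSimplex.map_coe, FunOnFinite.linearMap_apply_apply]

theorem stdSimplex_map_ne_zero {f : Fin (m + 1) → Fin (n + 1)} {t : stdSimplex ℝ (Fin (m + 1))}
    {i : Fin (n + 1)} : stdSimplex.map f t i ≠ 0 ↔ ∃ j, f j = i ∧ t j ≠ 0 := by
  rw [stdSimplex_map_apply, Ne,
    Finset.sum_eq_zero_iff_of_nonneg fun j _ => stdSimplex.zero_le t j]
  simp

theorem stdSimplex_map_congr {f g : Fin (m + 1) → Fin (n + 1)} {t : stdSimplex ℝ (Fin (m + 1))}
    (h : ∀ j, t j ≠ 0 → f j = g j) : stdSimplex.map f t = stdSimplex.map g t := by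
  refine stdSimplex.ext (funext fun i => ?_)
  rw [stdSimplex_map_apply, stdSimplex_map_apply, Finset.sum_filter, Finset.sum_filter]
  refine Finset.sum_congr rfl fun j _ => ?_
  by_cases hj : t j = 0
  · simp [hj]
  · rw [h j hj]

theorem exists_ne_zero (t : stdSimplex ℝ (Fin (n + 1))) : ∃ i, t i ≠ 0 := by
  by_contra! h
  have := stdSimplex.sum_eq_one t
  simp [h] at this

open Classical in
/-- The last vertex of the face whose interior contains `t`. -/
def topVertex (t : stdSimplex ℝ (Fin (n + 1))) : Fin (n + 1) :=
  (Finset.univ.filter fun i => t i ≠ 0).max'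
    ((exists_ne_zero t).imp fun i hi => Finset.mem_filter.2 ⟨Finset.mem_univ i, hi⟩)

theorem apply_topVertex_ne_zero (t : stdSimplex ℝ (Fin (n + 1))) : t (topVertex t) ≠ 0 := by
  classical
  exact (Finset.mem_filter.1 (Finset.max'_mem (Finset.univ.filter fun i => t i ≠ 0) _)).2

theorem le_topVertex {t : stdSimplex ℝ (Fin (n + 1))} {i : Fin (n + 1)} (hi : t i ≠ 0) :
    i ≤ topVertex t := by
  classical
  exact Finset.le_max' _ _ (Finset.mem_filter.2 ⟨Finset.mem_univ i, hi⟩)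

theorem topVertex_map (θ : Fin (m + 1) →o Fin (n + 1)) (t : stdSimplex ℝ (Fin (m + 1))) :
    topVertex (stdSimplex.map θ t) = θ (topVertex t) := by
  refine le_antisymm ?_ (le_topVertex (stdSimplex_map_ne_zero.2
    ⟨_, rfl, apply_topVertex_ne_zero t⟩))
  obtain ⟨j, hj, h⟩ := stdSimplex_map_ne_zero.1 (apply_topVertex_ne_zero (stdSimplex.map θ t))
  rw [← hj]
  exact θ.monotone (le_topVertex h)

/-- The idempotent of `[n]` with image `{0, …, v}`. -/
def truncate (v : Fin (n + 1)) : Fin (n + 1) →o Fin (n + 1) :=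
  ⟨fun i => min i v, fun _ _ h => min_le_min_right v h⟩

theorem truncate_last (v : Fin (n + 1)) : truncate v (Fin.last n) = v :=
  min_eq_right (Fin.le_last v)

theorem map_truncate {v : Fin (n + 1)} {t : stdSimplex ℝ (Fin (n + 1))}
    (h : ∀ i, t i ≠ 0 → i ≤ v) : stdSimplex.map (truncate v) t = t := by
  conv_rhs => rw [← stdSimplex.map_id_apply t]
  exact stdSimplex_map_congr fun i hi => min_eq_left (h i hi)

theorem le_of_map_truncate {v : Fin (n + 1)} {t : stdSimplex ℝ (Fin (n + 1))}
    (h : stdSimplex.map (truncate v) t = t) {i : Fin (n + 1)} (hi : t i ≠ 0) : i ≤ v := by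
  rw [← h] at hi
  obtain ⟨j, rfl, -⟩ := stdSimplex_map_ne_zero.1 hi
  exact min_le_right _ _

theorem comp_truncate (θ : Fin (m + 1) →o Fin (n + 1)) (v : Fin (m + 1)) :
    θ.comp (truncate v) = (truncate (θ v)).comp θ :=
  OrderHom.ext _ _ (funext fun _ => θ.monotone.map_min)

open Classical in
/-- The total weight of the vertices in `S`. -/
def mass (S : Set (Fin (n + 1))) (t : stdSimplex ℝ (Fin (n + 1))) : ℝ :=
  ∑ j, if j ∈ S then t j else 0

open Classical in
/-- The projection of `t` to the face spanned by `S`, by rescaling the weights; the point `t` itself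
if all weights on `S` are zero. -/
def condOn (S : Set (Fin (n + 1))) (t : stdSimplex ℝ (Fin (n + 1))) : stdSimplex ℝ (Fin (n + 1)) :=
  if h : 0 < mass S t then
    ⟨fun j => (if j ∈ S then t j else 0) / mass S t, fun j => by
      have := stdSimplex.zero_le t j
      positivity, by
      rw [← Finset.sum_div]
      exact div_self h.ne'⟩
  else t

open Classical in
theorem condOn_apply {S : Set (Fin (n + 1))} {t : stdSimplex ℝ (Fin (n + 1))} (h : 0 < mass S t)
    (j : Fin (n + 1)) : condOn S t j = (if j ∈ S then t j else 0) / mass S t := by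
  unfold condOn
  rw [dif_pos h]
  rfl

theorem mem_of_condOn_ne_zero {S : Set (Fin (n + 1))} {t : stdSimplex ℝ (Fin (n + 1))}
    (h : 0 < mass S t) {j : Fin (n + 1)} (hj : condOn S t j ≠ 0) : j ∈ S := by
  by_contra hS
  rw [condOn_apply h, if_neg hS, zero_div] at hj
  exact hj rfl

theorem mass_univ (t : stdSimplex ℝ (Fin (n + 1))) : mass Set.univ t = 1 := by
  simp [mass]

theorem condOn_univ (t : stdSimplex ℝ (Fin (n + 1))) : condOn Set.univ t = t := by
  have h : 0 < mass Set.univ t := by simp [mass_univ]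
  refine stdSimplex.ext (funext fun j => ?_)
  rw [condOn_apply h, mass_univ]
  simp

theorem mass_map (f : Fin (m + 1) → Fin (n + 1)) (S : Set (Fin (n + 1)))
    (t : stdSimplex ℝ (Fin (m + 1))) : mass S (stdSimplex.map f t) = mass (f ⁻¹' S) t := by
  classical
  unfold mass
  rw [← Finset.sum_fiberwise Finset.univ f]
  refine Finset.sum_congr rfl fun i _ => ?_
  rw [stdSimplex_map_apply]
  by_cases hi : i ∈ S
  · rw [if_pos hi]
    refine Finset.sum_congr rfl fun j hj => ?_
    rw [if_pos]
    rw [Set.mem_preimage, (Finset.mem_filter.1 hj).2]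
    exact hi
  · rw [if_neg hi]
    refine (Finset.sum_eq_zero fun j hj => ?_).symm
    rw [if_neg]
    rw [Set.mem_preimage, (Finset.mem_filter.1 hj).2]
    exact hi

theorem condOn_map (f : Fin (m + 1) → Fin (n + 1)) (S : Set (Fin (n + 1)))
    (t : stdSimplex ℝ (Fin (m + 1))) :
    condOn S (stdSimplex.map f t) = stdSimplex.map f (condOn (f ⁻¹' S) t) := by
  classical
  by_cases h : 0 < mass (f ⁻¹' S) t
  · have h' : 0 < mass S (stdSimplex.map f t) := by rwa [mass_map]
    refine stdSimplex.ext (funext fun i => ?_)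
    rw [condOn_apply h', mass_map, stdSimplex_map_apply, stdSimplex_map_apply]
    have : ∀ j, condOn (f ⁻¹' S) t j = (if j ∈ f ⁻¹' S then t j else 0) / mass (f ⁻¹' S) t :=
      condOn_apply h
    rw [Finset.sum_congr rfl fun j _ => this j, ← Finset.sum_div]
    congr 1
    by_cases hi : i ∈ S
    · rw [if_pos hi]
      refine Finset.sum_congr rfl fun j hj => ?_
      rw [if_pos]
      rw [Set.mem_preimage, (Finset.mem_filter.1 hj).2]
      exact hi
    · rw [if_neg hi]
      refine (Finset.sum_eq_zero fun j hj => ?_).symm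
      rw [if_neg]
      rw [Set.mem_preimage, (Finset.mem_filter.1 hj).2]
      exact hi
  · have h' : ¬ 0 < mass S (stdSimplex.map f t) := by rwa [mass_map]
    unfold condOn
    rw [dif_neg h, dif_neg h']

theorem continuous_apply_simplex (j : Fin (n + 1)) :
    Continuous fun t : stdSimplex ℝ (Fin (n + 1)) => t j :=
  (continuous_apply j).comp continuous_subtype_val

theorem continuous_mass (S : Set (Fin (n + 1))) : Continuous (mass S) := by
  classical
  refine continuous_finsetSum _ fun j _ => ?_
  split_ifs
  · exact continuous_apply_simplex j
  · exact continuous_const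

theorem continuousOn_condOn (S : Set (Fin (n + 1))) :
    ContinuousOn (condOn S) {t | 0 < mass S t} := by
  classical
  rw [continuousOn_iff_continuous_domRestrict, continuous_induced_rng]
  refine continuous_pi fun j => ?_
  have : Continuous fun t : {t : stdSimplex ℝ (Fin (n + 1)) | 0 < mass S t} =>
      (if j ∈ S then t.1 j else 0) / mass S t.1 := by
    refine Continuous.div ?_ ((continuous_mass S).comp continuous_subtype_val) fun t => t.2.ne'
    split_ifs
    · exact (continuous_apply_simplex j).comp continuous_subtype_val
    · exact continuous_const
  exact this.congr fun t => (condOn_apply t.2 j).symm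

end Simplex

/-! ### The category of pairs `(S, G/H)` -/

variable {G : Type u} [Group G]

namespace OrbHom

variable {A B C : OrbObj G}

theorem IsTrivial.comp_right {φ : A ⟶ B} (h : OrbHom.IsTrivial φ) (ψ : B ⟶ C) :
    OrbHom.IsTrivial (φ ≫ ψ) := fun c => by
  change (OrbHom.hom ψ c).comp (OrbHom.hom φ (OrbHom.orb ψ c)) = _
  rw [h, GammaHom.comp_zero]

theorem IsTrivial.comp_left {ψ : B ⟶ C} (h : OrbHom.IsTrivial ψ) (φ : A ⟶ B) :
    OrbHom.IsTrivial (φ ≫ ψ) := fun c => by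
  change (OrbHom.hom ψ c).comp (OrbHom.hom φ (OrbHom.orb ψ c)) = _
  rw [h]
  rfl

/-- A composite of a chain is trivial if one of its factors is. -/
theorem IsTrivial.map {n : ℕ} {A : ComposableArrows (OrbObj G) n} {j : Fin n}
    (h : OrbHom.IsTrivial (A.map (homOfLE (Fin.castSucc_le_succ j)))) {a b : Fin (n + 1)}
    (ha : a ≤ j.castSucc) (hb : j.succ ≤ b) (hab : a ≤ b) :
    OrbHom.IsTrivial (A.map (homOfLE hab)) := by
  have : homOfLE hab = homOfLE ha ≫ homOfLE (Fin.castSucc_le_succ j) ≫ homOfLE hb := rfl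
  rw [this, A.map_comp, A.map_comp]
  exact (h.comp_right _).comp_left _

end OrbHom

namespace Corep

variable {T : GammaObj G} {A B C : OrbObj G}

theorem pull_comp (φ : A ⟶ B) (ψ : B ⟶ C) (p : Corep T C) :
    pull (φ ≫ ψ) p = pull φ (pull ψ p) := rfl

theorem pull_zero (φ : A ⟶ B) {p : Corep T B} (h : p.2 = GammaHom.zero _ _) :
    (pull φ p).2 = GammaHom.zero _ _ := by
  change p.2.comp _ = _
  rw [h]
  rfl

theorem pull_trivial {φ : A ⟶ B} (h : OrbHom.IsTrivial φ) (p : Corep T B) :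
    (pull φ p).2 = GammaHom.zero _ _ := by
  change p.2.comp (OrbHom.hom φ p.1) = _
  rw [h, GammaHom.comp_zero]

/-- Fixed points of a subgroup `K`; these are the morphisms from `A` to `(T, G/K)`. -/
def IsFixed (K : Subgroup G) (p : Corep T A) : Prop := ∀ k ∈ K, k • p = p

theorem IsFixed.pull {K : Subgroup G} {p : Corep T B} (h : p.IsFixed K) (φ : A ⟶ B) :
    (Corep.pull φ p).IsFixed K := fun k hk => by rw [smul_pull, h k hk]

end Corep

namespace GammaOSpace

variable (F : GammaOSpace G)

theorem actOn_id {A : OrbObj G} (x : F.obj A.S A.H) : F.actOn (𝟙 A) x = x :=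
  (F.map_id _).trans (F.res_id x)

theorem actOn_comp {A B C : OrbObj G} (φ : A ⟶ B) (ψ : B ⟶ C) (x : F.obj A.S A.H) :
    F.actOn (φ ≫ ψ) x = F.actOn ψ (F.actOn φ x) := by
  change F.map ((OrbHom.hom ψ).comp ((OrbHom.hom φ).pull (OrbHom.orb ψ)))
    (F.res ((OrbHom.orb φ).comp (OrbHom.orb ψ)) x) = F.map _ (F.res _ (F.map _ (F.res _ x)))
  rw [F.map_comp, F.res_comp, F.res_map]

theorem actOn_base {A B : OrbObj G} (φ : A ⟶ B) : F.actOn φ (F.base _ _) = F.base _ _ :=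
  (congrArg (F.map _) (F.res_base _)).trans (F.map_base _)

theorem actOn_trivial {A B : OrbObj G} {φ : A ⟶ B} (h : OrbHom.IsTrivial φ)
    (x : F.obj A.S A.H) : F.actOn φ x = F.base _ _ := by
  have : OrbHom.hom φ = (PhiHom.const B.H (GammaHom.zero _ B.S) GammaHom.smul_zero).comp
      (PhiHom.const B.H (GammaHom.zero A.S (GammaObj.num G 0)) GammaHom.smul_zero) :=
    MulActionHom.ext fun c => h c
  change F.map _ (F.res _ x) = _
  rw [this, F.map_comp]
  exact congrArg _ ((F.zero B.H).uniq _)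

/-! ### Faces in the bar construction -/

section Face

variable {F} {T : GammaObj G} {l m n : ℕ}

/-- The chain `A ∘ θ`. -/
abbrev faceChain (θ : Fin (m + 1) →o Fin (n + 1)) (A : ComposableArrows (OrbObj G) n) :
    ComposableArrows (OrbObj G) m := θ.monotone.functor ⋙ A

/-- The component in `M` of the simplex `θ^*(A, x, p)`. -/
def faceCorep (θ : Fin (m + 1) →o Fin (n + 1)) (A : ComposableArrows (OrbObj G) n)
    (p : Corep T (A.obj (Fin.last n))) : Corep T ((faceChain θ A).obj (Fin.last m)) :=
  Corep.pull (A.map (homOfLE (Fin.le_last (θ (Fin.last m))))) p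

/-- The component in `F` of the simplex `θ^*(A, x, p)`. -/
def faceAct (θ : Fin (m + 1) →o Fin (n + 1)) (A : ComposableArrows (OrbObj G) n) :
    C(F.obj (A.obj 0).S (A.obj 0).H,
      F.obj ((faceChain θ A).obj 0).S ((faceChain θ A).obj 0).H) :=
  F.actOn (A.map (homOfLE (Fin.zero_le (θ 0))))

theorem faceCorep_comp (α : Fin (l + 1) →o Fin (m + 1)) (θ : Fin (m + 1) →o Fin (n + 1))
    (A : ComposableArrows (OrbObj G) n) (p : Corep T (A.obj (Fin.last n))) :
    faceCorep α (faceChain θ A) (faceCorep θ A p) = faceCorep (θ.comp α) A p := by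
  change Corep.pull (A.map _) (Corep.pull (A.map _) p) = Corep.pull (A.map _) p
  rw [← Corep.pull_comp, ← A.map_comp]
  rfl

theorem faceAct_comp (α : Fin (l + 1) →o Fin (m + 1)) (θ : Fin (m + 1) →o Fin (n + 1))
    (A : ComposableArrows (OrbObj G) n) (x : F.obj (A.obj 0).S (A.obj 0).H) :
    faceAct α (faceChain θ A) (faceAct θ A x) = faceAct (F := F) (θ.comp α) A x := by
  change F.actOn (A.map _) (F.actOn (A.map _) x) = F.actOn (A.map _) x
  rw [← F.actOn_comp, ← A.map_comp]
  rfl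

variable (F) in
/-- The point of the bar construction given by a simplex `(A, x, p)` and a point `t` of `Δⁿ`. -/
def barMk (A : ComposableArrows (OrbObj G) n) (p : Corep T (A.obj (Fin.last n)))
    (x : F.obj (A.obj 0).S (A.obj 0).H) (t : stdSimplex ℝ (Fin (n + 1))) : F.Bar T :=
  Quot.mk _ ⟨⟨n, A, p⟩, x, t⟩

theorem barMk_face (θ : Fin (m + 1) →o Fin (n + 1)) (A : ComposableArrows (OrbObj G) n)
    (p : Corep T (A.obj (Fin.last n))) (x : F.obj (A.obj 0).S (A.obj 0).H)
    (t : stdSimplex ℝ (Fin (m + 1))) :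
    F.barMk (faceChain θ A) (faceCorep θ A p) (faceAct θ A x) t =
      F.barMk A p x (stdSimplex.map θ t) :=
  Quot.sound (BarRel.simplicial θ A p x t)

variable (F) in
/-- The base point of the bar construction, as the class of a simplex whose component in `M` is
fixed by `G`. -/
def barBase (T : GammaObj G) : F.Bar T :=
  F.barMk (ComposableArrows.mk₀ ⟨T, ⊤⟩) ((1 : G), GammaHom.zero _ _) (F.base _ _)
    (stdSimplex.vertex 0)

theorem mk_eq_barBase {a : F.BarPre T} (h : F.IsCollapsed a) :
    (Quot.mk _ a : F.Bar T) = F.barBase T :=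
  Quot.sound (BarRel.collapse _ _ h (Or.inl rfl))

theorem isFixed_base (K : Subgroup G) :
    Corep.IsFixed K (A := ⟨T, (⊤ : Subgroup G)⟩) (((1 : G), GammaHom.zero _ T)) := by
  refine fun k _ => Prod.ext ?_ (GammaHom.smul_zero k)
  change ((k * 1 : G) : G ⧸ (⊤ : Subgroup G)) = (1 : G)
  exact QuotientGroup.eq.2 (Subgroup.mem_top _)

/-- The collapsed simplices of the bar construction are closed under passage to the face spanned
by the vertices up to `v`. -/
theorem isCollapsed_truncate {A : ComposableArrows (OrbObj G) n}
    {p : Corep T (A.obj (Fin.last n))} {x : F.obj (A.obj 0).S (A.obj 0).H}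
    {t : stdSimplex ℝ (Fin (n + 1))} (h : F.IsCollapsed ⟨⟨n, A, p⟩, x, t⟩) (v : Fin (n + 1)) :
    F.IsCollapsed ⟨⟨n, faceChain (truncate v) A, faceCorep (truncate v) A p⟩,
      faceAct (truncate v) A x, t⟩ := by
  rcases h with h | ⟨j, hj⟩ | h
  · refine Or.inl ?_
    change faceAct (truncate v) A x = F.base _ _
    rw [show x = F.base _ _ from h]
    exact F.actOn_base _
  · by_cases hv : j.succ ≤ v
    · exact Or.inr (Or.inl ⟨j, OrbHom.IsTrivial.map hj (min_le_left _ _)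
        (le_min le_rfl hv) _⟩)
    · refine Or.inr (Or.inr (Corep.pull_trivial (OrbHom.IsTrivial.map hj ?_ (Fin.le_last _) _) p))
      exact (truncate_last v).trans_le (Fin.le_castSucc_iff.2 (not_le.1 hv))
  · exact Or.inr (Or.inr (Corep.pull_zero _ h))

end Face

/-! ### Fixed points of the bar construction -/

section Fixed

variable {F} {T : GammaObj G} {m n : ℕ} (K : Subgroup G)

/-- The restriction of the component in `M` to the last vertex of positive weight. It does not
depend on the representative of a point of the realization. -/
def tail (a : F.BarPre T) : Σ A : OrbObj G, Corep T A :=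
  ⟨a.1.chain.obj (topVertex a.2.2),
    Corep.pull (a.1.chain.map (homOfLE (Fin.le_last (topVertex a.2.2)))) a.1.last⟩

theorem tail_face (θ : Fin (m + 1) →o Fin (n + 1)) (A : ComposableArrows (OrbObj G) n)
    (p : Corep T (A.obj (Fin.last n))) (x : F.obj (A.obj 0).S (A.obj 0).H)
    (t : stdSimplex ℝ (Fin (m + 1))) :
    tail (F := F) ⟨⟨m, faceChain θ A, faceCorep θ A p⟩, faceAct θ A x, t⟩ =
      tail ⟨⟨n, A, p⟩, x, stdSimplex.map θ t⟩ := by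
  have key : tail (F := F) ⟨⟨m, faceChain θ A, faceCorep θ A p⟩, faceAct θ A x, t⟩ =
      ⟨A.obj (θ (topVertex t)), Corep.pull (A.map (homOfLE (Fin.le_last _))) p⟩ := by
    refine congrArg (Sigma.mk (A.obj (θ (topVertex t)))) ?_
    change Corep.pull (A.map _) (Corep.pull (A.map _) p) = _
    rw [← Corep.pull_comp, ← A.map_comp]
    rfl
  rw [key, ← topVertex_map]
  rfl

/-- The simplices of the bar construction whose component in `M` is fixed by `K`. -/
abbrev FixIndex (T : GammaObj G) : Type u := {i : BarIndex T // i.last.IsFixed K}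

variable (F) in
/-- The disjoint union over all simplices fixed by `K`. -/
abbrev FixPre (T : GammaObj G) : Type u :=
  Σ i : FixIndex K T, F.obj (i.1.chain.obj 0).S (i.1.chain.obj 0).H ×
    stdSimplex ℝ (Fin (i.1.n + 1))

theorem barMk_mem_fixedPoints {A : ComposableArrows (OrbObj G) n}
    {p : Corep T (A.obj (Fin.last n))} (hp : p.IsFixed K) (x : F.obj (A.obj 0).S (A.obj 0).H)
    (t : stdSimplex ℝ (Fin (n + 1))) :
    F.barMk A p x t ∈ MulAction.fixedPoints K (F.Bar T) := fun k => by
  change F.barMk A (k.1 • p) x t = F.barMk A p x t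
  rw [hp k.1 k.2]

/-- The projection from the fixed simplices to the fixed points of the bar construction. -/
def fixMk (e : F.FixPre K T) : MulAction.fixedPoints K (F.Bar T) :=
  ⟨F.barMk e.1.1.chain e.1.1.last e.2.1 e.2.2, barMk_mem_fixedPoints K e.1.2 _ _⟩

open Classical in
/-- The invariant `tail` of a point of the bar construction other than the base point. -/
def barTail (z : F.Bar T) : Option (Σ A : OrbObj G, Corep T A) :=
  Quot.lift (fun a => if (Quot.mk _ a : F.Bar T) = F.barBase T then none else some (tail a))
    (fun a b h => by
      have hab : (Quot.mk _ a : F.Bar T) = Quot.mk _ b := Quot.sound h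
      change ite _ _ _ = ite _ _ _
      rw [hab]
      cases h with
      | simplicial θ A p x t =>
        congr 2
        exact tail_face θ A p x t
      | collapse a b ha hb => rw [if_pos (mk_eq_barBase hb), if_pos (mk_eq_barBase hb)]) z

open Classical in
/-- A point other than the base point is fixed by `K` only if its `tail` is, as `tail` is an
equivariant invariant. -/
theorem tail_isFixed {a : F.BarPre T} (h0 : (Quot.mk _ a : F.Bar T) ≠ F.barBase T)
    (h : (Quot.mk _ a : F.Bar T) ∈ MulAction.fixedPoints K (F.Bar T)) :
    (tail a).2.IsFixed K := fun k hk => by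
  have h1 : (Quot.mk _ (⟨⟨a.1.n, a.1.chain, k • a.1.last⟩, a.2⟩ : F.BarPre T) : F.Bar T) =
      Quot.mk _ a := h ⟨k, hk⟩
  have h2 := congrArg barTail h1
  change ite _ _ _ = ite _ _ _ at h2
  rw [if_neg h0, if_neg (by rwa [h1])] at h2
  have h3 := Option.some.inj h2
  have h4 := eq_of_heq (Sigma.mk.inj h3).2
  exact (Corep.smul_pull k _ _).trans h4

theorem barMk_truncate {A : ComposableArrows (OrbObj G) n} (p : Corep T (A.obj (Fin.last n)))
    (x : F.obj (A.obj 0).S (A.obj 0).H) {v : Fin (n + 1)} {t : stdSimplex ℝ (Fin (n + 1))}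
    (h : ∀ i, t i ≠ 0 → i ≤ v) :
    F.barMk (faceChain (truncate v) A) (faceCorep (truncate v) A p) (faceAct (truncate v) A x) t =
      F.barMk A p x t := by
  rw [barMk_face, map_truncate h]

theorem isFixed_faceCorep_truncate {A : ComposableArrows (OrbObj G) n}
    {p : Corep T (A.obj (Fin.last n))} {v : Fin (n + 1)}
    (h : (Corep.pull (A.map (homOfLE (Fin.le_last v))) p).IsFixed K) :
    (faceCorep (truncate v) A p).IsFixed K := by
  have key : ∀ w, w = v → ∀ hw : w ≤ Fin.last n, (Corep.pull (A.map (homOfLE hw)) p).IsFixed K := by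
    rintro _ rfl _
    exact h
  exact key _ (truncate_last v) _

/-- A fixed point other than the base point is represented by a fixed simplex: the face up to the
last vertex of positive weight. -/
theorem fixMk_surjective : Function.Surjective (fixMk (F := F) (T := T) K) := by
  rintro ⟨⟨a⟩, ha⟩
  by_cases h0 : (Quot.mk _ a : F.Bar T) = F.barBase T
  · exact ⟨⟨⟨⟨0, ComposableArrows.mk₀ ⟨T, ⊤⟩, ((1 : G), GammaHom.zero _ _)⟩, isFixed_base K⟩,
      F.base _ _, stdSimplex.vertex 0⟩, Subtype.ext h0.symm⟩
  · obtain ⟨⟨n, A, p⟩, x, t⟩ := a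
    have h1 : (Corep.pull (A.map (homOfLE (Fin.le_last (topVertex t)))) p).IsFixed K :=
      tail_isFixed (F := F) (a := ⟨⟨n, A, p⟩, x, t⟩) K h0 ha
    exact ⟨⟨⟨⟨n, faceChain (truncate (topVertex t)) A, faceCorep (truncate (topVertex t)) A p⟩,
      isFixed_faceCorep_truncate K h1⟩, faceAct (truncate (topVertex t)) A x, t⟩,
      Subtype.ext (barMk_truncate p x fun _ => le_topVertex)⟩

/-! ### Functions on the fixed points -/

/-- A function on the simplices fixed by `K` that is compatible with the relations of the
realization among these simplices. -/
structure FixCocone (T : GammaObj G) (Y : Type u) where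
  val : ∀ {n : ℕ} (A : ComposableArrows (OrbObj G) n) (p : Corep T (A.obj (Fin.last n))),
    p.IsFixed K → F.obj (A.obj 0).S (A.obj 0).H → stdSimplex ℝ (Fin (n + 1)) → Y
  pt : Y
  face : ∀ {m n : ℕ} (θ : Fin (m + 1) →o Fin (n + 1)) (A : ComposableArrows (OrbObj G) n)
    (p : Corep T (A.obj (Fin.last n))) (hp : p.IsFixed K) (x : F.obj (A.obj 0).S (A.obj 0).H)
    (t : stdSimplex ℝ (Fin (m + 1))),
    val (faceChain θ A) (faceCorep θ A p) (hp.pull _) (faceAct θ A x) t =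
      val A p hp x (stdSimplex.map θ t)
  collapse : ∀ {n : ℕ} (A : ComposableArrows (OrbObj G) n) (p : Corep T (A.obj (Fin.last n)))
    (hp : p.IsFixed K) (x : F.obj (A.obj 0).S (A.obj 0).H) (t : stdSimplex ℝ (Fin (n + 1))),
    F.IsCollapsed ⟨⟨n, A, p⟩, x, t⟩ → val A p hp x t = pt

namespace FixCocone

variable {K} {Y : Type u} (f : FixCocone (F := F) K T Y)

theorem val_congr {θ θ' : Fin (m + 1) →o Fin (n + 1)} (h : θ = θ')
    (A : ComposableArrows (OrbObj G) n) (p : Corep T (A.obj (Fin.last n)))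
    (x : F.obj (A.obj 0).S (A.obj 0).H) (t : stdSimplex ℝ (Fin (m + 1)))
    (hp : (faceCorep θ A p).IsFixed K) (hp' : (faceCorep θ' A p).IsFixed K) :
    f.val (faceChain θ A) (faceCorep θ A p) hp (faceAct θ A x) t =
      f.val (faceChain θ' A) (faceCorep θ' A p) hp' (faceAct θ' A x) t := by
  subst h
  rfl

theorem val_comp {l : ℕ} (α : Fin (l + 1) →o Fin (m + 1)) (θ : Fin (m + 1) →o Fin (n + 1))
    (A : ComposableArrows (OrbObj G) n) (p : Corep T (A.obj (Fin.last n)))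
    (x : F.obj (A.obj 0).S (A.obj 0).H) (t : stdSimplex ℝ (Fin (l + 1)))
    (hp : (faceCorep α (faceChain θ A) (faceCorep θ A p)).IsFixed K)
    (hp' : (faceCorep (θ.comp α) A p).IsFixed K) :
    f.val (faceChain α (faceChain θ A)) (faceCorep α (faceChain θ A) (faceCorep θ A p)) hp
      (faceAct α (faceChain θ A) (faceAct θ A x)) t =
      f.val (faceChain (θ.comp α) A) (faceCorep (θ.comp α) A p) hp' (faceAct (θ.comp α) A x) t := by
  have h1 := faceCorep_comp α θ A p
  have h2 := faceAct_comp α θ A x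
  change f.val (faceChain (θ.comp α) A) (faceCorep α (faceChain θ A) (faceCorep θ A p)) hp
    (faceAct α (faceChain θ A) (faceAct θ A x)) t = _
  congr 1

open Classical in
/-- The value at a point whose `tail` is fixed, computed on the face up to the last vertex of
positive weight. -/
def preLift (a : F.BarPre T) : Y :=
  if h : (tail a).2.IsFixed K then
    f.val (faceChain (truncate (topVertex a.2.2)) a.1.chain)
      (faceCorep (truncate (topVertex a.2.2)) a.1.chain a.1.last)
      (isFixed_faceCorep_truncate K h) (faceAct _ _ a.2.1) a.2.2
  else f.pt

theorem preLift_collapse {a : F.BarPre T} (h : F.IsCollapsed a) : f.preLift a = f.pt := by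
  unfold preLift
  split_ifs
  · exact f.collapse _ _ _ _ _ (isCollapsed_truncate h _)
  · rfl

theorem preLift_face (θ : Fin (m + 1) →o Fin (n + 1)) (A : ComposableArrows (OrbObj G) n)
    (p : Corep T (A.obj (Fin.last n))) (x : F.obj (A.obj 0).S (A.obj 0).H)
    (t : stdSimplex ℝ (Fin (m + 1))) :
    f.preLift ⟨⟨m, faceChain θ A, faceCorep θ A p⟩, faceAct θ A x, t⟩ =
      f.preLift ⟨⟨n, A, p⟩, x, stdSimplex.map θ t⟩ := by
  have htail := tail_face θ A p x t
  unfold preLift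
  by_cases h : (tail (F := F) ⟨⟨n, A, p⟩, x, stdSimplex.map θ t⟩).2.IsFixed K
  · have h' : (tail (F := F) ⟨⟨m, faceChain θ A, faceCorep θ A p⟩, faceAct θ A x, t⟩).2.IsFixed K :=
      by rwa [htail]
    rw [dif_pos h, dif_pos h']
    have h1 := isFixed_faceCorep_truncate K h
    rw [← f.face θ]
    have e : θ.comp (truncate (topVertex t)) =
        (truncate (topVertex (stdSimplex.map θ t))).comp θ := by
      rw [topVertex_map, comp_truncate]
    have h2 : (faceCorep ((truncate (topVertex (stdSimplex.map θ t))).comp θ) A p).IsFixed K := by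
      rw [← faceCorep_comp]
      exact h1.pull _
    refine (f.val_comp _ _ A p x t _ (e ▸ h2)).trans ?_
    refine (f.val_congr e A p x t _ h2).trans ?_
    exact (f.val_comp _ _ A p x t _ h2).symm
  · rw [dif_neg h, dif_neg (by rwa [htail])]

/-- The induced function on the bar construction; it need not be continuous away from the fixed
points. -/
def lift (z : F.Bar T) : Y :=
  Quot.lift f.preLift (fun a b h => by
    cases h with
    | simplicial θ A p x t => exact f.preLift_face θ A p x t
    | collapse a b ha hb => rw [f.preLift_collapse ha, f.preLift_collapse hb]) z

theorem lift_barMk {A : ComposableArrows (OrbObj G) n} {p : Corep T (A.obj (Fin.last n))}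
    (hp : p.IsFixed K) (x : F.obj (A.obj 0).S (A.obj 0).H) (t : stdSimplex ℝ (Fin (n + 1))) :
    f.lift (F.barMk A p x t) = f.val A p hp x t := by
  refine (dif_pos (hp.pull _)).trans ?_
  refine (f.face (truncate (topVertex t)) A p hp x t).trans ?_
  rw [map_truncate fun _ => le_topVertex]

end FixCocone

/-! ### The topology of the fixed points -/

/-- The vertices of a simplex at which its component in `M` is fixed by `K`. -/
def fixedVertices {A : ComposableArrows (OrbObj G) n} (p : Corep T (A.obj (Fin.last n))) :
    Set (Fin (n + 1)) :=
  {j | (Corep.pull (A.map (homOfLE (Fin.le_last j))) p).IsFixed K}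

theorem fixedVertices_face (θ : Fin (m + 1) →o Fin (n + 1)) {A : ComposableArrows (OrbObj G) n}
    (p : Corep T (A.obj (Fin.last n))) :
    fixedVertices K (A := faceChain θ A) (faceCorep θ A p) = θ ⁻¹' fixedVertices K p := by
  ext j
  have : Corep.pull ((faceChain θ A).map (homOfLE (Fin.le_last j))) (faceCorep θ A p) =
      Corep.pull (A.map (homOfLE (Fin.le_last (θ j)))) p := by
    change Corep.pull (A.map _) (Corep.pull (A.map _) p) = _
    rw [← Corep.pull_comp, ← A.map_comp]
    rfl
  change Corep.IsFixed K (Corep.pull ((faceChain θ A).map _) _) ↔ _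
  rw [this]
  rfl

theorem fixedVertices_eq_univ {A : ComposableArrows (OrbObj G) n}
    {p : Corep T (A.obj (Fin.last n))} (hp : p.IsFixed K) : fixedVertices K p = Set.univ :=
  Set.eq_univ_of_forall fun _ => hp.pull _

theorem fixedVertices_eq {A : ComposableArrows (OrbObj G) n} (p : Corep T (A.obj (Fin.last n))) :
    fixedVertices K p = ∅ ∨ ∃ v, v ∈ fixedVertices K p ∧ ∀ j ∈ fixedVertices K p, j ≤ v := by
  rcases (fixedVertices K p).eq_empty_or_nonempty with h | h
  · exact Or.inl h
  · refine Or.inr ?_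
    obtain ⟨v, hv, hmax⟩ := Set.exists_max_image (fixedVertices K p) id (Set.toFinite _) h
    exact ⟨v, hv, hmax⟩

/-- A set of fixed points that misses the base point spreads out to a set of simplices: a point
belongs to it if its projection to the face of fixed vertices does. -/
def spread (V : Set (F.Bar T)) (a : F.BarPre T) : Prop :=
  0 < mass (fixedVertices K a.1.last) a.2.2 ∧
    F.barMk a.1.chain a.1.last a.2.1 (condOn (fixedVertices K a.1.last) a.2.2) ∈ V

theorem spread_rel {V : Set (F.Bar T)} (hV : F.barBase T ∉ V) {a b : F.BarPre T}
    (h : F.BarRel T a b) : spread K V a = spread K V b := by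
  have hc : ∀ a : F.BarPre T, F.IsCollapsed a → ¬ spread K V a := by
    rintro a ha ⟨-, h2⟩
    have : F.barMk a.1.chain a.1.last a.2.1 (condOn (fixedVertices K a.1.last) a.2.2) =
      F.barBase T := mk_eq_barBase ha
    exact hV (this ▸ h2)
  cases h with
  | simplicial θ A p x t =>
    change (_ < mass (fixedVertices K (A := faceChain θ A) (faceCorep θ A p)) t ∧
      F.barMk (faceChain θ A) (faceCorep θ A p) (faceAct θ A x)
        (condOn (fixedVertices K (A := faceChain θ A) (faceCorep θ A p)) t) ∈ V) =
      (_ < mass (fixedVertices K p) (stdSimplex.map θ t) ∧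
        F.barMk A p x (condOn (fixedVertices K p) (stdSimplex.map θ t)) ∈ V)
    rw [fixedVertices_face, barMk_face, mass_map, condOn_map]
  | collapse a b ha hb => exact propext (iff_of_false (hc a ha) (hc b hb))

theorem continuous_fixMk : Continuous (fixMk (F := F) (T := T) K) := by
  refine Continuous.subtype_mk ?_ _
  refine continuous_quot_mk.comp (continuous_sigma fun i => ?_)
  exact continuous_sigmaMk (ι := BarIndex T) (σ := fun i => F.obj (i.chain.obj 0).S
    (i.chain.obj 0).H × stdSimplex ℝ (Fin (i.n + 1))) (i := i.1)

theorem isOpen_barMk_preimage {V : Set (MulAction.fixedPoints K (F.Bar T))}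
    (hV : IsOpen (fixMk K ⁻¹' V)) {A : ComposableArrows (OrbObj G) n}
    {p : Corep T (A.obj (Fin.last n))} (hp : p.IsFixed K) :
    IsOpen {y : F.obj (A.obj 0).S (A.obj 0).H × stdSimplex ℝ (Fin (n + 1)) |
      F.barMk A p y.1 y.2 ∈ Subtype.val '' V} := by
  have := isOpen_sigma_iff.1 hV ⟨⟨n, A, p⟩, hp⟩
  convert! this using 1
  ext y
  constructor
  · rintro ⟨z, hz, h⟩
    have : z = fixMk K ⟨⟨⟨n, A, p⟩, hp⟩, y⟩ := Subtype.ext h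
    change _ ∈ V
    rwa [← this]
  · intro h
    exact ⟨_, h, rfl⟩

/-- The fixed points carry the quotient topology of the disjoint union of the fixed simplices. Away
from the base point an open set of fixed points is thickened by the projection of simplices to
their fixed faces; as the base point need not be closed, the neighbourhoods of the base point are
treated through their complements. -/
theorem isQuotientMap_fixMk : IsQuotientMap (fixMk (F := F) (T := T) K) := by
  refine (isQuotientMap_iff _).2 ⟨isCoinducing_iff.2 fun V => ⟨fun hV => ?_, fun hV =>
    hV.preimage (continuous_fixMk K)⟩, fixMk_surjective K⟩
  by_cases h0 : F.barBase T ∈ Subtype.val '' V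
  -- The complement of `V` misses the base point; its preimage in a simplex lies in the face up to
  -- the last fixed vertex, where closedness can be tested.
  · rw [← isClosed_compl_iff]
    have h0' : F.barBase T ∉ Subtype.val '' Vᶜ := by
      rintro ⟨z, hz, hz'⟩
      obtain ⟨w, hw, hw'⟩ := h0
      exact hz (by rwa [show z = w from Subtype.ext (hz'.trans hw'.symm)])
    have : IsClosed (Subtype.val '' Vᶜ : Set (F.Bar T)) := by
      refine (isQuotientMap_quot_mk (r := F.BarRel T)).isClosed_preimage.1 ?_
      refine isClosed_sigma_iff.2 fun i => ?_
      obtain ⟨n, A, p⟩ := i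
      change IsClosed {y : F.obj (A.obj 0).S (A.obj 0).H × stdSimplex ℝ (Fin (n + 1)) |
        F.barMk A p y.1 y.2 ∈ Subtype.val '' Vᶜ}
      have htop : ∀ y : F.obj (A.obj 0).S (A.obj 0).H × stdSimplex ℝ (Fin (n + 1)),
          F.barMk A p y.1 y.2 ∈ Subtype.val '' Vᶜ → topVertex y.2 ∈ fixedVertices K p := by
        rintro y ⟨z, hz, hy⟩
        refine tail_isFixed (F := F) (a := ⟨⟨n, A, p⟩, y⟩) K (fun h => h0' ?_) ?_
        · rw [← h]
          exact ⟨z, hz, hy⟩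
        · have := z.2
          rwa [hy] at this
      rcases fixedVertices_eq K p with he | ⟨v, hv, hmax⟩
      · convert! isClosed_empty
        refine Set.eq_empty_of_forall_notMem fun y hy => ?_
        have := htop y hy
        rw [he] at this
        exact this
      · have hp := isFixed_faceCorep_truncate K hv
        have c1 : IsClosed {y : F.obj (A.obj 0).S (A.obj 0).H × stdSimplex ℝ (Fin (n + 1)) |
            stdSimplex.map (truncate v) y.2 = y.2} :=
          isClosed_eq ((stdSimplex.continuous_map _).comp continuous_snd) continuous_snd
        have c2 := (isOpen_barMk_preimage K hV hp).preimage
          (((faceAct (truncate v) A).continuous.comp continuous_fst).prodMk continuous_snd)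
        convert! c1.inter c2.isClosed_compl using 1
        ext y
        have key : ∀ z : F.Bar T, z ∈ MulAction.fixedPoints K (F.Bar T) →
            (z ∈ Subtype.val '' Vᶜ ↔ z ∉ Subtype.val '' V) := fun z hz => by
          refine ⟨?_, fun h => ⟨⟨z, hz⟩, fun h' => h ⟨_, h', rfl⟩, rfl⟩⟩
          rintro ⟨w, hw, rfl⟩ ⟨w', hw', h⟩
          exact hw (by rwa [← show w' = w from Subtype.ext h])
        constructor
        · intro hy
          have hle : ∀ i, y.2 i ≠ 0 → i ≤ v := fun i hi =>
            (le_topVertex hi).trans (hmax _ (htop y hy))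
          refine ⟨map_truncate hle, ?_⟩
          refine (key _ (barMk_mem_fixedPoints K hp _ _)).1 ?_
          exact (barMk_truncate p y.1 hle).symm ▸ hy
        · rintro ⟨h1, h2⟩
          have h3 := (key _ (barMk_mem_fixedPoints K hp _ _)).2 h2
          exact (congrArg (· ∈ Subtype.val '' Vᶜ)
            (barMk_truncate (F := F) p y.1 fun i => le_of_map_truncate h1)).mp h3
    have h2 := this.preimage (f := (Subtype.val : MulAction.fixedPoints K (F.Bar T) → F.Bar T))
      continuous_subtype_val
    rwa [Set.preimage_image_eq _ Subtype.val_injective] at h2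
  -- The set `spread V` is open and cuts out `V` on the fixed points.
  · let P : F.Bar T → Prop := Quot.lift (spread K (Subtype.val '' V)) fun _ _ => spread_rel K h0
    have hP : IsOpen {z | P z} := by
      refine (isQuotientMap_quot_mk (r := F.BarRel T)).isOpen_preimage.1 ?_
      refine isOpen_sigma_iff.2 fun i => ?_
      obtain ⟨n, A, p⟩ := i
      change IsOpen {y : F.obj (A.obj 0).S (A.obj 0).H × stdSimplex ℝ (Fin (n + 1)) |
        0 < mass (fixedVertices K p) y.2 ∧
          F.barMk A p y.1 (condOn (fixedVertices K p) y.2) ∈ Subtype.val '' V}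
      rcases fixedVertices_eq K p with he | ⟨v, hv, hmax⟩
      · convert! isOpen_empty
        refine Set.eq_empty_of_forall_notMem fun y hy => ?_
        have := hy.1
        rw [he] at this
        simp [mass] at this
      · have hp := isFixed_faceCorep_truncate K hv
        have o1 : IsOpen {y : F.obj (A.obj 0).S (A.obj 0).H × stdSimplex ℝ (Fin (n + 1)) |
            0 < mass (fixedVertices K p) y.2} :=
          isOpen_lt continuous_const ((continuous_mass _).comp continuous_snd)
        have c : ContinuousOn (fun y : F.obj (A.obj 0).S (A.obj 0).H × stdSimplex ℝ (Fin (n + 1)) =>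
            (faceAct (truncate v) A y.1, condOn (fixedVertices K p) y.2))
            {y | 0 < mass (fixedVertices K p) y.2} :=
          ((faceAct (truncate v) A).continuous.comp continuous_fst).continuousOn.prodMk
            ((continuousOn_condOn _).comp continuous_snd.continuousOn fun _ h => h)
        convert! c.isOpen_inter_preimage o1 (isOpen_barMk_preimage K hV hp) using 1
        ext y
        refine and_congr_right fun hy => ?_
        have := barMk_truncate (F := F) p y.1 (v := v)
          (t := condOn (fixedVertices K p) y.2) fun i hi => hmax i (mem_of_condOn_ne_zero hy hi)
        rw [← this]
        rfl
    have h2 := hP.preimage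
      (continuous_subtype_val (p := fun z => z ∈ MulAction.fixedPoints K (F.Bar T)))
    convert! h2 using 1
    ext z
    obtain ⟨⟨⟨⟨n, A, p⟩, hp⟩, x, t⟩, rfl⟩ := fixMk_surjective K z
    change _ ↔ 0 < mass (fixedVertices K p) t ∧
      F.barMk A p x (condOn (fixedVertices K p) t) ∈ Subtype.val '' V
    rw [fixedVertices_eq_univ K hp, mass_univ, condOn_univ]
    constructor
    · exact fun h => ⟨one_pos, _, h, rfl⟩
    · rintro ⟨-, w, hw, h⟩
      have : w = fixMk K ⟨⟨⟨n, A, p⟩, hp⟩, x, t⟩ := Subtype.ext h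
      rwa [← this]

end Fixed

end GammaOSpace

/-! ### Simplices with a further vertex -/

section Join

variable {m n : ℕ}

/-- The point of the join of `Δⁿ` with a further vertex at distance `s` from `t`. -/
def joinPt (t : stdSimplex ℝ (Fin (n + 1))) (s : unitInterval) : stdSimplex ℝ (Fin (n + 2)) :=
  ⟨Fin.lastCases (motive := fun _ => ℝ) s fun j => (1 - s) * t j, by
    refine ⟨fun i => ?_, ?_⟩
    · cases i using Fin.lastCases with
      | last => simpa using s.2.1
      | cast j => simpa using mul_nonneg (sub_nonneg.2 s.2.2) (stdSimplex.zero_le t j)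
    · rw [Fin.sum_univ_castSucc]
      simp [← Finset.mul_sum]⟩

@[simp] theorem joinPt_last (t : stdSimplex ℝ (Fin (n + 1))) (s : unitInterval) :
    joinPt t s (Fin.last (n + 1)) = s :=
  Fin.lastCases_last (motive := fun _ => ℝ)

@[simp] theorem joinPt_castSucc (t : stdSimplex ℝ (Fin (n + 1))) (s : unitInterval)
    (j : Fin (n + 1)) : joinPt t s j.castSucc = (1 - s) * t j :=
  Fin.lastCases_castSucc (motive := fun _ => ℝ) j

theorem continuous_joinPt :
    Continuous fun q : stdSimplex ℝ (Fin (n + 1)) × unitInterval => joinPt q.1 q.2 := by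
  refine Continuous.subtype_mk (continuous_pi fun i => ?_) _
  cases i using Fin.lastCases with
  | last =>
    simp only [Fin.lastCases_last]
    fun_prop
  | cast j =>
    simp only [Fin.lastCases_castSucc]
    exact (continuous_const.sub (continuous_subtype_val.comp continuous_snd)).mul
      ((continuous_apply_simplex j).comp continuous_fst)

/-- The extension of a monotone map to a further last vertex. -/
def joinMap (θ : Fin (m + 1) →o Fin (n + 1)) : Fin (m + 2) →o Fin (n + 2) where
  toFun := Fin.lastCases (Fin.last _) fun j => (θ j).castSucc
  monotone' i j h := by
    cases j using Fin.lastCases with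
    | last => simpa using Fin.le_last _
    | cast j =>
      cases i using Fin.lastCases with
      | last => exact absurd h (not_le.2 (Fin.castSucc_lt_last j))
      | cast i => simpa using θ.monotone (Fin.castSucc_le_castSucc_iff.1 h)

@[simp] theorem joinMap_last (θ : Fin (m + 1) →o Fin (n + 1)) :
    joinMap θ (Fin.last _) = Fin.last _ :=
  Fin.lastCases_last (motive := fun _ => Fin (n + 2))

@[simp] theorem joinMap_castSucc (θ : Fin (m + 1) →o Fin (n + 1)) (j : Fin (m + 1)) :
    joinMap θ j.castSucc = (θ j).castSucc :=
  Fin.lastCases_castSucc (motive := fun _ => Fin (n + 2)) j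

theorem map_joinPt (θ : Fin (m + 1) →o Fin (n + 1)) (t : stdSimplex ℝ (Fin (m + 1)))
    (s : unitInterval) :
    stdSimplex.map (joinMap θ) (joinPt t s) = joinPt (stdSimplex.map θ t) s := by
  refine stdSimplex.ext (funext fun i => ?_)
  rw [stdSimplex_map_apply, Finset.sum_filter, Fin.sum_univ_castSucc]
  cases i using Fin.lastCases with
  | last => simp [(Fin.castSucc_lt_last _).ne]
  | cast i =>
    simp [(Fin.castSucc_lt_last _).ne', stdSimplex_map_apply, Finset.sum_filter, Finset.mul_sum]

theorem joinPt_zero (t : stdSimplex ℝ (Fin (n + 1))) :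
    joinPt t 0 = stdSimplex.map Fin.castSucc t := by
  refine stdSimplex.ext (funext fun i => ?_)
  rw [stdSimplex_map_apply, Finset.sum_filter]
  cases i using Fin.lastCases with
  | last => simp [(Fin.castSucc_lt_last _).ne]
  | cast i => simp

theorem joinPt_one (t : stdSimplex ℝ (Fin (n + 1))) :
    joinPt t 1 = stdSimplex.map (fun _ : Fin 1 => Fin.last (n + 1)) (stdSimplex.vertex 0) := by
  rw [stdSimplex.map_vertex]
  refine stdSimplex.ext (funext fun i => ?_)
  cases i using Fin.lastCases with
  | last => simp
  | cast i => simp [(Fin.castSucc_lt_last _).ne]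

/-- The order isomorphism between `[n + 1]` and `[n]` with a further top element. -/
def toWithTop (n : ℕ) : Fin (n + 2) →o WithTop (Fin (n + 1)) where
  toFun := Fin.lastCases ⊤ fun j => (j : WithTop (Fin (n + 1)))
  monotone' i j h := by
    cases j using Fin.lastCases with
    | last => simp
    | cast j =>
      cases i using Fin.lastCases with
      | last => exact absurd h (not_le.2 (Fin.castSucc_lt_last j))
      | cast i => simpa using Fin.castSucc_le_castSucc_iff.1 h

@[simp] theorem toWithTop_last : toWithTop n (Fin.last _) = ⊤ :=
  Fin.lastCases_last (motive := fun _ => WithTop (Fin (n + 1)))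

@[simp] theorem toWithTop_castSucc (j : Fin (n + 1)) : toWithTop n j.castSucc = j :=
  Fin.lastCases_castSucc (motive := fun _ => WithTop (Fin (n + 1))) j

theorem withTopMap_toWithTop (θ : Fin (m + 1) →o Fin (n + 1)) :
    (OrderHom.withTopMap θ).comp (toWithTop m) = (toWithTop n).comp (joinMap θ) := by
  refine OrderHom.ext _ _ (funext fun i => ?_)
  cases i using Fin.lastCases with
  | last => simp
  | cast i => simp

end Join

/-! ### Fixed elements of `M` as morphisms -/

/-- The `G`-map `G/K → Y` with value `y` at the unit coset. -/
def orbMap {Y : Type*} [MulAction G Y] (K : Subgroup G) (y : Y) (hy : ∀ k ∈ K, k • y = y) :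
    (G ⧸ K) →[G] Y where
  toFun c := Quotient.liftOn' c (fun g => g • y) fun a b h => by
    have := hy _ (QuotientGroup.leftRel_apply.1 h)
    rw [mul_smul, inv_smul_eq_iff] at this
    exact this.symm
  map_smul' g c := Quotient.inductionOn' c fun a => mul_smul g a y

theorem orbMap_ext {Y : Type*} [MulAction G Y] {K : Subgroup G} {f g : (G ⧸ K) →[G] Y}
    (h : f ((1 : G) : G ⧸ K) = g ((1 : G) : G ⧸ K)) : f = g := by
  refine MulActionHom.ext fun c => Quotient.inductionOn' c fun a => ?_
  have : (Quotient.mk'' a : G ⧸ K) = a • ((1 : G) : G ⧸ K) :=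
    congrArg (fun b : G => (b : G ⧸ K)) (mul_one a).symm
  rw [this, map_smul, map_smul, h]

/-- Morphisms of `𝒟` are determined by their values at the unit coset. -/
theorem OrbHom.hom_ext {A B : OrbObj G} {φ ψ : A ⟶ B}
    (h1 : OrbHom.orb φ ((1 : G) : G ⧸ B.H) = OrbHom.orb ψ ((1 : G) : G ⧸ B.H))
    (h2 : OrbHom.hom φ ((1 : G) : G ⧸ B.H) = OrbHom.hom ψ ((1 : G) : G ⧸ B.H)) : φ = ψ :=
  OrbHom.ext (orbMap_ext h1) (orbMap_ext h2)

namespace Corep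

variable {T T' : GammaObj G} {K K' : Subgroup G} {A B : OrbObj G}

/-- The morphism `A → (T, G/K)` that corresponds to an element of `M(A)(T)` fixed by `K`. -/
def toHom (p : Corep T A) (hp : p.IsFixed K) : A ⟶ (⟨T, K⟩ : OrbObj G) :=
  (⟨orbMap K p.1 fun k hk => congrArg Prod.fst (hp k hk),
    orbMap K p.2 fun k hk => congrArg Prod.snd (hp k hk)⟩ : OrbHom A ⟨T, K⟩)

theorem toHom_orb_one (p : Corep T A) (hp : p.IsFixed K) :
    OrbHom.orb (toHom p hp) ((1 : G) : G ⧸ K) = p.1 :=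
  one_smul G p.1

theorem toHom_hom_one (p : Corep T A) (hp : p.IsFixed K) :
    OrbHom.hom (toHom p hp) ((1 : G) : G ⧸ K) = p.2 :=
  one_smul G p.2

theorem toHom_pull (φ : A ⟶ B) {p : Corep T B} (hp : p.IsFixed K) :
    toHom (pull φ p) (hp.pull φ) = φ ≫ toHom p hp := by
  refine OrbHom.hom_ext ?_ ?_
  · exact (toHom_orb_one _ _).trans (congrArg (OrbHom.orb φ) (toHom_orb_one p hp).symm)
  · refine (toHom_hom_one _ _).trans ?_
    change p.2.comp (OrbHom.hom φ p.1) = GammaHom.comp (OrbHom.hom (toHom p hp) ((1 : G) : G ⧸ K))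
      (OrbHom.hom φ (OrbHom.orb (toHom p hp) ((1 : G) : G ⧸ K)))
    rw [toHom_orb_one, toHom_hom_one]

theorem toHom_isTrivial {p : Corep T A} (hp : p.IsFixed K) (h : p.2 = GammaHom.zero _ _) :
    OrbHom.IsTrivial (toHom p hp) := by
  refine fun c => Quotient.inductionOn' c fun a => ?_
  change a • p.2 = _
  rw [h]
  exact GammaHom.smul_zero a

/-- The universal element of `M(T, G/K)(T)`. -/
def univ (T : GammaObj G) (K : Subgroup G) : Corep T (⟨T, K⟩ : OrbObj G) :=
  ((1 : G), GammaHom.id T)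

theorem univ_isFixed : (univ T K).IsFixed K := fun k hk => by
  refine Prod.ext ?_ (GammaHom.smul_id k)
  change ((k * 1 : G) : G ⧸ K) = ((1 : G) : G ⧸ K)
  refine QuotientGroup.eq.2 ?_
  simpa using hk

theorem toHom_univ : toHom (univ T K) univ_isFixed = 𝟙 (⟨T, K⟩ : OrbObj G) :=
  OrbHom.hom_ext (toHom_orb_one _ _) (toHom_hom_one _ _)

theorem pull_toHom (p : Corep T A) (hp : p.IsFixed K) : pull (toHom p hp) (univ T K) = p :=
  Prod.ext (one_smul G p.1) (one_smul G p.2)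

theorem toHom_pull_univ (φ : A ⟶ (⟨T, K⟩ : OrbObj G)) :
    toHom (pull φ (univ T K)) (univ_isFixed.pull φ) = φ := by
  rw [toHom_pull φ univ_isFixed, toHom_univ, Category.comp_id]

theorem push_eq_pull (ψ : (⟨T, K⟩ : OrbObj G) ⟶ (⟨T', K'⟩ : OrbObj G))
    (h : OrbHom.orb ψ ((1 : G) : G ⧸ K') = ((1 : G) : G ⧸ K)) (p : Corep T A) (hp : p.IsFixed K) :
    push (OrbHom.hom ψ ((1 : G) : G ⧸ K')) p = pull (toHom p hp ≫ ψ) (univ T' K') := by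
  refine Prod.ext ?_ ?_
  · change p.1 = OrbHom.orb (toHom p hp) (OrbHom.orb ψ ((1 : G) : G ⧸ K'))
    rw [h]
    exact (one_smul G p.1).symm
  · change GammaHom.comp _ p.2 = (GammaHom.id T').comp (GammaHom.comp _
      (OrbHom.hom (toHom p hp) (OrbHom.orb ψ ((1 : G) : G ⧸ K'))))
    rw [h]
    exact congrArg (GammaHom.comp _) (one_smul G p.2).symm

end Corep

theorem GammaOSpace.actOn_map_map (F : GammaOSpace G) {J : Type*} [Category* J]
    (C : J ⥤ OrbObj G) {a b c : J} (f : a ⟶ b) (g : b ⟶ c) (x : F.obj (C.obj a).S (C.obj a).H) :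
    F.actOn (C.map g) (F.actOn (C.map f) x) = F.actOn (C.map (f ≫ g)) x := by
  rw [C.map_comp, F.actOn_comp]

theorem Corep.pull_map_map {T : GammaObj G} {J : Type*} [Category* J] (C : J ⥤ OrbObj G) {a b c : J}
    (f : a ⟶ b) (g : b ⟶ c) (p : Corep T (C.obj c)) :
    Corep.pull (C.map f) (Corep.pull (C.map g) p) = Corep.pull (C.map (f ≫ g)) p := by
  rw [C.map_comp, Corep.pull_comp]

namespace GammaOSpace

variable {F : GammaOSpace G} {T T' : GammaObj G} {K K' : Subgroup G} {l m n : ℕ}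

/-! ### The augmentation -/

theorem actOn_comp_toHom_univ {A : OrbObj G} (φ : A ⟶ (⟨T, K⟩ : OrbObj G)) (x : F.obj A.S A.H) :
    F.actOn (φ ≫ Corep.toHom (Corep.univ T K) Corep.univ_isFixed) x = F.actOn φ x := by
  rw [Corep.toHom_univ, Category.comp_id]

variable (F T K) in
/-- The augmentation on simplices: the composite of a chain `A₀ → ⋯ → Aₙ → (T, G/K)` acts on the
component in `F(A₀)`. -/
def augCocone : FixCocone (F := F) K T (F.obj T K) where
  val {n} A p hp x _ := F.actOn (A.map (homOfLE (Fin.zero_le (Fin.last n))) ≫ Corep.toHom p hp) x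
  pt := F.base T K
  face θ A p hp x t := by
    change F.actOn (A.map _ ≫ Corep.toHom (Corep.pull (A.map _) p) _) (F.actOn (A.map _) x) = _
    rw [Corep.toHom_pull _ hp, ← F.actOn_comp, ← Category.assoc, ← Category.assoc, ← A.map_comp,
      ← A.map_comp]
    rfl
  collapse A p hp x t h := by
    rcases h with h | ⟨j, hj⟩ | h
    · rw [show x = F.base _ _ from h]
      exact F.actOn_base _
    · exact F.actOn_trivial ((OrbHom.IsTrivial.map hj (Fin.zero_le _) (Fin.le_last _) _).comp_right
        _) x
    · exact F.actOn_trivial ((Corep.toHom_isTrivial hp h).comp_left _) x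

variable (F T K) in
/-- The augmentation `(C F)(T)^K → F(T)(G/K)`. -/
def aug : C(MulAction.fixedPoints K (F.Bar T), F.obj T K) where
  toFun z := (augCocone F T K).lift z.1
  continuous_toFun := by
    refine (isQuotientMap_fixMk K).continuous_iff.2 (continuous_sigma fun i => ?_)
    obtain ⟨⟨n, A, p⟩, hp⟩ := i
    have : Continuous fun y : F.obj (A.obj 0).S (A.obj 0).H × stdSimplex ℝ (Fin (n + 1)) =>
        F.actOn (A.map (homOfLE (Fin.zero_le (Fin.last n))) ≫ Corep.toHom p hp) y.1 := by
      fun_prop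
    exact this.congr fun y => ((augCocone F T K).lift_barMk hp y.1 y.2).symm

theorem aug_barMk {A : ComposableArrows (OrbObj G) n} {p : Corep T (A.obj (Fin.last n))}
    (hp : p.IsFixed K) (x : F.obj (A.obj 0).S (A.obj 0).H) (t : stdSimplex ℝ (Fin (n + 1)))
    (h : F.barMk A p x t ∈ MulAction.fixedPoints K (F.Bar T)) :
    aug F T K ⟨F.barMk A p x t, h⟩ =
      F.actOn (A.map (homOfLE (Fin.zero_le (Fin.last n))) ≫ Corep.toHom p hp) x :=
  (augCocone F T K).lift_barMk hp x t

/-- Naturality of the augmentation. -/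
theorem aug_barPush (ψ : (⟨T, K⟩ : OrbObj G) ⟶ (⟨T', K'⟩ : OrbObj G))
    (h : OrbHom.orb ψ ((1 : G) : G ⧸ K') = ((1 : G) : G ⧸ K))
    (z : MulAction.fixedPoints K (F.Bar T))
    (hz : F.barPush (OrbHom.hom ψ ((1 : G) : G ⧸ K')) z.1 ∈
      MulAction.fixedPoints K' (F.Bar T')) :
    aug F T' K' ⟨_, hz⟩ = F.actOn ψ (aug F T K z) := by
  obtain ⟨⟨⟨⟨n, A, p⟩, hp⟩, x, t⟩, rfl⟩ := fixMk_surjective K z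
  have e := Corep.push_eq_pull ψ h p hp
  have hp' : (Corep.push (OrbHom.hom ψ ((1 : G) : G ⧸ K')) p).IsFixed K' := by
    rw [e]
    exact Corep.univ_isFixed.pull _
  have e' : Corep.toHom _ hp' = Corep.toHom p hp ≫ ψ := by
    refine Eq.trans ?_ (Corep.toHom_pull_univ _)
    congr 1
  refine (aug_barMk hp' x t hz).trans ?_
  rw [e', ← Category.assoc, F.actOn_comp]
  exact congrArg (F.actOn ψ) (aug_barMk hp x t _).symm

/-! ### The contraction of the bar construction -/

/-- The chain `A₀ → ⋯ → Aₙ → B`. -/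
def cone (A : ComposableArrows (OrbObj G) n) {B : OrbObj G} (φ : A.obj (Fin.last n) ⟶ B) :
    WithTop (Fin (n + 1)) ⥤ OrbObj G where
  obj
    | none => B
    | some i => A.obj i
  map {a b} h := match a, b, h with
    | none, none, _ => 𝟙 B
    | some i, none, _ => A.map (homOfLE (Fin.le_last i)) ≫ φ
    | some _, some _, h => A.map (homOfLE (WithTop.coe_le_coe.1 (leOfHom h)))
    | none, some j, h => absurd (leOfHom h) (WithTop.not_top_le_coe j)
  map_id a := match a with
    | none => rfl
    | some i => A.map_id i
  map_comp {a b c} f g := match a, b, c, f, g with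
    | none, none, none, _, _ => (Category.id_comp _).symm
    | some _, none, none, _, _ => (Category.comp_id _).symm
    | some i, some j, none, f, g => by
      change A.map _ ≫ φ = A.map _ ≫ A.map _ ≫ φ
      rw [← Category.assoc, ← A.map_comp]
      rfl
    | some i, some j, some k, f, g => by
      change A.map _ = A.map _ ≫ A.map _
      rw [← A.map_comp]
      rfl
    | none, some j, _, f, _ => absurd (leOfHom f) (WithTop.not_top_le_coe j)
    | _, none, some j, _, g => absurd (leOfHom g) (WithTop.not_top_le_coe j)

theorem cone_face (θ : Fin (m + 1) →o Fin (n + 1)) (A : ComposableArrows (OrbObj G) n)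
    {B : OrbObj G} (φ : A.obj (Fin.last n) ⟶ B) :
    cone (faceChain θ A) (A.map (homOfLE (Fin.le_last (θ (Fin.last m)))) ≫ φ) =
      (OrderHom.withTopMap θ).monotone.functor ⋙ cone A φ := by
  refine CategoryTheory.Functor.ext (fun a => match a with
    | none => rfl
    | some i => rfl) fun a b h => ?_
  match a, b, h with
  | none, none, _ => rfl
  | some i, none, _ =>
    have e : A.map (homOfLE (θ.monotone (Fin.le_last i))) ≫
        A.map (homOfLE (Fin.le_last (θ (Fin.last m)))) ≫ φ =
        A.map (homOfLE (Fin.le_last (θ i))) ≫ φ := by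
      rw [← Category.assoc, ← A.map_comp]
      rfl
    exact e.trans ((Category.id_comp _).trans (Category.comp_id _)).symm
  | some i, some j, h =>
    exact ((Category.id_comp _).trans (Category.comp_id _)).symm
  | none, some j, h => exact absurd (leOfHom h) (WithTop.not_top_le_coe j)

theorem coe_zero_le (a : WithTop (Fin (n + 1))) : ((0 : Fin (n + 1)) : WithTop (Fin (n + 1))) ≤ a :=
  match a with
  | none => le_top
  | some i => WithTop.coe_le_coe.2 (Fin.zero_le i)

/-- The point of the bar construction given by a diagram on `[n]` with a further top element and
a point of a simplex that is mapped to it. -/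
def coneMk (C : WithTop (Fin (n + 1)) ⥤ OrbObj G) (κ : Fin (m + 1) →o WithTop (Fin (n + 1)))
    (x : F.obj (C.obj ((0 : Fin (n + 1)) : WithTop (Fin (n + 1)))).S
      (C.obj ((0 : Fin (n + 1)) : WithTop (Fin (n + 1)))).H)
    (p : Corep T (C.obj ⊤)) (t : stdSimplex ℝ (Fin (m + 1))) : F.Bar T :=
  F.barMk (κ.monotone.functor ⋙ C)
    (Corep.pull (C.map (homOfLE (le_top : κ (Fin.last m) ≤ ⊤))) p)
    (F.actOn (C.map (homOfLE (coe_zero_le (κ 0)))) x) t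

theorem coneMk_congr {C C' : WithTop (Fin (n + 1)) ⥤ OrbObj G} (h : C = C')
    (κ : Fin (m + 1) →o WithTop (Fin (n + 1)))
    {x : F.obj (C.obj ((0 : Fin (n + 1)) : WithTop (Fin (n + 1)))).S
      (C.obj ((0 : Fin (n + 1)) : WithTop (Fin (n + 1)))).H}
    {x' : F.obj (C'.obj ((0 : Fin (n + 1)) : WithTop (Fin (n + 1)))).S
      (C'.obj ((0 : Fin (n + 1)) : WithTop (Fin (n + 1)))).H} (hx : HEq x x')
    {p : Corep T (C.obj ⊤)} {p' : Corep T (C'.obj ⊤)} (hp : HEq p p')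
    (t : stdSimplex ℝ (Fin (m + 1))) : coneMk C κ x p t = coneMk C' κ x' p' t := by
  subst h
  rw [eq_of_heq hx, eq_of_heq hp]

theorem coneMk_map (C : WithTop (Fin (n + 1)) ⥤ OrbObj G)
    (κ : Fin (m + 1) →o WithTop (Fin (n + 1))) (θ : Fin (l + 1) →o Fin (m + 1))
    (x : F.obj (C.obj ((0 : Fin (n + 1)) : WithTop (Fin (n + 1)))).S
      (C.obj ((0 : Fin (n + 1)) : WithTop (Fin (n + 1)))).H)
    (p : Corep T (C.obj ⊤)) (t : stdSimplex ℝ (Fin (l + 1))) :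
    coneMk C (κ.comp θ) x p t = coneMk C κ x p (stdSimplex.map θ t) := by
  refine Eq.trans ?_ (barMk_face θ (κ.monotone.functor ⋙ C) _ _ t)
  refine congrArg₂ (fun p x => F.barMk ((κ.comp θ).monotone.functor ⋙ C) p x t) ?_ ?_
  · exact (Corep.pull_map_map C _ _ p).symm
  · exact (F.actOn_map_map C _ _ x).symm

theorem coneMk_comp (Ψ : Fin (m + 1) →o Fin (n + 1)) (C : WithTop (Fin (n + 1)) ⥤ OrbObj G)
    (κ : Fin (l + 1) →o WithTop (Fin (m + 1)))
    (x : F.obj (C.obj ((0 : Fin (n + 1)) : WithTop (Fin (n + 1)))).S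
      (C.obj ((0 : Fin (n + 1)) : WithTop (Fin (n + 1)))).H)
    (p : Corep T (C.obj ⊤)) (t : stdSimplex ℝ (Fin (l + 1))) :
    coneMk ((OrderHom.withTopMap Ψ).monotone.functor ⋙ C) κ
        (F.actOn (C.map (homOfLE (coe_zero_le ((Ψ 0 : Fin (n + 1)) : WithTop (Fin (n + 1)))))) x)
        p t =
      coneMk C ((OrderHom.withTopMap Ψ).comp κ) x p t := by
  exact congrArg (fun x => F.barMk (((OrderHom.withTopMap Ψ).comp κ).monotone.functor ⋙ C) _ x t)
    (F.actOn_map_map C _ _ x)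

theorem coneMk_mem_fixedPoints (C : WithTop (Fin (n + 1)) ⥤ OrbObj G)
    (κ : Fin (m + 1) →o WithTop (Fin (n + 1)))
    (x : F.obj (C.obj ((0 : Fin (n + 1)) : WithTop (Fin (n + 1)))).S
      (C.obj ((0 : Fin (n + 1)) : WithTop (Fin (n + 1)))).H)
    {p : Corep T (C.obj ⊤)} (hp : p.IsFixed K) (t : stdSimplex ℝ (Fin (m + 1))) :
    coneMk C κ x p t ∈ MulAction.fixedPoints K (F.Bar T) :=
  barMk_mem_fixedPoints K (hp.pull _) _ _

theorem aug_coneMk (C : WithTop (Fin (n + 1)) ⥤ OrbObj G)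
    (κ : Fin (m + 1) →o WithTop (Fin (n + 1)))
    (x : F.obj (C.obj ((0 : Fin (n + 1)) : WithTop (Fin (n + 1)))).S
      (C.obj ((0 : Fin (n + 1)) : WithTop (Fin (n + 1)))).H)
    {p : Corep T (C.obj ⊤)} (hp : p.IsFixed K) (t : stdSimplex ℝ (Fin (m + 1)))
    (h : coneMk C κ x p t ∈ MulAction.fixedPoints K (F.Bar T)) :
    aug F T K ⟨_, h⟩ = F.actOn (C.map (homOfLE (coe_zero_le ⊤)) ≫ Corep.toHom p hp) x := by
  refine (aug_barMk (hp.pull _) _ t h).trans ?_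
  rw [Corep.toHom_pull _ hp]
  refine (F.actOn_comp (C.map (homOfLE (κ.monotone (Fin.zero_le (Fin.last m)))))
    (C.map (homOfLE le_top) ≫ Corep.toHom p hp) _).trans ?_
  refine (F.actOn_comp _ _ _).trans (Eq.trans ?_ (F.actOn_comp _ _ _).symm)
  refine congrArg (F.actOn (Corep.toHom p hp)) ?_
  exact (congrArg (F.actOn _) (F.actOn_map_map C _ _ x)).trans (F.actOn_map_map C _ _ x)

theorem coneMk_collapse {A : ComposableArrows (OrbObj G) n} {p : Corep T (A.obj (Fin.last n))}
    (hp : p.IsFixed K) {x : F.obj (A.obj 0).S (A.obj 0).H} {t : stdSimplex ℝ (Fin (n + 1))}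
    (h : F.IsCollapsed ⟨⟨n, A, p⟩, x, t⟩) (t' : stdSimplex ℝ (Fin (n + 2))) :
    coneMk (cone A (Corep.toHom p hp)) (toWithTop n) x (Corep.univ T K) t' = F.barBase T := by
  refine mk_eq_barBase ?_
  rcases h with h | ⟨j, hj⟩ | h
  · refine Or.inl ?_
    change F.actOn _ x = _
    rw [show x = F.base _ _ from h]
    exact F.actOn_base _
  · refine Or.inr (Or.inl ⟨j.castSucc, ?_⟩)
    have key : ∀ (a b : WithTop (Fin (n + 1))) (hab : a ≤ b), a = (j.castSucc : Fin (n + 1)) →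
        b = (j.succ : Fin (n + 1)) →
        OrbHom.IsTrivial ((cone A (Corep.toHom p hp)).map (homOfLE hab)) := by
      rintro _ _ hab rfl rfl
      exact hj
    refine key _ _ ((toWithTop n).monotone (Fin.castSucc_le_succ _)) (toWithTop_castSucc _) ?_
    rw [Fin.succ_castSucc]
    exact toWithTop_castSucc _
  · refine Or.inr (Or.inl ⟨Fin.last n, ?_⟩)
    have key : ∀ (a b : WithTop (Fin (n + 1))) (hab : a ≤ b), a = (Fin.last n : Fin (n + 1)) →
        b = ⊤ → OrbHom.IsTrivial ((cone A (Corep.toHom p hp)).map (homOfLE hab)) := by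
      rintro _ _ hab rfl rfl
      exact (Corep.toHom_isTrivial hp h).comp_left _
    exact key _ _ ((toWithTop n).monotone (Fin.castSucc_le_succ _)) (toWithTop_castSucc _)
      toWithTop_last

variable (F T K) in
/-- The contraction on simplices: a point `t` of the simplex `A₀ → ⋯ → Aₙ` moves towards the last
vertex of the simplex `A₀ → ⋯ → Aₙ → (T, G/K)`. -/
def contractCocone (s : unitInterval) : FixCocone (F := F) K T (F.Bar T) where
  val {n} A p hp x t :=
    coneMk (cone A (Corep.toHom p hp)) (toWithTop n) x (Corep.univ T K) (joinPt t s)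
  pt := F.barBase T
  face {m n} θ A p hp x t := by
    rw [← map_joinPt]
    refine Eq.trans ?_ (coneMk_map (cone A (Corep.toHom p hp)) (toWithTop n) (joinMap θ) x
      (Corep.univ T K) (joinPt t s))
    rw [← withTopMap_toWithTop]
    refine Eq.trans ?_ (coneMk_comp θ (cone A (Corep.toHom p hp)) (toWithTop m) x
      (Corep.univ T K) (joinPt t s))
    exact coneMk_congr (F := F) (T := T)
      ((congrArg (cone (faceChain θ A)) (Corep.toHom_pull _ hp)).trans (cone_face θ A _))
      (toWithTop m) (HEq.refl (faceAct θ A x)) (HEq.refl (Corep.univ T K)) (joinPt t s)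
  collapse A p hp x t h := coneMk_collapse hp h _

theorem lift_contractCocone_mem (s : unitInterval) (z : MulAction.fixedPoints K (F.Bar T)) :
    (contractCocone F T K s).lift z.1 ∈ MulAction.fixedPoints K (F.Bar T) := by
  obtain ⟨⟨⟨⟨n, A, p⟩, hp⟩, x, t⟩, rfl⟩ := fixMk_surjective K z
  refine (congrArg (· ∈ MulAction.fixedPoints K (F.Bar T))
    ((contractCocone F T K s).lift_barMk hp x t)).mpr ?_
  exact coneMk_mem_fixedPoints (cone A (Corep.toHom p hp)) _ x (Corep.univ_isFixed (T := T)) _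

theorem continuous_barMk (A : ComposableArrows (OrbObj G) n) (p : Corep T (A.obj (Fin.last n))) :
    Continuous fun y : F.obj (A.obj 0).S (A.obj 0).H × stdSimplex ℝ (Fin (n + 1)) =>
      F.barMk A p y.1 y.2 := by
  refine continuous_quot_mk.comp ?_
  exact continuous_sigmaMk (ι := BarIndex T) (σ := fun i => F.obj (i.chain.obj 0).S
    (i.chain.obj 0).H × stdSimplex ℝ (Fin (i.n + 1))) (i := ⟨n, A, p⟩)

variable (F T K) in
/-- The contraction of `(C F)(T)^K` onto `F(T)(G/K)`. -/
def contract : C(MulAction.fixedPoints K (F.Bar T) × unitInterval,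
    MulAction.fixedPoints K (F.Bar T)) where
  toFun q := ⟨(contractCocone F T K q.2).lift q.1.1, lift_contractCocone_mem q.2 q.1⟩
  continuous_toFun := by
    refine (isQuotientMap_fixMk K).continuous_lift_prod_left ?_
    refine Continuous.subtype_mk ?_ _
    rw [← (Homeomorph.sigmaProdDistrib).symm.comp_continuous_iff']
    refine continuous_sigma fun i => ?_
    obtain ⟨⟨n, A, p⟩, hp⟩ := i
    have c : Continuous fun q : (F.obj (A.obj 0).S (A.obj 0).H × stdSimplex ℝ (Fin (n + 1))) ×
        unitInterval => coneMk (cone A (Corep.toHom p hp)) (toWithTop n) q.1.1 (Corep.univ T K)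
          (joinPt q.1.2 q.2) := by
      refine (continuous_barMk (F := F) _ _).comp (Continuous.prodMk ?_ ?_)
      · exact (F.actOn _).continuous.comp (continuous_fst.comp continuous_fst)
      · exact continuous_joinPt.comp ((continuous_snd.comp continuous_fst).prodMk continuous_snd)
    exact c.congr fun q => ((contractCocone F T K q.2).lift_barMk hp q.1.1 q.1.2).symm

theorem contract_barMk {A : ComposableArrows (OrbObj G) n} {p : Corep T (A.obj (Fin.last n))}
    (hp : p.IsFixed K) (x : F.obj (A.obj 0).S (A.obj 0).H) (t : stdSimplex ℝ (Fin (n + 1)))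
    (s : unitInterval) :
    contract F T K (fixMk K ⟨⟨⟨n, A, p⟩, hp⟩, x, t⟩, s) =
      ⟨coneMk (cone A (Corep.toHom p hp)) (toWithTop n) x (Corep.univ T K) (joinPt t s),
        coneMk_mem_fixedPoints (cone A (Corep.toHom p hp)) (toWithTop n) x
          (Corep.univ_isFixed (T := T)) _⟩ :=
  Subtype.ext ((contractCocone F T K s).lift_barMk hp x t)

variable (T K) in
/-- The chain of length zero at `(T, G/K)`. -/
def vertexChain : ComposableArrows (OrbObj G) 0 := (Functor.const (Fin 1)).obj ⟨T, K⟩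

variable (F T K) in
/-- The section `F(T)(G/K) → (C F)(T)^K` given by the vertex `(T, G/K)`. -/
def augSection : C(F.obj T K, MulAction.fixedPoints K (F.Bar T)) where
  toFun y := ⟨F.barMk (vertexChain T K) (Corep.univ T K) y (stdSimplex.vertex 0),
    barMk_mem_fixedPoints (A := vertexChain T K) K (Corep.univ_isFixed (T := T)) y _⟩
  continuous_toFun := by
    refine Continuous.subtype_mk ?_ _
    exact (continuous_barMk (F := F) (vertexChain T K) (Corep.univ T K)).comp
      (continuous_id.prodMk continuous_const)

theorem coneMk_joinPt_zero {A : ComposableArrows (OrbObj G) n} {p : Corep T (A.obj (Fin.last n))}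
    (hp : p.IsFixed K) (x : F.obj (A.obj 0).S (A.obj 0).H) (t : stdSimplex ℝ (Fin (n + 1))) :
    coneMk (cone A (Corep.toHom p hp)) (toWithTop n) x (Corep.univ T K) (joinPt t 0) =
      F.barMk A p x t := by
  let c : Fin (n + 1) →o Fin (n + 2) := ⟨Fin.castSucc, Fin.strictMono_castSucc.monotone⟩
  let κ : Fin (n + 1) →o WithTop (Fin (n + 1)) := ⟨fun i => i, fun _ _ => WithTop.coe_le_coe.2⟩
  have hκ : (toWithTop n).comp c = κ := OrderHom.ext _ _ (funext toWithTop_castSucc)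
  have hj : joinPt t 0 = stdSimplex.map c t := joinPt_zero t
  rw [hj]
  refine (coneMk_map (cone A (Corep.toHom p hp)) (toWithTop n) c x (Corep.univ T K) t).symm.trans ?_
  rw [hκ]
  refine congrArg₂ (fun p x => F.barMk A p x t) ?_ ?_
  · refine Eq.trans ?_ (Corep.pull_toHom p hp)
    change Corep.pull (A.map (𝟙 (Fin.last n)) ≫ Corep.toHom p hp) _ = _
    rw [A.map_id, Category.id_comp]
  · change F.actOn (A.map (𝟙 0)) x = x
    rw [A.map_id, F.actOn_id]

theorem coneMk_joinPt_one {A : ComposableArrows (OrbObj G) n} {p : Corep T (A.obj (Fin.last n))}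
    (hp : p.IsFixed K) (x : F.obj (A.obj 0).S (A.obj 0).H) (t : stdSimplex ℝ (Fin (n + 1))) :
    coneMk (cone A (Corep.toHom p hp)) (toWithTop n) x (Corep.univ T K) (joinPt t 1) =
      augSection F T K (F.actOn (A.map (homOfLE (Fin.zero_le _)) ≫ Corep.toHom p hp) x) := by
  let c : Fin 1 →o Fin (n + 2) := ⟨fun _ => Fin.last _, fun _ _ _ => le_rfl⟩
  let κ : Fin 1 →o WithTop (Fin (n + 1)) := ⟨fun _ => ⊤, fun _ _ _ => le_rfl⟩
  have hκ : (toWithTop n).comp c = κ := OrderHom.ext _ _ (funext fun _ => toWithTop_last)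
  have hj : joinPt t 1 = stdSimplex.map c (stdSimplex.vertex 0) := joinPt_one t
  rw [hj]
  refine (coneMk_map (cone A (Corep.toHom p hp)) (toWithTop n) c x (Corep.univ T K) _).symm.trans ?_
  rw [hκ]
  rfl

theorem aug_augSection (y : F.obj T K) : aug F T K (augSection F T K y) = y := by
  refine (aug_barMk (A := vertexChain T K) (Corep.univ_isFixed (T := T)) y _ _).trans ?_
  refine (actOn_comp_toHom_univ (𝟙 (⟨T, K⟩ : OrbObj G)) y).trans ?_
  exact F.actOn_id (A := ⟨T, K⟩) y

variable (F T K) in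
/-- The fixed points of the coalescence are recovered by the augmentation. -/
theorem isFiberRetraction_aug : IsFiberRetraction (aug F T K) := by
  refine ⟨augSection F T K, contract F T K, aug_augSection, fun z => ?_, fun z => ?_,
    fun z s => ?_⟩
  all_goals obtain ⟨⟨⟨⟨n, A, p⟩, hp⟩, x, t⟩, rfl⟩ := fixMk_surjective K z
  · rw [contract_barMk]
    exact Subtype.ext (coneMk_joinPt_zero hp x t)
  · rw [contract_barMk]
    refine Subtype.ext ((coneMk_joinPt_one hp x t).trans ?_)
    exact congrArg (fun y => (augSection F T K y).1) (aug_barMk hp x t _).symm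
  · rw [contract_barMk]
    refine (aug_coneMk (cone A (Corep.toHom p hp)) _ x (Corep.univ_isFixed (T := T)) _ _).trans ?_
    refine (actOn_comp_toHom_univ _ x).trans ?_
    exact (aug_barMk hp x t _).symm

end GammaOSpace

theorem joined_pi {ι : Type} {A : ι → Type u} [∀ i, TopologicalSpace (A i)] {x y : ∀ i, A i}
    (h : ∀ i, Joined (x i) (y i)) : Joined x y :=
  ⟨Path.pi fun i => (h i).somePath⟩

theorem joinedIn_map {X Y : Type*} [TopologicalSpace X] [TopologicalSpace Y] {f : X → Y}
    (hf : Continuous f) {s : Set X} {t : Set Y} (hst : ∀ x ∈ s, f x ∈ t) {x y : X}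
    (h : JoinedIn s x y) : JoinedIn t (f x) (f y) :=
  ⟨h.somePath.map hf, fun r => hst _ (h.somePath_mem r)⟩

theorem fixedPoints_anti {W : Type*} [MulAction G W] {H K : Subgroup G} (h : H ≤ K) :
    MulAction.fixedPoints K W ⊆ MulAction.fixedPoints H W :=
  fun _ hx g => hx ⟨g.1, h g.2⟩

/-! ### Orbits of finite pointed `G`-sets -/

namespace GammaObj

variable (T : GammaObj G) (K : Subgroup G)

/-- The stabilizer in `K` of an element of `T` other than the marked point. -/
def stab (i : Fin T.n) : Subgroup G where
  carrier := {k | k ∈ K ∧ T.ρ k i = i}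
  one_mem' := ⟨K.one_mem, by simp⟩
  mul_mem' := fun ha hb => ⟨K.mul_mem ha.1 hb.1, by simp [ha.2, hb.2]⟩
  inv_mem' := fun ha => ⟨K.inv_mem ha.1, by
    rw [map_inv, Equiv.Perm.inv_eq_iff_eq]
    exact ha.2.symm⟩

variable {T K} in
theorem stab_le (i : Fin T.n) : T.stab K i ≤ K := fun _ h => h.1

/-- The relation of lying in the same `K`-orbit. -/
def orbitSetoid : Setoid (Fin T.n) where
  r i j := ∃ k ∈ K, T.ρ k i = j
  iseqv :=
    { refl := fun i => ⟨1, K.one_mem, by simp⟩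
      symm := by
        rintro i _ ⟨k, hk, rfl⟩
        exact ⟨k⁻¹, K.inv_mem hk, by simp⟩
      trans := by
        rintro i _ _ ⟨k, hk, rfl⟩ ⟨l, hl, rfl⟩
        exact ⟨l * k, K.mul_mem hl hk, by simp⟩ }

/-- The `K`-orbits of elements of `T` other than the marked point. -/
def Orb : Type := Quotient (T.orbitSetoid K)

variable {T K}

/-- A representative of an orbit. -/
def rep (o : T.Orb K) : Fin T.n := Quotient.out o

/-- The orbit of an element. -/
def orb (K : Subgroup G) (i : Fin T.n) : T.Orb K := Quotient.mk (T.orbitSetoid K) i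

theorem exists_smul_rep (i : Fin T.n) : ∃ k ∈ K, T.ρ k (rep (orb K i)) = i :=
  Quotient.exact (s := T.orbitSetoid K) (Quotient.out_eq _)

theorem orb_eq {i : Fin T.n} {o : T.Orb K} {k : G} (hk : k ∈ K) (h : T.ρ k (rep o) = i) :
    orb K i = o := by
  rw [← Quotient.out_eq o]
  exact (Quotient.sound (s := T.orbitSetoid K) ⟨k, hk, h⟩).symm

theorem smul_el (g : G) (i : Fin T.n) : g • T.el i = T.el (T.ρ g i) := rfl

end GammaObj

namespace GammaGSpace

variable (X : GammaGSpace G) {T : GammaObj G} {K : Subgroup G}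

theorem maps_smul {φ : X.Maps T} (hφ : φ ∈ MulAction.fixedPoints K (X.Maps T)) {k : G} (hk : k ∈ K)
    (s : T.carrier) : φ.1 (k • s) = k • φ.1 s := by
  have h : k • φ = φ := hφ ⟨k, hk⟩
  have h2 : k • φ.1 (k⁻¹ • k • s) = φ.1 (k • s) := congrFun (congrArg Subtype.val h) (k • s)
  rw [← h2, inv_smul_smul]

theorem maps_fixed {φ : X.Maps T} (hφ : φ ∈ MulAction.fixedPoints K (X.Maps T)) (i : Fin T.n) :
    φ.1 (T.el i) ∈ MulAction.fixedPoints (T.stab K i) (X.obj (GammaObj.num G 1)) := fun k => by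
  have h := X.maps_smul hφ k.2.1 (T.el i)
  rw [GammaObj.smul_el, k.2.2] at h
  exact h.symm

theorem map_proj_fixed {x : X.obj T} (hx : x ∈ MulAction.fixedPoints K (X.obj T)) (i : Fin T.n) :
    X.map (GammaHom.proj T i) x ∈
      MulAction.fixedPoints (T.stab K i) (X.obj (GammaObj.num G 1)) := fun k => by
  have h : (k.1⁻¹ : G) • x = x := hx ⟨k.1⁻¹, K.inv_mem k.2.1⟩
  have h2 := X.map_smul k.1 (GammaHom.proj T i) x
  rw [GammaHom.smul_proj, k.2.2, h] at h2
  exact h2.symm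

theorem map_mem_fixedPoints {S : GammaObj G} {f : GammaHom S T} (hf : ∀ k ∈ K, k • f = f)
    {x : X.obj S} (hx : x ∈ MulAction.fixedPoints K (X.obj S)) :
    X.map f x ∈ MulAction.fixedPoints K (X.obj T) := fun k => by
  have h2 := X.map_smul k.1 f x
  rw [hf k.1 k.2, show (k.1⁻¹ : G) • x = x from hx k⁻¹] at h2
  exact h2.symm

theorem base_mem_fixedPoints : X.base T ∈ MulAction.fixedPoints K (X.obj T) :=
  fun k => X.smul_base T k.1

theorem map_zero_eq_base {S : GammaObj G} (x : X.obj S) :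
    X.map (GammaHom.zero S T) x = X.base T := by
  have : GammaHom.zero S T = (GammaHom.zero (GammaObj.num G 0) T).comp (GammaHom.zero S _) := rfl
  rw [this, X.map_comp]
  exact congrArg _ (X.zero.uniq _)

theorem map_base {S : GammaObj G} (f : GammaHom S T) : X.map f (X.base S) = X.base T := by
  rw [base, ← X.map_comp, GammaHom.comp_zero]
  rfl

/-- The family of values at orbit representatives. -/
def orbitFamily (w : ∀ o : T.Orb K, MulAction.fixedPoints (T.stab K (GammaObj.rep o))
    (X.obj (GammaObj.num G 1))) (s : T.carrier) : X.obj (GammaObj.num G 1) :=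
  Option.elim s (X.base _) fun i =>
    (GammaObj.exists_smul_rep (K := K) i).choose • (w (GammaObj.orb K i)).1

theorem orbitFamily_el (w : ∀ o : T.Orb K, MulAction.fixedPoints (T.stab K (GammaObj.rep o))
    (X.obj (GammaObj.num G 1))) {o : T.Orb K} {k : G} (hk : k ∈ K) :
    X.orbitFamily w (T.el (T.ρ k (GammaObj.rep o))) = k • (w o).1 := by
  have ho : GammaObj.orb K (T.ρ k (GammaObj.rep o)) = o := GammaObj.orb_eq hk rfl
  change (GammaObj.exists_smul_rep (K := K) (T.ρ k (GammaObj.rep o))).choose •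
    (w (GammaObj.orb K (T.ρ k (GammaObj.rep o)))).1 = _
  obtain ⟨h1, h2⟩ := (GammaObj.exists_smul_rep (K := K) (T.ρ k (GammaObj.rep o))).choose_spec
  generalize (GammaObj.exists_smul_rep (K := K) (T.ρ k (GammaObj.rep o))).choose = l at h1 h2 ⊢
  rw [ho] at h2 ⊢
  have hs : k⁻¹ * l ∈ T.stab K (GammaObj.rep o) :=
    ⟨K.mul_mem (K.inv_mem hk) h1, by simp [h2]⟩
  have h3 : (k⁻¹ * l) • (w o).1 = (w o).1 := (w o).2 ⟨_, hs⟩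
  rw [mul_smul, inv_smul_eq_iff] at h3
  exact h3

theorem orbitFamily_rep (w : ∀ o : T.Orb K, MulAction.fixedPoints (T.stab K (GammaObj.rep o))
    (X.obj (GammaObj.num G 1))) (o : T.Orb K) :
    X.orbitFamily w (T.el (GammaObj.rep o)) = (w o).1 := by
  have h := X.orbitFamily_el w (o := o) K.one_mem
  rw [one_smul, map_one] at h
  exact h

theorem orbitFamily_smul (w : ∀ o : T.Orb K, MulAction.fixedPoints (T.stab K (GammaObj.rep o))
    (X.obj (GammaObj.num G 1))) {k : G} (hk : k ∈ K) (s : T.carrier) :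
    X.orbitFamily w (k • s) = k • X.orbitFamily w s := by
  rcases s with _ | i
  · exact (X.smul_base _ k).symm
  · obtain ⟨l, hl, h⟩ := GammaObj.exists_smul_rep (K := K) i
    rw [← h]
    have e : k • T.el (T.ρ l (GammaObj.rep (GammaObj.orb K i))) =
        T.el (T.ρ (k * l) (GammaObj.rep (GammaObj.orb K i))) := by
      rw [GammaObj.smul_el]
      simp
    change X.orbitFamily w (k • T.el (T.ρ l (GammaObj.rep (GammaObj.orb K i)))) =
      k • X.orbitFamily w (T.el (T.ρ l (GammaObj.rep (GammaObj.orb K i))))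
    rw [e, X.orbitFamily_el w (K.mul_mem hk hl), X.orbitFamily_el w hl, mul_smul]

variable (T K) in
/-- A `K`-fixed based map `T → X(1)` is a family of fixed points of the stabilizers of
representatives of the `K`-orbits. -/
def evalReps : MulAction.fixedPoints K (X.Maps T) ≃ₜ
    ∀ o : T.Orb K, MulAction.fixedPoints (T.stab K (GammaObj.rep o))
      (X.obj (GammaObj.num G 1)) where
  toFun φ o := ⟨φ.1.1 (T.el (GammaObj.rep o)), X.maps_fixed φ.2 _⟩
  invFun w := ⟨⟨X.orbitFamily w, rfl⟩, fun k => Subtype.ext (funext fun s => by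
    change k.1 • X.orbitFamily w (k.1⁻¹ • s) = _
    rw [X.orbitFamily_smul w (K.inv_mem k.2), smul_inv_smul])⟩
  left_inv φ := by
    refine Subtype.ext (Subtype.ext (funext fun s => ?_))
    rcases s with _ | i
    · exact φ.1.2.symm
    · obtain ⟨k, hk, h⟩ := GammaObj.exists_smul_rep (K := K) i
      have key : X.orbitFamily (K := K) (fun o => ⟨φ.1.1 (T.el (GammaObj.rep o)),
          X.maps_fixed φ.2 _⟩) (T.el i) = φ.1.1 (T.el i) := by
        rw [← h, X.orbitFamily_el _ hk, ← GammaObj.smul_el, X.maps_smul φ.2 hk]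
      exact key
  right_inv w := funext fun o => Subtype.ext (X.orbitFamily_rep w o)
  continuous_toFun := by
    refine continuous_pi fun o => Continuous.subtype_mk ?_ _
    exact (continuous_apply (T.el (GammaObj.rep o))).comp
      ((continuous_subtype_val (p := fun φ : T.carrier → X.obj (GammaObj.num G 1) =>
        φ T.pt = X.base _)).comp continuous_subtype_val)
  continuous_invFun := by
    refine Continuous.subtype_mk (Continuous.subtype_mk (continuous_pi fun s => ?_) _) _
    rcases s with _ | i
    · exact continuous_const
    · exact (X.continuous_act _ _).comp (continuous_subtype_val.comp (continuous_apply _))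

variable (T K) in
/-- The Segal map on fixed points, in terms of orbit representatives. -/
def segalReps : C(MulAction.fixedPoints K (X.obj T),
    ∀ o : T.Orb K, MulAction.fixedPoints (T.stab K (GammaObj.rep o)) (X.obj (GammaObj.num G 1))) :=
  (X.evalReps T K : C(_, _)).comp (fixedMap (X.segal T) (X.segal_equivariant T) K)

variable {X}

theorem IsSpecial.segalReps (hX : X.IsSpecial) (T : GammaObj G) (K : Subgroup G) :
    IsWeakEquiv (X.segalReps T K) :=
  (IsFiberRetraction.of_homeomorph (X.evalReps T K)).isWeakEquiv.comp (hX T K)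

/-- Points of `X(T)^K` whose projections to `X(1)` lie in the same components lie in the same
component. -/
theorem IsSpecial.joinedIn (hX : X.IsSpecial) {x y : X.obj T}
    (hx : x ∈ MulAction.fixedPoints K (X.obj T)) (hy : y ∈ MulAction.fixedPoints K (X.obj T))
    (h : ∀ o : T.Orb K, JoinedIn (MulAction.fixedPoints (T.stab K (GammaObj.rep o))
      (X.obj (GammaObj.num G 1))) (X.map (GammaHom.proj T (GammaObj.rep o)) x)
      (X.map (GammaHom.proj T (GammaObj.rep o)) y)) :
    JoinedIn (MulAction.fixedPoints K (X.obj T)) x y := by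
  rw [joinedIn_iff_joined hx hy, ← (hX.segalReps T K).joined_iff]
  exact joined_pi fun o => (joinedIn_iff_joined _ _).1 (h o)

/-- Every `K`-fixed map `T → X(1)` is realized, up to paths, by a point of `X(T)^K`. -/
theorem IsSpecial.exists_joined (hX : X.IsSpecial) {φ : X.Maps T}
    (hφ : φ ∈ MulAction.fixedPoints K (X.Maps T)) :
    ∃ x ∈ MulAction.fixedPoints K (X.obj T), ∀ i, JoinedIn (MulAction.fixedPoints (T.stab K i)
      (X.obj (GammaObj.num G 1))) (X.map (GammaHom.proj T i) x) (φ.1 (T.el i)) := by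
  obtain ⟨x, hx⟩ := (hX T K).exists_joined ⟨φ, hφ⟩
  refine ⟨x.1, x.2, fun i => ?_⟩
  let ev : C(MulAction.fixedPoints K (X.Maps T),
      MulAction.fixedPoints (T.stab K i) (X.obj (GammaObj.num G 1))) :=
    ⟨fun φ => ⟨φ.1.1 (T.el i), X.maps_fixed φ.2 i⟩, Continuous.subtype_mk
      ((continuous_apply (T.el i)).comp ((continuous_subtype_val (p := fun φ : T.carrier →
        X.obj (GammaObj.num G 1) => φ T.pt = X.base _)).comp continuous_subtype_val)) _⟩
  exact (joinedIn_iff_joined (X.map_proj_fixed x.2 i) (X.maps_fixed hφ i)).2 (joined_map ev hx)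

end GammaGSpace

/-! ### Relations between morphisms of `Γ_G` -/

namespace GammaHom

variable {S T : GammaObj G}

theorem proj_el (i j : Fin S.n) : (proj S i).toFun (S.el j) =
    if j = i then (GammaObj.num G 1).el (0 : Fin 1) else (GammaObj.num G 1).pt := by
  have : S.el j = S.el i ↔ j = i := Option.some_inj
  simp only [proj, this]

theorem proj_pair (i : Fin S.n) (j : Fin 2) (s : S.carrier) (k : Fin 2) :
    (proj (S.smash 2) (finProdFinEquiv (i, j))).toFun (pair s k) =
      if k = j then (proj S i).toFun s else (GammaObj.num G 1).pt := by
  rcases s with _ | l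
  · change (proj (S.smash 2) _).toFun (S.smash 2).pt = if k = j then (proj S i).toFun S.pt else _
    rw [map_pt, map_pt, ite_self]
  · change (proj (S.smash 2) _).toFun ((S.smash 2).el (finProdFinEquiv (l, k))) =
      if k = j then (proj S i).toFun (S.el l) else _
    rw [proj_el]
    refine (proj_el (S := S.smash 2) (finProdFinEquiv (i, j)) (finProdFinEquiv (l, k))).trans ?_
    have : (finProdFinEquiv (l, k) : Fin (S.n * 2)) = finProdFinEquiv (i, j) ↔ l = i ∧ k = j := by
      rw [EmbeddingLike.apply_eq_iff_eq, Prod.mk.injEq]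
    refine (if_congr this rfl rfl).trans ?_
    split_ifs <;> simp_all

theorem proj_comp_smashFst (i : Fin S.n) :
    (proj S i).comp (smashFst S) = proj (S.smash 2) (finProdFinEquiv (i, 0)) := by
  ext t
  induction t using pair_cases with
  | h s j =>
    rw [proj_pair]
    change (proj S i).toFun ((smashFst S).toFun (pair s j)) = _
    rw [smashFst_pair]
    split_ifs
    · rfl
    · exact map_pt _

theorem proj_comp_smashMap (f : GammaHom S T) (i : Fin T.n) (j : Fin 2) (l : Fin S.n)
    (h : (proj T i).comp f = proj S l) :
    (proj (T.smash 2) (finProdFinEquiv (i, j))).comp (smashMap f) =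
      proj (S.smash 2) (finProdFinEquiv (l, j)) := by
  ext t
  induction t using pair_cases with
  | h s k =>
    rw [proj_pair, ← h]
    change (proj (T.smash 2) _).toFun ((smashMap f).toFun (pair s k)) = _
    rw [smashMap_pair, proj_pair]
    rfl

theorem proj_num_one : proj (GammaObj.num G 1) (0 : Fin 1) = GammaHom.id _ := by
  ext t
  rcases t with _ | i
  · exact map_pt _
  · have : i = (0 : Fin 1) := Subsingleton.elim (α := Fin 1) _ _
    subst this
    exact (proj_el (S := GammaObj.num G 1) (0 : Fin 1) (0 : Fin 1)).trans (if_pos rfl)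

end GammaHom

/-! ### Unit components of a special `Γ_G`-space -/

namespace GammaGSpace

variable (X : GammaGSpace G) {T : GammaObj G} {K : Subgroup G}

/-- The point `y` of `X(T)^K` lies in a unit component. -/
def IsUnitPt (T : GammaObj G) (K : Subgroup G) (y : X.obj T) : Prop :=
  ∃ d ∈ MulAction.fixedPoints K (X.obj (T.smash 2)),
    JoinedIn (MulAction.fixedPoints K (X.obj T)) (X.map (GammaHom.smashMu T) d) (X.base T) ∧
      JoinedIn (MulAction.fixedPoints K (X.obj T)) (X.map (GammaHom.smashFst T) d) y

variable {X}

/-- Being a unit can be tested on the projections to `X(1)`: inverses of the projections assemble,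
as `X` is special. -/
theorem IsSpecial.isUnitPt (hX : X.IsSpecial) {y : X.obj T}
    (hy : y ∈ MulAction.fixedPoints K (X.obj T))
    (h : ∀ o : T.Orb K, X.IsUnitPt (GammaObj.num G 1) (T.stab K (GammaObj.rep o))
      (X.map (GammaHom.proj T (GammaObj.rep o)) y)) : X.IsUnitPt T K y := by
  choose d hd hmu hfst using h
  let P : GammaObj G := (GammaObj.num G 1).smash 2
  let q (j : Fin 2) : Fin P.n := finProdFinEquiv ((0 : Fin 1), j)
  have hq : ∀ i : Fin P.n, ∃ j, i = q j := fun i => by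
    refine ⟨(finProdFinEquiv.symm i).2, ?_⟩
    have : (finProdFinEquiv.symm i).1 = (0 : Fin 1) := Subsingleton.elim (α := Fin 1) _ _
    change i = finProdFinEquiv ((0 : Fin 1), _)
    rw [← this]
    exact (finProdFinEquiv.apply_symm_apply i).symm
  have smul_q : ∀ (g : G) j, P.ρ g (q j) = q j := fun g j => by
    have e : g • P.el (q j) = P.el (q j) :=
      GammaHom.smul_pair g ((GammaObj.num G 1).el (0 : Fin 1)) j
    exact Option.some_inj.1 e
  have hdq : ∀ o j, X.map (GammaHom.proj P (q j)) (d o) ∈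
      MulAction.fixedPoints (T.stab K (GammaObj.rep o)) (X.obj (GammaObj.num G 1)) := fun o j =>
    X.map_mem_fixedPoints (fun k _ => by rw [GammaHom.smul_proj, smul_q]) (hd o)
  let φ (j : Fin 2) : MulAction.fixedPoints K (X.Maps T) :=
    (X.evalReps T K).symm fun o => ⟨_, hdq o j⟩
  have hφ : ∀ j o, (φ j).1.1 (T.el (GammaObj.rep o)) = X.map (GammaHom.proj P (q j)) (d o) :=
    fun j o => X.orbitFamily_rep (fun o => ⟨_, hdq o j⟩) o
  -- The map `T ∧ 2 → X(1)` given by `φ 0` and `φ 1`.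
  let Φ : X.Maps (T.smash 2) := ⟨fun t => Option.elim t (X.base _) fun k =>
    (φ (finProdFinEquiv.symm k).2).1.1 (T.el (finProdFinEquiv.symm k).1), rfl⟩
  have hΦ : ∀ s j, Φ.1 (GammaHom.pair s j) = (φ j).1.1 s := fun s j => by
    rcases s with _ | i
    · exact (φ j).1.2.symm
    · change (φ (finProdFinEquiv.symm (finProdFinEquiv (i, j))).2).1.1
        (T.el (finProdFinEquiv.symm (finProdFinEquiv (i, j))).1) = _
      rw [Equiv.symm_apply_apply]
      rfl
  have hΦK : Φ ∈ MulAction.fixedPoints K (X.Maps (T.smash 2)) := fun k => by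
    refine Subtype.ext (funext fun t => ?_)
    induction t using GammaHom.pair_cases with
    | h s j =>
      change k.1 • Φ.1 (k.1⁻¹ • GammaHom.pair s j) = Φ.1 (GammaHom.pair s j)
      rw [GammaHom.smul_pair, hΦ, hΦ, X.maps_smul (φ j).2 (K.inv_mem k.2), smul_inv_smul]
  obtain ⟨x, hx, hxΦ⟩ := hX.exists_joined hΦK
  have key : ∀ o j, JoinedIn (MulAction.fixedPoints (T.stab K (GammaObj.rep o))
      (X.obj (GammaObj.num G 1)))
      (X.map (GammaHom.proj (T.smash 2) (finProdFinEquiv (GammaObj.rep o, j))) x)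
      (X.map (GammaHom.proj P (q j)) (d o)) := fun o j => by
    have h1 := hxΦ (finProdFinEquiv (GammaObj.rep o, j))
    rw [GammaHom.pair_el, hΦ, hφ] at h1
    refine h1.mono (fixedPoints_anti fun k hk => ⟨hk.1, ?_⟩)
    have e : k • (T.smash 2).el (finProdFinEquiv (GammaObj.rep o, j)) =
        (T.smash 2).el (finProdFinEquiv (GammaObj.rep o, j)) := by
      rw [GammaHom.pair_el, GammaHom.smul_pair, GammaObj.smul_el, hk.2]
    exact Option.some_inj.1 e
  have hmuK := X.map_mem_fixedPoints (K := K) (fun k _ => GammaHom.smul_smashMu (S := T) k) hx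
  have hfstK := X.map_mem_fixedPoints (K := K) (fun k _ => GammaHom.smul_smashFst (S := T) k) hx
  refine ⟨x, hx, hX.joinedIn hmuK X.base_mem_fixedPoints fun o => ?_,
    hX.joinedIn hfstK hy fun o => ?_⟩
  · rw [X.map_base, ← X.map_comp, ← GammaHom.smashMu_smashMap, X.map_comp]
    have hp : ∀ k ∈ T.stab K (GammaObj.rep o), k • GammaHom.smashMap
        (GammaHom.proj T (GammaObj.rep o)) = GammaHom.smashMap (GammaHom.proj T (GammaObj.rep o)) :=
      fun k hk => by rw [GammaHom.smul_smashMap, GammaHom.smul_proj, hk.2]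
    have hx' := X.map_mem_fixedPoints hp (fixedPoints_anti (GammaObj.stab_le _) hx)
    have hj : JoinedIn (MulAction.fixedPoints (T.stab K (GammaObj.rep o)) (X.obj P))
        (X.map (GammaHom.smashMap (GammaHom.proj T (GammaObj.rep o))) x) (d o) := by
      refine hX.joinedIn hx' (hd o) fun o' => ?_
      obtain ⟨j, hj⟩ := hq (GammaObj.rep o')
      rw [← X.map_comp]
      refine JoinedIn.mono ?_ (fixedPoints_anti (GammaObj.stab_le _))
      have e : (GammaHom.proj P (q j)).comp (GammaHom.smashMap (GammaHom.proj T (GammaObj.rep o))) =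
          GammaHom.proj (T.smash 2) (finProdFinEquiv (GammaObj.rep o, j)) :=
        GammaHom.proj_comp_smashMap (T := GammaObj.num G 1) _ (0 : Fin 1) j (GammaObj.rep o) (by
          rw [GammaHom.proj_num_one]
          rfl)
      rw [hj, e]
      exact key o j
    exact (joinedIn_map (X.map _).continuous (fun z hz => X.map_mem_fixedPoints
      (fun k _ => GammaHom.smul_smashMu k) hz) hj).trans (hmu o)
  · rw [← X.map_comp, GammaHom.proj_comp_smashFst]
    refine (key o 0).trans ?_
    have e : GammaHom.proj P (q 0) = GammaHom.smashFst (GammaObj.num G 1) := by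
      refine (GammaHom.proj_comp_smashFst (S := GammaObj.num G 1) (0 : Fin 1)).symm.trans ?_
      rw [GammaHom.proj_num_one]
      rfl
    rw [e]
    exact hfst o

end GammaGSpace

/-! ### Fixed points and the fixed point systems `Φ W` -/

theorem continuous_of_kification {X Y : Type u} (t : TopologicalSpace X) [TopologicalSpace Y]
    {f : X → Y} (hf : Continuous f) :
    @Continuous X Y (@TopologicalSpace.compactlyGenerated.{u} X t) _ f :=
  @continuous_from_compactlyGenerated.{u} X Y t _ f fun _ g => hf.comp g.continuous

/-- Compact Hausdorff test spaces in the lowest universe do not see k-ification either. -/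
theorem continuous_to_kification_of_compact {X : Type u} (t : TopologicalSpace X) {K : Type}
    [TopologicalSpace K] [CompactSpace K] [T2Space K] {g : K → X} (hg : Continuous g) :
    @Continuous K X _ (@TopologicalSpace.compactlyGenerated.{u} X t) g := by
  have h := continuous_to_kification t (CompHaus.of (ULift.{u} K)) (fun k => g k.down)
    (hg.comp continuous_uliftDown)
  exact @Continuous.comp K (ULift.{u} K) X _ _ (@TopologicalSpace.compactlyGenerated.{u} X t)
    ULift.up (fun k => g k.down) h continuous_uliftUp

namespace Phi

variable {W : Type u} [MulAction G W] {K : Subgroup G}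

theorem val_smul (x : Phi G W K) (g : G) (c : G ⧸ K) : x.val (g • c) = g • x.val c :=
  x.map_smul' g c

theorem val_one_mem (x : Phi G W K) : x.val ((1 : G) : G ⧸ K) ∈ MulAction.fixedPoints K W :=
  fun k => by
    refine (x.val_smul k.1 _).symm.trans (congrArg x.val ?_)
    exact QuotientGroup.eq.2 (by simp)

variable [TopologicalSpace W]

variable (W K) in
/-- The evaluation `Φ W(G/K) → W^K` at the unit coset. -/
def evOne : C(Phi G W K, MulAction.fixedPoints K W) where
  toFun x := ⟨x.val ((1 : G) : G ⧸ K), x.val_one_mem⟩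
  continuous_toFun := by
    refine continuous_of_kification (preTop G W K) ?_
    let _ := preTop G W K
    exact Continuous.subtype_mk ((continuous_apply (A := fun _ : G ⧸ K => W)
      ((1 : G) : G ⧸ K)).comp continuous_induced_dom) _

theorem evOne_surjective : Function.Surjective (evOne W K) := fun w =>
  ⟨orbMap K w.1 fun k hk => w.2 ⟨k, hk⟩, Subtype.ext (one_smul G w.1)⟩

theorem isPathInclusion_evOne (hW : ∀ g : G, Continuous fun w : W => g • w) :
    IsPathInclusion (evOne W K) where
  injective x y h := orbMap_ext (f := x) (g := y) (congrArg Subtype.val h)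
  lift {L} _ _ _ g hg := by
    refine continuous_to_kification_of_compact (preTop G W K) ?_
    let _ := preTop G W K
    refine continuous_induced_rng.2 (continuous_pi fun c => Quotient.inductionOn' c fun a => ?_)
    have h1 : Continuous fun k : L => a • (evOne W K (g k)).1 :=
      (hW a).comp (continuous_subtype_val.comp hg)
    refine h1.congr fun k => ((g k).val_smul a _).symm.trans (congrArg (g k).val ?_)
    exact congrArg (fun b : G => (b : G ⧸ K)) (mul_one a)
  mem_range _ y _ := evOne_surjective y

end Phi

namespace GammaOSpace

variable (F : GammaOSpace G) (T : GammaObj G) (K : Subgroup G)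

/-- The inclusion of the units. -/
def unitsIncl : C(F.units.obj T K, F.obj T K) where
  toFun x := x.1
  continuous_toFun := by
    refine continuous_of_kification (F.unitsPreTop T K) ?_
    let _ := F.unitsPreTop T K
    exact continuous_induced_dom

theorem isPathInclusion_unitsIncl : IsPathInclusion (F.unitsIncl T K) where
  injective _ _ h := Subtype.ext h
  lift g hg := by
    refine continuous_to_kification_of_compact (F.unitsPreTop T K) ?_
    let _ := F.unitsPreTop T K
    exact continuous_induced_rng.2 hg
  mem_range x y h := by
    have e : ZerothHomotopy.mk y ∈ F.unitComponents T K := by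
      rw [← mk_eq_mk_iff_joined.2 h]
      exact x.2
    exact ⟨⟨y, e⟩, rfl⟩

end GammaOSpace

/-! ### Restriction to stabilizers -/

namespace GammaOSpace

variable (F : GammaOSpace G) (T : GammaObj G) (K : Subgroup G)

variable {T K} in
theorem isFixed_restrCorep {T' : GammaObj G} {K' : Subgroup G} {f : GammaHom T T'} (hK : K' ≤ K)
    (hf : ∀ k ∈ K', k • f = f) :
    Corep.IsFixed (A := (⟨T, K⟩ : OrbObj G)) K' (((1 : G) : G ⧸ K), f) := fun k hk =>
  Prod.ext (QuotientGroup.eq.2 (by simpa using hK hk)) (hf k hk)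

variable {T K} in
/-- The morphism `(T, G/K) → (T', G/K')` of `𝒟` given by the projection `G/K' → G/K` and a
`K'`-equivariant map `f : T → T'`. -/
def restrHom {T' : GammaObj G} {K' : Subgroup G} (f : GammaHom T T') (hK : K' ≤ K)
    (hf : ∀ k ∈ K', k • f = f) : (⟨T, K⟩ : OrbObj G) ⟶ (⟨T', K'⟩ : OrbObj G) :=
  Corep.toHom (A := (⟨T, K⟩ : OrbObj G)) (((1 : G) : G ⧸ K), f) (isFixed_restrCorep hK hf)

variable {T} in
theorem smul_proj_of_stab {i : Fin T.n} : ∀ k ∈ T.stab K i, k • GammaHom.proj T i =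
    GammaHom.proj T i := fun k hk =>
  (GammaHom.smul_proj T k i).trans (congrArg _ hk.2)

/-- The family of maps `F(T)(G/K) → F(1)(G/K_i)` given by the projections, where `i` runs through
representatives of the `K`-orbits. -/
def segalReps : C(F.obj T K, ∀ o : T.Orb K,
    F.obj (GammaObj.num G 1) (T.stab K (GammaObj.rep o))) where
  toFun y o := F.actOn (restrHom (GammaHom.proj T (GammaObj.rep o)) (GammaObj.stab_le _)
    (smul_proj_of_stab K)) y
  continuous_toFun := continuous_pi fun o => (F.actOn (restrHom (GammaHom.proj T
    (GammaObj.rep o)) (GammaObj.stab_le _) (smul_proj_of_stab K))).continuous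

variable {T K}

/-- Naturality of the augmentation for restrictions to smaller subgroups followed by maps of
finite pointed sets. -/
theorem aug_restrHom {T' : GammaObj G} {K' : Subgroup G} {f : GammaHom T T'} (hK : K' ≤ K)
    (hf : ∀ k ∈ K', k • f = f) (z : MulAction.fixedPoints K (F.Bar T))
    (hz : F.barPush f z.1 ∈ MulAction.fixedPoints K' (F.Bar T')) :
    aug F T' K' ⟨_, hz⟩ = F.actOn (restrHom f hK hf) (aug F T K z) := by
  have h1 := Corep.toHom_orb_one (A := (⟨T, K⟩ : OrbObj G)) _ (isFixed_restrCorep hK hf)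
  have h2 := Corep.toHom_hom_one (A := (⟨T, K⟩ : OrbObj G)) _ (isFixed_restrCorep hK hf)
  have h3 : F.barPush (OrbHom.hom (restrHom f hK hf) ((1 : G) : G ⧸ K')) z.1 =
      F.barPush f z.1 := congrArg (fun f => F.barPush f z.1) h2
  refine Eq.trans ?_ (aug_barPush (restrHom f hK hf) h1 z (h3 ▸ hz))
  exact congrArg _ (Subtype.ext h3.symm)

end GammaOSpace

/-! ### The units of a special `Γ_G`-space -/

namespace GammaGSpace

variable (X : GammaGSpace G) (T : GammaObj G) (K : Subgroup G)

/-- The inclusion `U X(T)(G/K) → X(T)^K`. -/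
def unitsEv : C((phi X).units.obj T K, MulAction.fixedPoints K (X.obj T)) :=
  (Phi.evOne (X.obj T) K).comp ((phi X).unitsIncl T K)

theorem isPathInclusion_unitsEv : IsPathInclusion (X.unitsEv T K) :=
  (Phi.isPathInclusion_evOne (X.continuous_act T)).comp ((phi X).isPathInclusion_unitsIncl T K)

variable {T K}

/-- Evaluation at the unit coset is a homeomorphism up to k-ification, which path components do not
see. Hence the components of `Φ X(T)(G/K)` and of `X(T)^K` agree, and so do their units. -/
theorem mem_range_unitsEv {y : X.obj T} (hy : y ∈ MulAction.fixedPoints K (X.obj T)) :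
    ⟨y, hy⟩ ∈ Set.range (X.unitsEv T K) ↔ X.IsUnitPt T K y := by
  have hev (S : GammaObj G) := Phi.isPathInclusion_evOne (K := K) (X.continuous_act S)
  have hmu {d : X.obj (T.smash 2)} (hd : d ∈ MulAction.fixedPoints K _) :=
    X.map_mem_fixedPoints (fun k _ => GammaHom.smul_smashMu (S := T) k) hd
  have hfst {d : X.obj (T.smash 2)} (hd : d ∈ MulAction.fixedPoints K _) :=
    X.map_mem_fixedPoints (fun k _ => GammaHom.smul_smashFst (S := T) k) hd
  constructor
  · rintro ⟨⟨x, ⟨c, h1, h2⟩⟩, hx⟩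
    induction c with
    | mk d =>
    have e : Phi.evOne (X.obj T) K x = ⟨y, hy⟩ := hx
    refine ⟨_, Phi.val_one_mem d, ?_, ?_⟩
    · exact (joinedIn_iff_joined (hmu (Phi.val_one_mem d)) X.base_mem_fixedPoints).2
        (joined_map (Phi.evOne (X.obj T) K) (mk_eq_mk_iff_joined.1 h1))
    · refine (joinedIn_iff_joined (hfst (Phi.val_one_mem d)) hy).2 ?_
      rw [← e]
      exact joined_map (Phi.evOne (X.obj T) K) (mk_eq_mk_iff_joined.1 h2)
  · rintro ⟨d, hd, h1, h2⟩
    obtain ⟨d', hd'⟩ := Phi.evOne_surjective ⟨d, hd⟩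
    obtain ⟨x, hx⟩ := Phi.evOne_surjective ⟨y, hy⟩
    obtain rfl : d'.val _ = d := congrArg Subtype.val hd'
    obtain rfl : x.val _ = y := congrArg Subtype.val hx
    refine ⟨⟨x, ZerothHomotopy.mk d', ?_, ?_⟩, hx⟩
    · refine mk_eq_mk_iff_joined.2 ((hev T).joined ?_)
      exact (joinedIn_iff_joined (hmu hd) X.base_mem_fixedPoints).1 h1
    · refine mk_eq_mk_iff_joined.2 ((hev T).joined ?_)
      exact (joinedIn_iff_joined (hfst hd) hy).1 h2

theorem unitsEv_actOn {T' : GammaObj G} {K' : Subgroup G} {f : GammaHom T T'} (hK : K' ≤ K)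
    (hf : ∀ k ∈ K', k • f = f) (y : (phi X).units.obj T K) :
    (X.unitsEv T' K' ((phi X).units.actOn (GammaOSpace.restrHom f hK hf) y)).1 =
      X.map f (X.unitsEv T K y).1 := by
  have h1 := Corep.toHom_orb_one (A := (⟨T, K⟩ : OrbObj G)) _
    (GammaOSpace.isFixed_restrCorep hK hf)
  have h2 := Corep.toHom_hom_one (A := (⟨T, K⟩ : OrbObj G)) _
    (GammaOSpace.isFixed_restrCorep hK hf)
  change X.map (OrbHom.hom (GammaOSpace.restrHom f hK hf) _)
    (y.1.val (OrbHom.orb (GammaOSpace.restrHom f hK hf) _)) = _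
  exact congrArg₂ (fun f c => X.map f (y.1.val c)) h2 h1

variable {X}

/-- The map for the units is the restriction of `segalReps X` to unions of path components, and
these correspond to each other as units are detected on the projections. -/
theorem IsSpecial.unitsSegal (hX : X.IsSpecial) (T : GammaObj G) (K : Subgroup G) :
    IsWeakEquiv ((phi X).units.segalReps T K) := by
  have hj (o : T.Orb K) := X.isPathInclusion_unitsEv (GammaObj.num G 1) (T.stab K (GammaObj.rep o))
  refine (X.isPathInclusion_unitsEv T K).isWeakEquiv_of_square (IsPathInclusion.pi hj)
    (hX.segalReps T K) ?_ fun y z h => ?_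
  · exact ContinuousMap.ext fun y => funext fun o => Subtype.ext (X.unitsEv_actOn _ _ y)
  · refine (X.mem_range_unitsEv y.2).2 (hX.isUnitPt y.2 fun o => ?_)
    have h1 : Joined _ _ := h.elim fun p => ⟨p.map (continuous_apply o)⟩
    have h2 := (hj o).mem_range _ _ h1.symm
    exact (X.mem_range_unitsEv _).1 h2

/-- The augmentations identify the Segal map of `C U X` on fixed points with the map `segalReps` of
`U X`. -/
theorem IsSpecial.coalescence_units (hX : X.IsSpecial) :
    (phi X).units.coalescence.IsSpecial := fun T K => by
  let U := (phi X).units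
  let Y := U.coalescence
  let augs : C(∀ o : T.Orb K, MulAction.fixedPoints (T.stab K (GammaObj.rep o))
      (Y.obj (GammaObj.num G 1)), ∀ o : T.Orb K, U.obj (GammaObj.num G 1)
        (T.stab K (GammaObj.rep o))) :=
    ⟨fun z o => GammaOSpace.aug U (GammaObj.num G 1) (T.stab K (GammaObj.rep o)) (z o),
      continuous_pi fun o => (GammaOSpace.aug U _ _).continuous.comp (continuous_apply o)⟩
  have h1 : IsWeakEquiv augs := (IsFiberRetraction.pi fun o : T.Orb K =>
    GammaOSpace.isFiberRetraction_aug U (GammaObj.num G 1)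
      (T.stab K (GammaObj.rep o))).isWeakEquiv
  have h2 := (IsFiberRetraction.of_homeomorph (Y.evalReps T K)).isWeakEquiv
  have h3 : IsWeakEquiv (GammaOSpace.aug U T K) :=
    (GammaOSpace.isFiberRetraction_aug U T K).isWeakEquiv
  have h4 := IsWeakEquiv.comp (hX.unitsSegal T K) h3
  refine IsWeakEquiv.of_comp (IsWeakEquiv.comp h1 h2) ?_
  refine (congrArg IsWeakEquiv ?_).mp h4
  refine ContinuousMap.ext fun z => funext fun o => ?_
  exact (U.aug_restrHom _ _ z _).symm

end GammaGSpace

/-! ### The multiplication on path components -/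

namespace GammaHom

/-- The map `{*, 0, …, m-1} → {*, 0, …, n-1}` given by a partially defined map. -/
def ofFin {m n : ℕ} (f : Fin m → Option (Fin n)) : GammaHom (GammaObj.num G m) (GammaObj.num G n) :=
  ⟨fun t => Option.bind t f, rfl⟩

theorem smul_num {m : ℕ} (g : G) (t : (GammaObj.num G m).carrier) : g • t = t := by
  rcases t with _ | t <;> rfl

theorem smul_of_num {m n : ℕ} (g : G) (f : GammaHom (GammaObj.num G m) (GammaObj.num G n)) :
    g • f = f := by
  ext t
  rw [smul_toFun, smul_num, smul_num]

theorem ext_num {m : ℕ} {T : GammaObj G} {f f' : GammaHom (GammaObj.num G m) T}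
    (h : ∀ i : Fin m, f.toFun ((GammaObj.num G m).el i) = f'.toFun ((GammaObj.num G m).el i)) :
    f = f' := by
  ext t
  rcases t with _ | i
  · exact f.map_pt.trans f'.map_pt.symm
  · exact h i

end GammaHom

namespace GammaGSpace

variable {X : GammaGSpace G} (H : Subgroup G)

theorem pi0Fixed_comp {S T U : GammaObj G} {f : GammaHom T U} {f' : GammaHom S T}
    {k : GammaHom S U} (h : f.comp f' = k) (hf : ∀ g : G, g • f = f) (hf' : ∀ g : G, g • f' = f')
    (hk : ∀ g : G, g • k = k) (d : ZerothHomotopy (MulAction.fixedPoints H (X.obj S))) :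
    X.pi0Fixed f hf H (X.pi0Fixed f' hf' H d) = X.pi0Fixed k hk H d := by
  subst h
  induction d with
  | mk x => exact congrArg ZerothHomotopy.mk (Subtype.ext (X.map_comp f f' x.1).symm)

theorem pi0Fixed_id {S : GammaObj G} {f : GammaHom S S} (h : f = GammaHom.id S)
    (hf : ∀ g : G, g • f = f) (d : ZerothHomotopy (MulAction.fixedPoints H (X.obj S))) :
    X.pi0Fixed f hf H d = d := by
  subst h
  induction d with
  | mk x => exact congrArg ZerothHomotopy.mk (Subtype.ext (X.map_id S x.1))

theorem pi0Fixed_zero {S T : GammaObj G} {f : GammaHom S T} (h : f = GammaHom.zero S T)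
    (hf : ∀ g : G, g • f = f) (d : ZerothHomotopy (MulAction.fixedPoints H (X.obj S))) :
    X.pi0Fixed f hf H d = ZerothHomotopy.mk ⟨X.base T, X.base_mem_fixedPoints⟩ := by
  subst h
  induction d with
  | mk x => exact congrArg ZerothHomotopy.mk (Subtype.ext (X.map_zero_eq_base x.1))

variable {H}

theorem IsSpecial.pi0_injective (hX : X.IsSpecial) {m : ℕ}
    {d d' : ZerothHomotopy (MulAction.fixedPoints H (X.obj (GammaObj.num G m)))}
    (h : ∀ i : Fin m, X.pi0Fixed (GammaHom.proj (GammaObj.num G m) i) (smul_proj_num m i) H d =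
      X.pi0Fixed (GammaHom.proj (GammaObj.num G m) i) (smul_proj_num m i) H d') : d = d' := by
  induction d with
  | mk x =>
  induction d' with
  | mk x' =>
  refine mk_eq_mk_iff_joined.2 ((joinedIn_iff_joined x.2 x'.2).1
    (hX.joinedIn x.2 x'.2 fun o => ?_))
  exact ((joinedIn_iff_joined _ _).2 (mk_eq_mk_iff_joined.1 (h (GammaObj.rep o)))).mono
    (fixedPoints_anti (GammaObj.stab_le _))

theorem IsSpecial.pi0_surjective (hX : X.IsSpecial) {m : ℕ}
    (a : Fin m → ZerothHomotopy (MulAction.fixedPoints H (X.obj (GammaObj.num G 1)))) :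
    ∃ d : ZerothHomotopy (MulAction.fixedPoints H (X.obj (GammaObj.num G m))), ∀ i : Fin m,
      X.pi0Fixed (GammaHom.proj (GammaObj.num G m) i) (smul_proj_num m i) H d = a i := by
  have ha : ∀ i, ∃ x, ZerothHomotopy.mk x = a i := fun i => by
    induction a i with
    | mk x => exact ⟨x, rfl⟩
  choose x hx using ha
  let φ : X.Maps (GammaObj.num G m) :=
    ⟨fun s => Option.elim s (X.base _) fun i => (x i).1, rfl⟩
  have hφ : φ ∈ MulAction.fixedPoints H (X.Maps (GammaObj.num G m)) := fun k => by
    refine Subtype.ext (funext fun s => ?_)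
    change k.1 • φ.1 (k.1⁻¹ • s) = φ.1 s
    rw [GammaHom.smul_num]
    rcases s with _ | i
    · exact X.smul_base _ k.1
    · exact (x i).2 k
  obtain ⟨y, hy, h⟩ := hX.exists_joined hφ
  refine ⟨ZerothHomotopy.mk ⟨y, hy⟩, fun i => ?_⟩
  rw [← hx]
  refine mk_eq_mk_iff_joined.2 ((joinedIn_iff_joined _ _).1 ((h i).mono (fixedPoints_anti ?_)))
  exact fun k hk => ⟨hk, rfl⟩

/-- For a special `Γ_G`-space the multiplication on `π₀(X(1)^H)` is associative and unital, so that
right inverses suffice for a group structure. -/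
theorem IsSpecial.exists_group (hX : X.IsSpecial)
    (hinv : ∀ a : ZerothHomotopy (MulAction.fixedPoints H (X.obj (GammaObj.num G 1))),
      ∃ d, X.pi0Fixed (GammaHom.proj _ (0 : Fin 2)) (smul_proj_num 2 0) H d = a ∧
        X.pi0Fixed (GammaHom.mu G) GammaHom.smul_mu H d =
          ZerothHomotopy.mk ⟨X.base _, X.base_mem_fixedPoints⟩) :
    ∃ _ : Group (ZerothHomotopy (MulAction.fixedPoints H (X.obj (GammaObj.num G 1)))),
      ∀ d : ZerothHomotopy (MulAction.fixedPoints H (X.obj (GammaObj.num G 2))),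
        X.pi0Fixed (GammaHom.proj _ (0 : Fin 2)) (smul_proj_num 2 0) H d *
            X.pi0Fixed (GammaHom.proj _ (1 : Fin 2)) (smul_proj_num 2 1) H d =
          X.pi0Fixed (GammaHom.mu G) GammaHom.smul_mu H d := by
  let A := ZerothHomotopy (MulAction.fixedPoints H (X.obj (GammaObj.num G 1)))
  let p {m : ℕ} (i : Fin m) := X.pi0Fixed (GammaHom.proj (GammaObj.num G m) i) (smul_proj_num m i) H
  let μ := X.pi0Fixed (GammaHom.mu G) GammaHom.smul_mu H
  let r {m n : ℕ} (f : Fin m → Option (Fin n)) :=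
    X.pi0Fixed (GammaHom.ofFin (G := G) f) (fun g => GammaHom.smul_of_num g _) H
  choose q hq using fun a b : A => hX.pi0_surjective (m := 2) ![a, b]
  choose w hw using hinv
  let _ : Mul A := ⟨fun a b => μ (q a b)⟩
  let _ : One A := ⟨ZerothHomotopy.mk ⟨X.base _, X.base_mem_fixedPoints⟩⟩
  let _ : Inv A := ⟨fun a => p 1 (w a)⟩
  have mul_eq (d) : p 0 d * p 1 d = μ d := by
    refine congrArg μ (hX.pi0_injective fun i => (hq _ _ i).trans ?_)
    revert i
    exact Fin.forall_fin_two.2 ⟨rfl, rfl⟩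
  have mul_eq' {d} {a b : A} (ha : p 0 d = a) (hb : p 1 d = b) : a * b = μ d := by
    rw [← ha, ← hb, mul_eq]
  refine ⟨Group.ofRightAxioms (fun a b c => ?_) (fun a => ?_) fun a => ?_, mul_eq⟩
  · obtain ⟨e, he⟩ := hX.pi0_surjective ![a, b, c]
    have ha : p 0 e = a := he 0
    have hb : p 1 e = b := he 1
    have hc : p 2 e = c := he 2
    have comp_p {n : ℕ} (i : Fin n) (j : Fin 3) (f : Fin 3 → Option (Fin n))
        (h : (GammaHom.proj (GammaObj.num G n) i).comp (GammaHom.ofFin f) =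
          GammaHom.proj (GammaObj.num G 3) j) : p i (r f e) = p j e :=
      pi0Fixed_comp H h _ _ _ e
    -- Both bracketings are the image of `e` under the map `3 → 1` that sends all elements to `1`.
    have hab : a * b = μ (r ![some 0, some 1, none] e) := by
      refine mul_eq' ((comp_p 0 0 _ ?_).trans ha) ((comp_p 1 1 _ ?_).trans hb) <;>
      · refine GammaHom.ext_num fun i => ?_
        fin_cases i <;> rfl
    have hbc : b * c = μ (r ![none, some 0, some 1] e) := by
      refine mul_eq' ((comp_p 0 1 _ ?_).trans hb) ((comp_p 1 2 _ ?_).trans hc) <;>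
      · refine GammaHom.ext_num fun i => ?_
        fin_cases i <;> rfl
    have h1 : a * b * c = μ (r ![some 0, some 0, some 1] e) := by
      refine mul_eq' ?_ ((comp_p 1 2 _ ?_).trans hc)
      · refine Eq.trans ?_ hab.symm
        refine (pi0Fixed_comp H rfl _ _ (fun g => GammaHom.smul_of_num g _) e).trans
          (pi0Fixed_comp H ?_ _ _ _ e).symm
        refine GammaHom.ext_num fun i => ?_
        fin_cases i <;> rfl
      · refine GammaHom.ext_num fun i => ?_
        fin_cases i <;> rfl
    have h2 : a * (b * c) = μ (r ![some 0, some 1, some 1] e) := by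
      refine mul_eq' ((comp_p 0 0 _ ?_).trans ha) ?_
      · refine GammaHom.ext_num fun i => ?_
        fin_cases i <;> rfl
      · refine Eq.trans ?_ hbc.symm
        refine (pi0Fixed_comp H rfl _ _ (fun g => GammaHom.smul_of_num g _) e).trans
          (pi0Fixed_comp H ?_ _ _ _ e).symm
        refine GammaHom.ext_num fun i => ?_
        fin_cases i <;> rfl
    rw [h1, h2]
    refine (pi0Fixed_comp H rfl _ _ (fun g => GammaHom.smul_of_num g _) e).trans
      (pi0Fixed_comp H ?_ _ _ _ e).symm
    refine GammaHom.ext_num fun i => ?_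
    fin_cases i <;> rfl
  · have h : μ (r ![some 0] a) = a :=
      (pi0Fixed_comp H rfl _ _ (fun g => GammaHom.smul_of_num g _) a).trans
        (pi0Fixed_id H (GammaHom.ext_num fun i => by fin_cases i; rfl) _ a)
    refine (mul_eq' (d := r ![some 0] a) ?_ ?_).trans h
    · exact (pi0Fixed_comp H rfl _ _ (fun g => GammaHom.smul_of_num g _) a).trans
        (pi0Fixed_id H (GammaHom.ext_num fun i => by fin_cases i; rfl) _ a)
    · exact (pi0Fixed_comp H rfl _ _ (fun g => GammaHom.smul_of_num g _) a).trans
        (pi0Fixed_zero H (GammaHom.ext_num fun i => by fin_cases i; rfl) _ a)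
  · exact (mul_eq' (hw a).1 rfl).trans (hw a).2

end GammaGSpace

/-! ### Inverses -/

namespace GammaHom

variable {S : GammaObj G}

/-- The map `S ∧ 2 → S ∧ 2` that interchanges the elements of `2`. -/
def smashSwap (S : GammaObj G) : GammaHom (S.smash 2) (S.smash 2) :=
  ⟨fun t => Option.map (fun k : Fin (S.n * 2) =>
    finProdFinEquiv ((finProdFinEquiv.symm k).1, (finProdFinEquiv.symm k).2.rev)) t, rfl⟩

theorem smashSwap_pair (s : S.carrier) (j : Fin 2) :
    (smashSwap S).toFun (pair s j) = pair s j.rev := by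
  rcases s with _ | i
  · rfl
  · exact congrArg (fun q : Fin S.n × Fin 2 => (some (finProdFinEquiv (q.1, q.2.rev)) :
      Option (Fin (S.n * 2)))) (Equiv.symm_apply_apply finProdFinEquiv (i, j))

theorem smul_smashSwap (g : G) : g • smashSwap S = smashSwap S := by
  ext t
  induction t using pair_cases with
  | h s j => rw [smul_toFun, smul_pair, smashSwap_pair, smashSwap_pair, smul_pair, smul_inv_smul]

theorem smashMu_smashSwap : (smashMu S).comp (smashSwap S) = smashMu S := by
  ext t
  induction t using pair_cases with
  | h s j => simp only [comp, smashSwap_pair, smashMu_pair]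

/-- The isomorphism `1 ∧ 2 ≅ 2`. -/
def oneSmash (G : Type u) [Group G] : GammaHom ((GammaObj.num G 1).smash 2) (GammaObj.num G 2) :=
  ⟨fun t => Option.map (fun k : Fin (1 * 2) => (finProdFinEquiv.symm k).2) t, rfl⟩

theorem oneSmash_pair (s : (GammaObj.num G 1).carrier) (j : Fin 2) :
    (oneSmash G).toFun (pair s j) = Option.map (fun _ : Fin 1 => j) s := by
  rcases s with _ | i
  · rfl
  · exact congrArg (fun q : Fin 1 × Fin 2 => some q.2)
      (Equiv.symm_apply_apply finProdFinEquiv (i, j))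

theorem smul_oneSmash (g : G) : g • oneSmash G = oneSmash G := by
  ext t
  induction t using pair_cases with
  | h s j => rw [smul_toFun, smul_pair, smul_num, smul_num]

theorem mu_oneSmash : (mu G).comp (oneSmash G) = smashMu (GammaObj.num G 1) := by
  ext t
  induction t using pair_cases with
  | h s j =>
    change (mu G).toFun ((oneSmash G).toFun (pair s j)) = _
    rw [oneSmash_pair, smashMu_pair]
    rcases s with _ | i
    · rfl
    · exact congrArg some (Subsingleton.elim (α := Fin 1) _ _)

theorem proj_oneSmash (j : Fin 2) : (proj (GammaObj.num G 2) j).comp (oneSmash G) =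
    proj ((GammaObj.num G 1).smash 2) (finProdFinEquiv ((0 : Fin 1), j)) := by
  ext t
  induction t using pair_cases with
  | h s k =>
    refine Eq.trans ?_ (proj_pair (S := GammaObj.num G 1) (0 : Fin 1) j s k).symm
    rw [proj_num_one]
    change (proj (GammaObj.num G 2) _).toFun ((oneSmash G).toFun (pair s k)) = _
    rw [oneSmash_pair]
    rcases s with _ | i
    · refine (map_pt _).trans ?_
      split_ifs <;> rfl
    · obtain rfl : i = (0 : Fin 1) := Subsingleton.elim (α := Fin 1) _ _
      exact proj_el (S := GammaObj.num G 2) j k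

theorem smashFst_one : smashFst (GammaObj.num G 1) =
    proj ((GammaObj.num G 1).smash 2) (finProdFinEquiv ((0 : Fin 1), (0 : Fin 2))) := by
  refine Eq.trans ?_ (proj_comp_smashFst (S := GammaObj.num G 1) (0 : Fin 1))
  rw [proj_num_one]
  rfl

theorem smashFst_smashSwap : (smashFst (GammaObj.num G 1)).comp (smashSwap _) =
    proj ((GammaObj.num G 1).smash 2) (finProdFinEquiv ((0 : Fin 1), (1 : Fin 2))) := by
  ext t
  induction t using pair_cases with
  | h s k =>
    refine Eq.trans ?_ (proj_pair (S := GammaObj.num G 1) (0 : Fin 1) (1 : Fin 2) s k).symm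
    rw [proj_num_one]
    change (smashFst _).toFun ((smashSwap _).toFun (pair s k)) = _
    rw [smashSwap_pair, smashFst_pair]
    fin_cases k <;> rfl

end GammaHom

namespace GammaGSpace

variable {X : GammaGSpace G} {T : GammaObj G} {K : Subgroup G}

theorem IsUnitPt.mono {K' : Subgroup G} {y : X.obj T} (h : X.IsUnitPt T K y) (hK : K' ≤ K) :
    X.IsUnitPt T K' y := by
  obtain ⟨d, hd, h1, h2⟩ := h
  exact ⟨d, fixedPoints_anti hK hd, h1.mono (fixedPoints_anti hK), h2.mono (fixedPoints_anti hK)⟩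

/-- A pair of inverse elements consists of units. -/
theorem IsSpecial.isUnitPt_witness (hX : X.IsSpecial) {d : X.obj ((GammaObj.num G 1).smash 2)}
    (hd : d ∈ MulAction.fixedPoints K (X.obj ((GammaObj.num G 1).smash 2)))
    (h : JoinedIn (MulAction.fixedPoints K (X.obj (GammaObj.num G 1)))
      (X.map (GammaHom.smashMu (GammaObj.num G 1)) d) (X.base _)) :
    X.IsUnitPt ((GammaObj.num G 1).smash 2) K d := by
  have key : ∀ j : Fin 2, X.IsUnitPt (GammaObj.num G 1) K (X.map (GammaHom.proj
      ((GammaObj.num G 1).smash 2) (finProdFinEquiv ((0 : Fin 1), j))) d) := by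
    refine Fin.forall_fin_two.2 ⟨⟨d, hd, h, ?_⟩, ⟨X.map (GammaHom.smashSwap _) d,
      X.map_mem_fixedPoints (fun k _ => GammaHom.smul_smashSwap k) hd, ?_, ?_⟩⟩
    · rw [← GammaHom.smashFst_one]
      exact JoinedIn.refl (X.map_mem_fixedPoints (fun k _ => GammaHom.smul_smashFst k) hd)
    · rwa [← X.map_comp, GammaHom.smashMu_smashSwap]
    · rw [← GammaHom.smashFst_smashSwap, X.map_comp]
      exact JoinedIn.refl (X.map_mem_fixedPoints (fun k _ => GammaHom.smul_smashFst k)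
        (X.map_mem_fixedPoints (fun k _ => GammaHom.smul_smashSwap k) hd))
  refine hX.isUnitPt hd fun o => ?_
  have e : GammaObj.rep o = (finProdFinEquiv ((0 : Fin 1), (finProdFinEquiv.symm
      (GammaObj.rep o : Fin (1 * 2))).2) : Fin (1 * 2)) := by
    refine (finProdFinEquiv.apply_symm_apply (GammaObj.rep o : Fin (1 * 2))).symm.trans ?_
    exact congrArg finProdFinEquiv (Prod.ext (Subsingleton.elim (α := Fin 1) _ _) rfl)
  refine IsUnitPt.mono ?_ (GammaObj.stab_le _)
  exact e ▸ key (finProdFinEquiv.symm (GammaObj.rep o : Fin (1 * 2))).2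

variable (X T K) in
/-- The map `(C U X)(T)^K → X(T)^K`; up to homotopy it is the inclusion of the unit components. -/
def counit : C(MulAction.fixedPoints K ((phi X).units.coalescence.obj T),
    MulAction.fixedPoints K (X.obj T)) :=
  (X.unitsEv T K).comp (GammaOSpace.aug (phi X).units T K)

theorem counit_map {T' : GammaObj G} {f : GammaHom T T'} (hf : ∀ k ∈ K, k • f = f)
    (z : MulAction.fixedPoints K ((phi X).units.coalescence.obj T))
    (hz : (phi X).units.coalescence.map f z.1 ∈
      MulAction.fixedPoints K ((phi X).units.coalescence.obj T')) :
    (X.counit T' K ⟨_, hz⟩).1 = X.map f (X.counit T K z).1 :=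
  (congrArg (fun y => (X.unitsEv T' K y).1)
    ((phi X).units.aug_restrHom le_rfl hf z hz)).trans (X.unitsEv_actOn le_rfl hf _)

theorem joined_of_counit {z z' : MulAction.fixedPoints K ((phi X).units.coalescence.obj T)}
    (h : JoinedIn (MulAction.fixedPoints K (X.obj T)) (X.counit T K z).1 (X.counit T K z').1) :
    Joined z z' :=
  (GammaOSpace.isFiberRetraction_aug (phi X).units T K).isWeakEquiv.joined_iff.1
    ((X.isPathInclusion_unitsEv T K).joined
      ((joinedIn_iff_joined (X.counit T K z).2 (X.counit T K z').2).1 h))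

theorem isUnitPt_counit (z : MulAction.fixedPoints K ((phi X).units.coalescence.obj T)) :
    X.IsUnitPt T K (X.counit T K z).1 :=
  (X.mem_range_unitsEv (X.counit T K z).2).1 ⟨_, rfl⟩

theorem IsUnitPt.exists_counit_eq {y : X.obj T} (h : X.IsUnitPt T K y)
    (hy : y ∈ MulAction.fixedPoints K (X.obj T)) :
    ∃ z : MulAction.fixedPoints K ((phi X).units.coalescence.obj T), (X.counit T K z).1 = y := by
  obtain ⟨x, hx⟩ := (X.mem_range_unitsEv hy).2 h
  refine ⟨GammaOSpace.augSection (phi X).units T K x, ?_⟩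
  have h1 : GammaOSpace.aug (phi X).units T K (GammaOSpace.augSection (phi X).units T K x) = x :=
    GammaOSpace.aug_augSection x
  change (X.unitsEv T K (GammaOSpace.aug (phi X).units T K _)).1 = y
  rw [h1, hx]

/-- A witness `d` that the image in `X(1)^K` is a unit is itself a unit, hence comes from a point
`w` of `(C U X)(1 ∧ 2)^K`. -/
theorem IsSpecial.exists_inverse (hX : X.IsSpecial) (a : ZerothHomotopy
      (MulAction.fixedPoints K ((phi X).units.coalescence.obj (GammaObj.num G 1)))) :
    ∃ d, (phi X).units.coalescence.pi0Fixed (GammaHom.proj _ (0 : Fin 2)) (smul_proj_num 2 0) K d =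
        a ∧ (phi X).units.coalescence.pi0Fixed (GammaHom.mu G) GammaHom.smul_mu K d =
          ZerothHomotopy.mk ⟨(phi X).units.coalescence.base _, base_mem_fixedPoints _⟩ := by
  induction a with
  | mk z =>
  obtain ⟨d, hd, h1, h2⟩ := isUnitPt_counit z
  obtain ⟨w, rfl⟩ := (hX.isUnitPt_witness hd h1).exists_counit_eq hd
  refine ⟨(phi X).units.coalescence.pi0Fixed (GammaHom.oneSmash G) GammaHom.smul_oneSmash K
    (ZerothHomotopy.mk w), ?_, ?_⟩
  · refine (pi0Fixed_comp K ((GammaHom.proj_oneSmash 0).trans GammaHom.smashFst_one.symm) _ _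
      GammaHom.smul_smashFst _).trans (mk_eq_mk_iff_joined.2 (joined_of_counit ?_))
    refine (congrArg (fun y => JoinedIn (MulAction.fixedPoints K (X.obj (GammaObj.num G 1))) y
      (X.counit _ K z).1) ?_).mpr h2
    exact counit_map (fun k _ => GammaHom.smul_smashFst k) w _
  · refine (pi0Fixed_comp K GammaHom.mu_oneSmash _ _ GammaHom.smul_smashMu _).trans
      (Eq.trans ?_ (pi0Fixed_zero K rfl GammaHom.smul_zero (ZerothHomotopy.mk w)))
    refine mk_eq_mk_iff_joined.2 (joined_of_counit ?_)
    refine (congrArg₂ (JoinedIn (MulAction.fixedPoints K (X.obj (GammaObj.num G 1))))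
      ?_ ?_).mpr h1
    · exact counit_map (fun k _ => GammaHom.smul_smashMu k) w _
    · exact (counit_map (fun k _ => GammaHom.smul_zero k) w _).trans (X.map_zero_eq_base _)

end GammaGSpace

end

end EquivGamma

theorem mainTheorem9 {G : Type u} [Group G] [Finite G] (X : EquivGamma.GammaGSpace G)
    (hX : X.IsSpecial) :
    (EquivGamma.phi X).units.coalescence.IsVerySpecial :=
  ⟨hX.coalescence_units, fun _ => hX.coalescence_units.exists_group hX.exists_inverse⟩
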